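/- \textbf{Setting.} Let $N>0$ and $\underline k=(\mathtt m,\mathtt n)\in\mathbb Z^2$ with $\mathtt m,\mathtt n>0$. For $v=(v_1,v_2)\in\mathbb R^2$ put $v^\perp=(v_2,-v_1)$, $\nabla^\perp=(\partial_y,-\partial_x)$, $\Omega(v)=N v_1/|v|$ for $v\ne0$ and $\Omega(0)=0$. Let $c=N\mathtt m|\underline k|^{-3}\underline k$ and $$b_\epsilon=\epsilon\sin(\underline k\cdot x),\qquad \omega_\epsilon=\epsilon\tfrac{|\underline k|}{N}\sin(\underline k\cdot x),\qquad \psi_\epsilon=\tfrac{\epsilon}{N|\underline k|}\sin(\underline k\cdot x).$$ For $\mu\in\mathbb R^2$ let $\mathcal L_{\mu,\epsilon}$ be the operator from $H^1(\mathbb T^2;\mathbb C^2)$ to $L^2(\mathbb T^2;\mathbb C^2)$, $\mathbb T=\mathbb R/2\pi\mathbb Z$, $$\mathcal L_{\mu,\epsilon}=c\cdot(\nabla+i\mu)+\begin{pmatrix}-\nabla^\perp\psi_\epsilon\cdot(\nabla+i\mu)&\bigl(-N^2(\partial_x+i\mu_1)-\nabla b_\epsilon\cdot(\nabla^\perp+i\mu^\perp)\bigr)|D+\mu|^{-2}\\-(\partial_x+i\mu_1)&-\nabla^\perp\psi_\epsilon\cdot(\nabla+i\mu)-\nabla\omega_\epsilon\cdot(\nabla^\perp+i\mu^\perp)|D+\mu|^{-2}\end{pmatrix},$$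 where $|D+\mu|^{-2}$ is the Fourier multiplier with symbol $|q+\mu|^{-2}$ (and $0$ where $q+\mu=0$), and let $\mathscr L_{\mu,\epsilon}$ be its restriction $H^1_{\underline k}\to H^0_{\underline k}$ to the functions whose Fourier coefficients are supported on $\underline k\mathbb Z$. Let $$\mathcal R_{\underline k}=\{0\}\cup\{\mu\neq0:\ \Omega(\underline k)-\Omega(\underline k+\mu)=\Omega(\mu)\},\qquad w^\sigma_{\ell}(\mu)=c\cdot(\ell\underline k+\mu)+\sigma\,\Omega(\ell\underline k+\mu)\quad(\ell\in\mathbb Z,\ \sigma=\pm),$$ let $\mathcal D_{\underline k}$ be the set of those $\mu\in\mathcal R_{\underline k}$ for which there is no $\alpha>0$ with $|w^+_\ell(\mu)-w^+_0(\mu)|\ge\alpha$ for all $\ell\ne0$ and $|w^-_\ell(\mu)-w^-_1(\mu)|\ge\alpha$ for all $\ell\neq1$, and let $\lambda^+=i\,w_0^+(\mu)$. Put $$f^-_{\underline k}=\tfrac1{\sqrt2}\begin{pmatrix}N\\|\underline k+\mu|\end{pmatrix}e^{i\underline k\cdot x},\qquad f^+_0=\tfrac1{\sqrt2}\begin{pmatrix}N\\-|\mu|\end{pmatrix}.$$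 Below $r(\epsilon^p)$, with or without an index, denotes a real-valued function of $\epsilon$, analytic near $\epsilon=0$ and $O(\epsilon^p)$ (depending on $\mu$); $\sqrt{\cdot}$ of a real number is the principal complex square root. \textbf{Theorem.} The set $\mathcal D_{\underline k}$ is discrete. Let $\mu\in\mathcal R_{\underline k}\setminus\mathcal D_{\underline k}$. Then $\lambda^+$ is an isolated point of the spectrum of $\mathscr L_{\mu,0}$. Let $\Gamma$ be a counterclockwise circle centred at $\lambda^+$ such that $\lambda^+$ is the only point of the spectrum of $\mathscr L_{\mu,0}$ on or inside $\Gamma$. There is $\epsilon_0>0$ such that for all $\epsilon\in(0,\epsilon_0)$ the circle $\Gamma$ lies in the resolvent set of $\mathscr L_{\mu,\epsilon}$; the range $\mathcal V_{\mu,\epsilon}$ of $P_{\mu,\epsilon}=-\frac1{2\pi i}\oint_\Gamma(\mathscr L_{\mu,\epsilon}-\lambda)^{-1}d\lambda$ is a two-dimensional subspace of $H^1_{\underline k}$, invariant under $\mathscr L_{\mu,\epsilon}$, with basis $P_{\mu,\epsilon}f^-_{\underline k},\,P_{\mu,\epsilon}f^+_0$; and in this basis $\mathcal L_{\mu,\epsilon}:\mathcal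 V_{\mu,\epsilon}\to\mathcal V_{\mu,\epsilon}$ is represented by $$\begin{pmatrix}\lambda^++i\,r_1(\epsilon^2)& i\,b_0(\mu)\epsilon+i\,r_2(\epsilon^2)\\ i\,b_1(\mu)\epsilon+i\,r_3(\epsilon^2)&\lambda^++i\,r_4(\epsilon^2)\end{pmatrix},$$ $$b_1(\mu)=(\underline k^\perp\cdot\mu)\frac{(|\underline k+\mu|-|\underline k|)(|\underline k+\mu|+|\underline k|-|\mu|)}{4N|\underline k||\mu||\underline k+\mu|},\qquad b_0(\mu)=-(\underline k^\perp\cdot\mu)\frac{(|\underline k|+|\mu|)(|\underline k+\mu|+|\underline k|-|\mu|)}{4N|\underline k||\mu||\underline k+\mu|}.$$ Its eigenvalues, counted with algebraic multiplicity, are $$\lambda^\pm(\mu,\epsilon)=\lambda^++i\,r(\epsilon^2)\pm\epsilon\sqrt{\mathtt e(\mu)+r(\epsilon)},$$ $$\mathtt e(\mu)=-b_1(\mu)b_0(\mu)=(\underline k^\perp\cdot\mu)^2\,\frac{(|\underline k+\mu|-|\underline k|)(|\underline k|+|\mu|)(|\underline k+\mu|+|\underline k|-|\mu|)^2}{16N^2|\mu|^2|\underline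 k+\mu|^2|\underline k|^2}.$$ Moreover, for every real $y\notin\{0,-\mathtt n\}$ there is exactly one $x=\varphi(y)$ with $(x,y)\in\mathcal R_{\underline k}$, and: (1) along $\mu(\tau)=(\varphi(\mathtt n\tau),\mathtt n\tau)$, $\tau\ne0$, $$\mathtt e(\mu(\tau))=\frac{\mathtt m^2\mathtt n^2}{4N^2|\underline k|^2}\,\tau+O(\tau^2)\quad(\tau\to0),$$ so that $\mathtt e(\mu(\tau))>0$ for all small $\tau>0$; (2) along $\mu(\tau)=(\varphi(\tau),\tau)$, $$\mathtt e(\mu(\tau))=\frac{\mathtt m^2}{256N^2|\underline k|^6}\bigl(\mathtt n-\sqrt{3\mathtt m^2+4\mathtt n^2}\bigr)^2\bigl(3\mathtt m^2+2\mathtt n^2+\mathtt n\sqrt{3\mathtt m^2+4\mathtt n^2}\bigr)^2+O(\tau^{-1})\quad(\tau\to+\infty),$$ where the constant is positive, so that $\mathtt e(\mu(\tau))>0$ for all large $\tau$. -/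

import Mathlib

open MeasureTheory Topology Filter Asymptotics
open scoped ENNReal

noncomputable section

namespace Boussinesq

/-! ### The torus, its Fourier series, and the plane of wavevectors

The torus `ℝ² / (2πℤ)²` is parametrised by `t ∈ (ℝ / ℤ)²` through `x = 2πt`.  Thus
`UnitAddTorus.mFourier q` is the function `x ↦ exp (i q·x)`, the Haar probability measure is
`(2π)⁻² dx`, and `∂ⱼ` (with respect to `x`) is the Fourier multiplier with symbol `i qⱼ`. -/

abbrev Torus : Type := UnitAddTorus (Fin 2)

/-- Wavevectors in `ℤ²`. -/
abbrev Freq : Type := Fin 2 → ℤ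

/-- The plane `ℝ²` with the Euclidean norm. -/
abbrev Plane : Type := EuclideanSpace ℝ (Fin 2)

abbrev torusMeasure : Measure Torus :=
  Measure.pi fun _ : Fin 2 => (AddCircle.haarAddCircle : Measure UnitAddCircle)

/-- `L²(𝕋²; ℂ)`. -/
abbrev L2 : Type := Lp ℂ 2 torusMeasure

/-- `L²(𝕋²; ℂ) × L²(𝕋²; ℂ)`, whose elements are the pairs `(b, ω)`. -/
abbrev X : Type := L2 × L2

/-- An integer wavevector as a vector of the plane. -/
def vec (q : Freq) : Plane := !₂[(q 0 : ℝ), (q 1 : ℝ)]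

/-- `v^⊥ = (v₂, -v₁)`. -/
def perp (v : Plane) : Plane := !₂[v 1, -v 0]

/-- The Hilbert basis `x ↦ exp (i q·x)` of `L²(𝕋²)`. -/
def expBasis : HilbertBasis Freq ℂ L2 := UnitAddTorus.mFourierBasis

/-- The Fourier coefficient of `f` at `q`. -/
def coeff (f : L2) (q : Freq) : ℂ := expBasis.repr f q

theorem coeff_eq_integral (f : L2) (q : Freq) :
    coeff f q = ∫ t, UnitAddTorus.mFourier (-q) t * f t ∂torusMeasure :=
  UnitAddTorus.mFourierBasis_repr f q

theorem coeff_add (f g : L2) (q : Freq) : coeff (f + g) q = coeff f q + coeff g q := by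
  simp [coeff]

theorem coeff_smul (a : ℂ) (f : L2) (q : Freq) : coeff (a • f) q = a * coeff f q := by
  simp [coeff]

theorem coeff_neg (f : L2) (q : Freq) : coeff (-f) q = -coeff f q := by
  simp [coeff]

theorem coeff_sub (f g : L2) (q : Freq) : coeff (f - g) q = coeff f q - coeff g q := by
  simp [coeff]

theorem coeff_zero (q : Freq) : coeff 0 q = 0 := by
  simp [coeff]

theorem coeff_ext {f g : L2} (h : ∀ q, coeff f q = coeff g q) : f = g :=
  expBasis.repr.injective (by ext q; exact h q)

theorem memlp_coeff (f : L2) : Memℓp (coeff f) 2 := lp.memℓp (expBasis.repr f)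

/-- The Fourier multiplier with symbol `a`: it sends `f` to the function with Fourier
coefficients `a q * coeff f q`, if those are square summable (otherwise the value is `0`). -/
def fourierMul (a : Freq → ℂ) (f : L2) : L2 :=
  open Classical in
  if h : Memℓp (fun q => a q * coeff f q) 2 then expBasis.repr.symm ⟨_, h⟩ else 0

theorem coeff_fourierMul {a : Freq → ℂ} {f : L2} (h : Memℓp (fun q => a q * coeff f q) 2)
    (q : Freq) : coeff (fourierMul a f) q = a q * coeff f q := by
  rw [fourierMul, dif_pos h, coeff, LinearIsometryEquiv.apply_symm_apply]

theorem coeff_fourierMul_of_eq_zero (a : Freq → ℂ) {f : L2} {q : Freq} (hq : coeff f q = 0) :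
    coeff (fourierMul a f) q = 0 := by
  by_cases h : Memℓp (fun q => a q * coeff f q) 2
  · rw [coeff_fourierMul h, hq, mul_zero]
  · simp [fourierMul, h, coeff_zero]

theorem fourierMul_add {a : Freq → ℂ} {f g : L2} (hf : Memℓp (fun q => a q * coeff f q) 2)
    (hg : Memℓp (fun q => a q * coeff g q) 2) :
    fourierMul a (f + g) = fourierMul a f + fourierMul a g := by
  refine coeff_ext fun q => ?_
  have h : Memℓp (fun q => a q * coeff (f + g) q) 2 := by
    convert hf.add hg using 1
    ext q
    simp [coeff_add, mul_add]
  rw [coeff_fourierMul h, coeff_add, coeff_add, coeff_fourierMul hf, coeff_fourierMul hg, mul_add]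

theorem fourierMul_smul {a : Freq → ℂ} {f : L2} (c : ℂ)
    (hf : Memℓp (fun q => a q * coeff f q) 2) :
    fourierMul a (c • f) = c • fourierMul a f := by
  refine coeff_ext fun q => ?_
  have h : Memℓp (fun q => a q * coeff (c • f) q) 2 := by
    convert hf.const_smul c using 1
    ext q
    simp [coeff_smul, mul_left_comm]
  rw [coeff_fourierMul h, coeff_smul, coeff_smul, coeff_fourierMul hf]
  ring

/-- The Sobolev space `H¹(𝕋²; ℂ)`. -/
def H1 : Submodule ℂ L2 where
  carrier := {f | Memℓp (fun q => (1 + ‖vec q‖ : ℂ) * coeff f q) 2}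
  add_mem' {f g} hf hg := by
    have h := Memℓp.add hf hg
    simp only [Set.mem_ofPred_eq]
    convert h using 1
    ext q
    simp [coeff_add, mul_add]
  zero_mem' := by
    simp only [Set.mem_ofPred_eq, coeff_zero, mul_zero]
    exact zero_memℓp
  smul_mem' c f hf := by
    have h := Memℓp.const_smul hf c
    simp only [Set.mem_ofPred_eq]
    convert h using 1
    ext q
    simp [coeff_smul, mul_left_comm]

theorem memlp_of_le {a b : Freq → ℂ} (ha : Memℓp a 2) (C : ℝ) (h : ∀ q, ‖b q‖ ≤ C * ‖a q‖) :
    Memℓp b 2 := by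
  have h2 : (0 : ℝ) < (2 : ℝ≥0∞).toReal := by norm_num
  rw [memℓp_gen_iff h2] at ha ⊢
  refine Summable.of_nonneg_of_le (fun q => by positivity) (fun q => ?_) (ha.mul_left (C ^ 2))
  have := pow_le_pow_left₀ (norm_nonneg _) (h q) 2
  simpa [mul_pow] using this

/-- `∂ⱼ + i μⱼ`. -/
def shiftedD (μ : Plane) (j : Fin 2) (f : L2) : L2 :=
  fourierMul (fun q => Complex.I * (vec q + μ) j) f

/-- `|D + μ|⁻²`, the Fourier multiplier with symbol `|q + μ|⁻²`
(with the convention that the symbol is `0` at a `q` with `q + μ = 0`). -/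
def invLap (μ : Plane) (f : L2) : L2 :=
  fourierMul (fun q => ((‖vec q + μ‖ ^ 2)⁻¹ : ℝ)) f

/-- `v · (∇ + i μ)`. -/
def shiftedGrad (μ v : Plane) (f : L2) : L2 :=
  (v 0 : ℂ) • shiftedD μ 0 f + (v 1 : ℂ) • shiftedD μ 1 f

/-- `v · (∇^⊥ + i μ^⊥)`, where `∇^⊥ = (∂_y, -∂_x)`. -/
def shiftedPerpGrad (μ v : Plane) (f : L2) : L2 :=
  (v 0 : ℂ) • shiftedD μ 1 f - (v 1 : ℂ) • shiftedD μ 0 f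

/-- The function `x ↦ cos (k·x)`. -/
def cosWave (k : Freq) : C(Torus, ℂ) :=
  (1 / 2 : ℂ) • (UnitAddTorus.mFourier k + UnitAddTorus.mFourier (-k))

/-- Multiplication by `cos (k·x)`. -/
def mulCos (k : Freq) (f : L2) : L2 :=
  ContinuousMap.toLp (E := ℂ) ∞ torusMeasure ℂ (cosWave k) • f

theorem mulCos_add (k : Freq) (f g : L2) : mulCos k (f + g) = mulCos k f + mulCos k g :=
  Lp.add_smul _ _ _

theorem mulCos_sub (k : Freq) (f g : L2) : mulCos k (f - g) = mulCos k f - mulCos k g := by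
  have h := mulCos_add k (f - g) g
  rw [sub_add_cancel] at h
  exact eq_sub_of_add_eq h.symm

theorem mulCos_smul (k : Freq) (c : ℂ) (f : L2) : mulCos k (c • f) = c • mulCos k f :=
  (Lp.smul_comm _ _ _).symm

theorem coeff_mulCos (k : Freq) (f : L2) (q : Freq) :
    coeff (mulCos k f) q = (coeff f (q - k) + coeff f (q + k)) / 2 := by
  have hint : ∀ p : Freq, Integrable (fun t => UnitAddTorus.mFourier p t * f t) torusMeasure := by
    intro p
    refine Integrable.bdd_mul (c := 1) ((Lp.memLp f).integrable (by norm_num))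
      (UnitAddTorus.mFourier p).continuous.aestronglyMeasurable (Eventually.of_forall fun t => ?_)
    exact (ContinuousMap.norm_coe_le_norm _ t).trans UnitAddTorus.mFourier_norm.le
  simp only [coeff_eq_integral]
  rw [← integral_add (hint _) (hint _), ← integral_div]
  refine integral_congr_ae ?_
  filter_upwards [Lp.coeFn_lpSMul (r := 2)
      (ContinuousMap.toLp (E := ℂ) ∞ torusMeasure ℂ (cosWave k)) f,
    ContinuousMap.coeFn_toLp (E := ℂ) (p := ∞) (𝕜 := ℂ) torusMeasure (cosWave k)] with t h1 h2
  have e1 : -(q - k) = -q + k := by abel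
  have e2 : -(q + k) = -q + -k := by abel
  rw [mulCos, h1, Pi.smul_apply', h2, e1, e2, UnitAddTorus.mFourier_add, UnitAddTorus.mFourier_add]
  simp only [cosWave, ContinuousMap.smul_apply, ContinuousMap.add_apply, smul_eq_mul]
  ring

theorem memlp_shiftedD {f : L2} (hf : f ∈ H1) (μ : Plane) (j : Fin 2) :
    Memℓp (fun q => (Complex.I * (vec q + μ) j : ℂ) * coeff f q) 2 := by
  refine memlp_of_le hf (1 + ‖μ‖) fun q => ?_
  have h1 : |(vec q + μ) j| ≤ ‖vec q + μ‖ := by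
    simpa using PiLp.norm_apply_le (vec q + μ) j
  have h2 : ‖vec q + μ‖ ≤ (1 + ‖μ‖) * (1 + ‖vec q‖) := by
    nlinarith [norm_add_le (vec q) μ, norm_nonneg μ, norm_nonneg (vec q),
      mul_nonneg (norm_nonneg μ) (norm_nonneg (vec q))]
  have h3 : ‖(1 + ‖vec q‖ : ℂ)‖ = 1 + ‖vec q‖ := by
    rw [← Complex.ofReal_one, ← Complex.ofReal_add, Complex.norm_real, Real.norm_of_nonneg]
    positivity
  rw [norm_mul, norm_mul, norm_mul, h3, Complex.norm_I, one_mul, Complex.norm_real,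
    Real.norm_eq_abs, ← mul_assoc]
  exact mul_le_mul_of_nonneg_right (h1.trans h2) (norm_nonneg _)

theorem exists_bound_invLap (μ : Plane) : ∃ C : ℝ, ∀ q : Freq, (‖vec q + μ‖ ^ 2)⁻¹ ≤ C := by
  have hfin : {q : Freq | ‖vec q + μ‖ < 1}.Finite := by
    refine (Set.finite_Icc (fun _ => -⌈1 + ‖μ‖⌉ : Freq) (fun _ => ⌈1 + ‖μ‖⌉)).subset ?_
    intro q hq
    have hq' : ‖vec q + μ‖ < 1 := hq
    have h0 : ‖vec q‖ ≤ 1 + ‖μ‖ := by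
      have := norm_sub_le (vec q + μ) μ
      rw [add_sub_cancel_right] at this
      linarith
    have h1 : ∀ j, |(q j : ℝ)| ≤ 1 + ‖μ‖ := by
      intro j
      refine le_trans ?_ h0
      have := PiLp.norm_apply_le (vec q) j
      fin_cases j <;> simpa [vec] using this
    have h2 : ∀ j, |q j| ≤ ⌈1 + ‖μ‖⌉ := by
      intro j
      have := (h1 j).trans (Int.le_ceil _)
      exact_mod_cast this
    exact ⟨fun j => (abs_le.1 (h2 j)).1, fun j => (abs_le.1 (h2 j)).2⟩
  obtain ⟨C, hC⟩ := (hfin.image fun q => (‖vec q + μ‖ ^ 2)⁻¹).bddAbove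
  refine ⟨max C 1, fun q => ?_⟩
  by_cases hq : ‖vec q + μ‖ < 1
  · exact (hC (Set.mem_image_of_mem _ hq)).trans (le_max_left _ _)
  · refine (inv_le_one_of_one_le₀ ?_).trans (le_max_right _ _)
    exact one_le_pow₀ (not_lt.1 hq)

theorem memlp_invLap (f : L2) (μ : Plane) :
    Memℓp (fun q => (((‖vec q + μ‖ ^ 2)⁻¹ : ℝ) : ℂ) * coeff f q) 2 := by
  obtain ⟨C, hC⟩ := exists_bound_invLap μ
  refine memlp_of_le (memlp_coeff f) C fun q => ?_
  rw [norm_mul, Complex.norm_real, Real.norm_of_nonneg (by positivity)]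
  exact mul_le_mul_of_nonneg_right (hC q) (norm_nonneg _)

theorem memlp_shiftedD_invLap (f : L2) (μ : Plane) (j : Fin 2) :
    Memℓp (fun q => (Complex.I * (vec q + μ) j : ℂ) * coeff (invLap μ f) q) 2 := by
  obtain ⟨C, hC⟩ := exists_bound_invLap μ
  refine memlp_of_le (memlp_coeff f) (1 + C) fun q => ?_
  rw [invLap, coeff_fourierMul (memlp_invLap f μ), ← mul_assoc, norm_mul, norm_mul, norm_mul,
    Complex.norm_I, one_mul, Complex.norm_real, Complex.norm_real, Real.norm_eq_abs,
    Real.norm_of_nonneg (by positivity)]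
  refine mul_le_mul_of_nonneg_right ?_ (norm_nonneg _)
  have h1 : |(vec q + μ) j| ≤ ‖vec q + μ‖ := by
    simpa using PiLp.norm_apply_le (vec q + μ) j
  have h2 : ‖vec q + μ‖ * (‖vec q + μ‖ ^ 2)⁻¹ ≤ 1 + (‖vec q + μ‖ ^ 2)⁻¹ := by
    have hp : 0 ≤ (‖vec q + μ‖ ^ 2)⁻¹ := by positivity
    rcases le_total ‖vec q + μ‖ 1 with h | h
    · nlinarith
    · have hpos : 0 < ‖vec q + μ‖ := by linarith
      have h4 : ‖vec q + μ‖ * (‖vec q + μ‖ ^ 2)⁻¹ = ‖vec q + μ‖⁻¹ := by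
        field_simp
      rw [h4]
      have := inv_le_one_of_one_le₀ h
      linarith
  exact (mul_le_mul_of_nonneg_right h1 (by positivity)).trans
    (h2.trans (by linarith [hC q]))

theorem shiftedD_add {f g : L2} (hf : f ∈ H1) (hg : g ∈ H1) (μ : Plane) (j : Fin 2) :
    shiftedD μ j (f + g) = shiftedD μ j f + shiftedD μ j g :=
  fourierMul_add (memlp_shiftedD hf μ j) (memlp_shiftedD hg μ j)

theorem shiftedD_smul {f : L2} (c : ℂ) (hf : f ∈ H1) (μ : Plane) (j : Fin 2) :
    shiftedD μ j (c • f) = c • shiftedD μ j f :=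
  fourierMul_smul c (memlp_shiftedD hf μ j)

theorem shiftedD_invLap_add (f g : L2) (μ : Plane) (j : Fin 2) :
    shiftedD μ j (invLap μ (f + g)) = shiftedD μ j (invLap μ f) + shiftedD μ j (invLap μ g) := by
  rw [invLap, fourierMul_add (memlp_invLap f μ) (memlp_invLap g μ)]
  exact fourierMul_add (memlp_shiftedD_invLap f μ j) (memlp_shiftedD_invLap g μ j)

theorem shiftedD_invLap_smul (c : ℂ) (f : L2) (μ : Plane) (j : Fin 2) :
    shiftedD μ j (invLap μ (c • f)) = c • shiftedD μ j (invLap μ f) := by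
  rw [invLap, fourierMul_smul c (memlp_invLap f μ)]
  exact fourierMul_smul c (memlp_shiftedD_invLap f μ j)

/-! ### The linearised operator -/

/-- The speed `c = N k₁ |k|⁻³ k` of the primary plane wave with wavevector `k`. -/
def waveSpeed (N : ℝ) (k : Freq) : Plane := (N * k 0 / ‖vec k‖ ^ 3) • vec k

/-- The expression of `𝓛_{μ,ε}`, obtained by linearising the Boussinesq system at the plane wave
`b_ε = ε sin (k·x)`, `ω_ε = ε |k| N⁻¹ sin (k·x)`, `ψ_ε = ε (N |k|)⁻¹ sin (k·x)` in the frame moving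
with speed `c`, and conjugating with `exp (i μ·x)`; with `Φ = |D + μ|⁻² ω` it reads
* `c·(∇ + iμ) b - ∇^⊥ψ_ε·(∇ + iμ) b - N² (∂_x + iμ₁) Φ - ∇b_ε·(∇^⊥ + iμ^⊥) Φ`,
* `c·(∇ + iμ) ω - (∂_x + iμ₁) b - ∇^⊥ψ_ε·(∇ + iμ) ω - ∇ω_ε·(∇^⊥ + iμ^⊥) Φ`. -/
def linOpFun (N : ℝ) (k : Freq) (μ : Plane) (ε : ℝ) (u : X) : X :=
  (shiftedGrad μ (waveSpeed N k) u.1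
      - ((ε / (N * ‖vec k‖) : ℝ) : ℂ) • mulCos k (shiftedGrad μ (perp (vec k)) u.1)
      - ((N ^ 2 : ℝ) : ℂ) • shiftedD μ 0 (invLap μ u.2)
      - (ε : ℂ) • mulCos k (shiftedPerpGrad μ (vec k) (invLap μ u.2)),
    shiftedGrad μ (waveSpeed N k) u.2
      - shiftedD μ 0 u.1
      - ((ε / (N * ‖vec k‖) : ℝ) : ℂ) • mulCos k (shiftedGrad μ (perp (vec k)) u.2)
      - ((ε * ‖vec k‖ / N : ℝ) : ℂ) • mulCos k (shiftedPerpGrad μ (vec k) (invLap μ u.2)))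

/-- `𝓛_{μ,ε}` as an unbounded operator on `L²(𝕋²; ℂ²)` with domain `H¹(𝕋²; ℂ²)`. -/
def linOp (N : ℝ) (k : Freq) (μ : Plane) (ε : ℝ) : X →ₗ.[ℂ] X where
  domain := H1.prod H1
  toFun :=
    { toFun := fun u => linOpFun N k μ ε u
      map_add' := by
        rintro ⟨⟨b, w⟩, hb, hw⟩ ⟨⟨b', w'⟩, hb', hw'⟩
        simp only [linOpFun, shiftedGrad, shiftedPerpGrad, Submodule.coe_add, Prod.mk_add_mk,
          shiftedD_add hb hb', shiftedD_add hw hw', shiftedD_invLap_add, mulCos_add,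
          mulCos_sub, mulCos_smul, Prod.mk.injEq]
        constructor <;> module
      map_smul' := by
        rintro c ⟨⟨b, w⟩, hb, hw⟩
        simp only [linOpFun, shiftedGrad, shiftedPerpGrad, Submodule.coe_smul, Prod.smul_mk,
          shiftedD_smul c hb, shiftedD_smul c hw, shiftedD_invLap_smul, mulCos_add,
          mulCos_sub, mulCos_smul, Prod.mk.injEq, RingHom.id_apply]
        constructor <;> module }

/-- `H⁰_k`: the functions in `L²(𝕋²; ℂ²)` whose Fourier coefficients are supported on `kℤ`. -/
def Hk (k : Freq) : Submodule ℂ X where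
  carrier := {u | ∀ q, (∀ l : ℤ, q ≠ l • k) → coeff u.1 q = 0 ∧ coeff u.2 q = 0}
  add_mem' {u v} hu hv q hq := by simp [coeff_add, hu q hq, hv q hq]
  zero_mem' q _ := by simp [coeff_zero]
  smul_mem' c u hu q hq := by simp [coeff_smul, hu q hq]

theorem linOpFun_mem_Hk (N : ℝ) (k : Freq) (μ : Plane) (ε : ℝ) {u : X} (hu : u ∈ Hk k) :
    linOpFun N k μ ε u ∈ Hk k := by
  intro q hq
  have hm : ∀ l : ℤ, q - k ≠ l • k := fun l h => hq (l + 1) (by rw [add_smul, one_smul, ← h]; abel)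
  have hp : ∀ l : ℤ, q + k ≠ l • k := fun l h => hq (l - 1) (by rw [sub_smul, one_smul, ← h]; abel)
  have key : ∀ f : L2, (∀ p : Freq, (∀ l : ℤ, p ≠ l • k) → coeff f p = 0) →
      ∀ a : Freq → ℂ, ∀ p : Freq, (∀ l : ℤ, p ≠ l • k) → coeff (fourierMul a f) p = 0 :=
    fun f hf a p h => coeff_fourierMul_of_eq_zero a (hf p h)
  have h1 := key _ fun p h => (hu p h).1
  have h2 := key _ fun p h => (hu p h).2
  have h3 := fun a => key _ (h2 a)
  simp only [linOpFun, shiftedGrad, shiftedPerpGrad, shiftedD, invLap, coeff_sub, coeff_add,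
    coeff_smul, coeff_mulCos, h1 _ _ hq, h1 _ _ hm, h1 _ _ hp, h2 _ _ hq, h2 _ _ hm, h2 _ _ hp,
    h3 _ _ _ hq, h3 _ _ _ hm, h3 _ _ _ hp, mul_zero, add_zero, sub_zero, zero_div, and_self]

/-- The restriction `𝓛_{μ,ε}|_{H¹_k} : H¹_k → H⁰_k`, as an unbounded operator on `H⁰_k` with domain
`H¹_k = H¹ ∩ H⁰_k`. -/
def restrictedOp (N : ℝ) (k : Freq) (μ : Plane) (ε : ℝ) : Hk k →ₗ.[ℂ] Hk k where
  domain := (H1.prod H1).comap (Hk k).subtype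
  toFun :=
    { toFun := fun u => ⟨linOp N k μ ε ⟨u.1, u.2⟩, linOpFun_mem_Hk N k μ ε u.1.2⟩
      map_add' := fun u v => Subtype.ext ((linOp N k μ ε).map_add ⟨u.1, u.2⟩ ⟨v.1, v.2⟩)
      map_smul' := fun c u => Subtype.ext ((linOp N k μ ε).map_smul c ⟨u.1, u.2⟩) }

/-! ### Spectral projections of unbounded operators -/

section Spectral

/-- `R` is a bounded two-sided inverse of `A - z`. -/
def IsResolventAt {E : Type*} [NormedAddCommGroup E] [NormedSpace ℂ E]
    (A : E →ₗ.[ℂ] E) (z : ℂ) (R : E →L[ℂ] E) : Prop :=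
  (∀ g : E, ∃ h : R g ∈ A.domain, A ⟨R g, h⟩ - z • R g = g) ∧
    ∀ f : A.domain, R (A f - z • (f : E)) = f

def resolventSetOf {E : Type*} [NormedAddCommGroup E] [NormedSpace ℂ E]
    (A : E →ₗ.[ℂ] E) : Set ℂ := {z | ∃ R, IsResolventAt A z R}

def spectrumOf {E : Type*} [NormedAddCommGroup E] [NormedSpace ℂ E]
    (A : E →ₗ.[ℂ] E) : Set ℂ := (resolventSetOf A)ᶜ

/-- `(A - z)⁻¹` for `z` in the resolvent set (and `0` otherwise). -/
def resolventOf {E : Type*} [NormedAddCommGroup E] [NormedSpace ℂ E]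
    (A : E →ₗ.[ℂ] E) (z : ℂ) : E →L[ℂ] E :=
  open Classical in if h : ∃ R, IsResolventAt A z R then h.choose else 0

/-- The spectral (Riesz) projection `-(2πi)⁻¹ ∮ (A - z)⁻¹ dz` over the counterclockwise circle with
centre `c` and radius `ρ`. -/
def rieszProj {E : Type*} [NormedAddCommGroup E] [NormedSpace ℂ E]
    (A : E →ₗ.[ℂ] E) (c : ℂ) (ρ : ℝ) : E →L[ℂ] E :=
  -((2 * Real.pi * Complex.I : ℂ)⁻¹ • ∮ z in C(c, ρ), resolventOf A z)

/-- `e` is a basis of the subspace `V`, which lies in the domain of `A` and is invariant under `A`,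
and `M` is the matrix of `A : V → V` in the basis `e`. -/
def IsRepresentedBy {E : Type*} [NormedAddCommGroup E] [NormedSpace ℂ E]
    (A : E →ₗ.[ℂ] E) (V : Submodule ℂ E) (e : Fin 2 → E) (M : Matrix (Fin 2) (Fin 2) ℂ) : Prop :=
  LinearIndependent ℂ e ∧ Submodule.span ℂ (Set.range e) = V ∧ V ≤ A.domain ∧
    ∀ j, ∃ h : e j ∈ A.domain, A ⟨e j, h⟩ = ∑ i, M i j • e i

/-- The eigenvalues of `A : V → V`. -/
def eigenvaluesOn {E : Type*} [NormedAddCommGroup E] [NormedSpace ℂ E]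
    (A : E →ₗ.[ℂ] E) (V : Submodule ℂ E) : Set ℂ :=
  {z | ∃ v : A.domain, (v : E) ∈ V ∧ v ≠ 0 ∧ A v = z • (v : E)}

end Spectral

/-! ### Dispersion relation, resonant set and unperturbed eigenvectors -/

/-- `Ω(v) = N v₁ / |v|`, with `Ω(0) = 0`. -/
def Omega (N : ℝ) (v : Plane) : ℝ := N * v 0 / ‖v‖

/-- The resonant set `𝓡_k`. -/
def resonantSet (N : ℝ) (k : Freq) : Set Plane :=
  {0} ∪ {μ | μ ≠ 0 ∧ Omega N (vec k) - Omega N (vec k + μ) = Omega N μ}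

/-- `w^σ_{lk}(μ) = c·(lk + μ) + σ Ω(lk + μ)`, for `σ = ±1`. -/
def freqW (N : ℝ) (k : Freq) (μ : Plane) (σ : ℝ) (l : ℤ) : ℝ :=
  inner ℝ (waveSpeed N k) (vec (l • k) + μ) + σ * Omega N (vec (l • k) + μ)

/-- The set `𝓓_k` of resonant `μ` for which the double eigenvalue is not separated from the other
eigenvalues. -/
def exceptionalSet (N : ℝ) (k : Freq) : Set Plane :=
  {μ ∈ resonantSet N k | ¬ ∃ α > 0,
    (∀ l : ℤ, l ≠ 0 → α ≤ |freqW N k μ 1 l - freqW N k μ 1 0|) ∧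
    (∀ l : ℤ, l ≠ 1 → α ≤ |freqW N k μ (-1) l - freqW N k μ (-1) 1|)}

/-- The eigenvalue `λ⁺ = λ⁺₀(μ) = i w⁺₀(μ)`. -/
def lambdaPlus (N : ℝ) (k : Freq) (μ : Plane) : ℂ := Complex.I * freqW N k μ 1 0

/-- `f^σ_{lk}(μ) = 2^{-1/2} (N, -σ |lk + μ|) exp (i lk·x)`, as an element of `H⁰_k`. -/
def eigvec (N : ℝ) (k : Freq) (μ : Plane) (σ : ℝ) (l : ℤ) : Hk k :=
  ⟨(((1 / √2 * N : ℝ) : ℂ) • expBasis (l • k),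
    ((1 / √2 * (-σ * ‖vec (l • k) + μ‖) : ℝ) : ℂ) • expBasis (l • k)), by
    intro q hq
    have h : coeff (expBasis (l • k)) q = 0 := by
      rw [coeff, HilbertBasis.repr_self, lp.single_apply, Pi.single_eq_of_ne (hq l)]
    simp only [coeff_smul, h, mul_zero, and_self]⟩

/-- The circle of centre `λ⁺` and radius `ρ` separates `λ⁺` from the rest of the spectrum of
`𝓛_{μ,0}|_{H¹_k}`. -/
def IsSeparating (N : ℝ) (k : Freq) (μ : Plane) (ρ : ℝ) : Prop :=
  0 < ρ ∧ spectrumOf (restrictedOp N k μ 0) ∩ Metric.closedBall (lambdaPlus N k μ) ρ =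
    {lambdaPlus N k μ}

/-- The spectral projection `P_{μ,ε}` of `𝓛_{μ,ε}|_{H¹_k}` relative to the circle of centre `λ⁺` and
radius `ρ`. -/
def specProj (N : ℝ) (k : Freq) (μ : Plane) (ρ ε : ℝ) : Hk k →L[ℂ] Hk k :=
  rieszProj (restrictedOp N k μ ε) (lambdaPlus N k μ) ρ

/-- The perturbed spectral subspace `𝓥_{μ,ε}`, the range of `P_{μ,ε}`. -/
def specSubspace (N : ℝ) (k : Freq) (μ : Plane) (ρ ε : ℝ) : Submodule ℂ (Hk k) :=
  LinearMap.range (specProj N k μ ρ ε : Hk k →ₗ[ℂ] Hk k)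

/-- The basis `P_{μ,ε} f⁻_k, P_{μ,ε} f⁺_0` of `𝓥_{μ,ε}`. -/
def specBasis (N : ℝ) (k : Freq) (μ : Plane) (ρ ε : ℝ) : Fin 2 → Hk k :=
  ![specProj N k μ ρ ε (eigvec N k μ (-1) 1), specProj N k μ ρ ε (eigvec N k μ 1 0)]

/-! ### The coefficients -/

def b1 (N : ℝ) (k : Freq) (μ : Plane) : ℝ :=
  inner ℝ (perp (vec k)) μ *
    ((‖vec k + μ‖ - ‖vec k‖) * (‖vec k + μ‖ + ‖vec k‖ - ‖μ‖) /
      (4 * N * ‖vec k‖ * ‖μ‖ * ‖vec k + μ‖))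

def b0 (N : ℝ) (k : Freq) (μ : Plane) : ℝ :=
  -(inner ℝ (perp (vec k)) μ *
    ((‖vec k‖ + ‖μ‖) * (‖vec k + μ‖ + ‖vec k‖ - ‖μ‖) /
      (4 * N * ‖vec k‖ * ‖μ‖ * ‖vec k + μ‖)))

def eCoeff (N : ℝ) (k : Freq) (μ : Plane) : ℝ :=
  inner ℝ (perp (vec k)) μ ^ 2 *
    ((‖vec k + μ‖ - ‖vec k‖) * (‖vec k‖ + ‖μ‖) * (‖vec k + μ‖ + ‖vec k‖ - ‖μ‖) ^ 2 /
      (16 * N ^ 2 * ‖μ‖ ^ 2 * ‖vec k + μ‖ ^ 2 * ‖vec k‖ ^ 2))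

/-- `r` is a real-valued function of a real variable, analytic at `0`, with `r ε = O(ε ^ p)`. -/
def IsAnalyticO (r : ℝ → ℝ) (p : ℕ) : Prop :=
  AnalyticAt ℝ r 0 ∧ r =O[𝓝 0] fun ε => ε ^ p

/-- The function `φ` whose graph is the resonant set: `φ y` is the abscissa of the point of `𝓡_k` at
height `y`.  Its restrictions to `y > 0` and to `y < 0` are `φ₊` and `φ₋`. -/
def resonantAbscissa (N : ℝ) (k : Freq) (y : ℝ) : ℝ :=
  Classical.epsilon fun x => !₂[x, y] ∈ resonantSet N k

/-- The point `(φ y, y)` of the resonant set at height `y`. -/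
def resonantPoint (N : ℝ) (k : Freq) (y : ℝ) : Plane := !₂[resonantAbscissa N k y, y]

end Boussinesq

end

open Boussinesq

/-! At ε = 0 the operator acts on each mode lk + μ by a 2×2 block with eigenvalues i w^±_l. Because
c·k = Ω(k), the resonance relation says exactly that w⁻_1 = w⁺_0, so λ⁺ is double; off 𝓓_k it is
isolated, the other frequencies staying at a positive distance. The part linear in ε is bounded on
H⁰_k although it contains a derivative: that derivative is k^⊥·(∇ + iμ), and k^⊥·(lk + μ) = k^⊥·μ on
every mode. Hence the resolvent is a Neumann series in ε, and the Riesz projection P is analytic in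
ε, of rank two near ε = 0.

The matrix is found without a similarity transformation. The functionals l_i dual to f⁻_k, f⁺_0 are
left eigenvectors of the unperturbed operator. Applied to the relation that defines the matrix M,
they give G M = λ⁺ G + ε Q with G = (l_i P f_j) and Q = (l_i B P f_j), where B is the perturbation.
Since G = 1 at ε = 0, M = λ⁺ + ε G⁻¹Q with leading term l_i B f_j (`exists_representing_matrix`,
`rieszProj_zero`). A cosine shifts l by ±1, so this term is off-diagonal, with entries i b₀ and i b₁
(`dualCoord_perturbation`). Conjugation of the Fourier coefficients anticommutes with the operator,
so G⁻¹Q is purely imaginary; trace and determinant then give the eigenvalues (`spectral_expansion`).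

For y outside {0, -n} the sum Ω(μ) + Ω(k + μ) is strictly increasing in x, so the resonant set is a
graph over y there. As y → 0 the abscissa is O(y²); as y → +∞ the ratio μ₁/|μ| tends to m/(2|k|). In
each regime e is a function, differentiable at the limit point, of well-chosen variables, and this
yields both asymptotics.

At a point of 𝓓_k some gap w_l - w_j vanishes, and only finitely many l can be responsible. Away
from 0 the resonant set is locally an analytic graph and the gaps are analytic on it, so their zeros
are isolated unless a gap vanishes identically on one of the pieces y < -n, -n < y < 0, y > 0. On
the first piece the behaviour as |μ| → ∞ forbids this; the other two reach the origin, near which no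
gap vanishes. The delicate gap is l = -1 on the minus branch: elimination leaves a quantity tending
to a multiple of m² - 2n², nonzero because √2 is irrational (`isDiscrete_exceptionalSet`). -/

noncomputable section

namespace Boussinesq

/-! ### Resolvents of unbounded operators and bounded perturbations -/

section Resolvent

variable {E : Type*} [NormedAddCommGroup E] [NormedSpace ℂ E] {A A' : E →ₗ.[ℂ] E}

theorem IsResolventAt.apply_eq {z : ℂ} {R : E →L[ℂ] E} (hR : IsResolventAt A z R) (g : E) :
    ∃ h : R g ∈ A.domain, A ⟨R g, h⟩ = g + z • R g := by
  obtain ⟨h, e⟩ := hR.1 g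
  exact ⟨h, sub_eq_iff_eq_add.1 e⟩

theorem IsResolventAt.sub_eq {z w : ℂ} {R S : E →L[ℂ] E} (hR : IsResolventAt A z R)
    (hS : IsResolventAt A w S) : R - S = (z - w) • (R * S) := by
  ext g
  obtain ⟨h, e⟩ := hS.apply_eq g
  have h1 := hR.2 ⟨S g, h⟩
  rw [e] at h1
  have h2 : g + w • S g - z • S g = g - (z - w) • S g := by module
  simp only [h2, map_sub, map_smul] at h1
  simp only [sub_apply, smul_apply,
    mul_apply_eq_comp]
  rw [sub_eq_iff_eq_add, add_comm]
  exact sub_eq_iff_eq_add.1 h1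

theorem IsResolventAt.unique {z : ℂ} {R S : E →L[ℂ] E} (hR : IsResolventAt A z R)
    (hS : IsResolventAt A z S) : R = S := by
  have := hR.sub_eq hS
  rwa [sub_self, zero_smul, sub_eq_zero] at this

theorem isResolventAt_resolventOf {z : ℂ} (hz : z ∈ resolventSetOf A) :
    IsResolventAt A z (resolventOf A z) := by
  have h : ∃ R, IsResolventAt A z R := hz
  rw [resolventOf, dif_pos h]
  exact h.choose_spec

theorem IsResolventAt.resolventOf_eq {z : ℂ} {R : E →L[ℂ] E} (hR : IsResolventAt A z R) :
    resolventOf A z = R :=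
  (isResolventAt_resolventOf ⟨R, hR⟩).unique hR

theorem IsResolventAt.not_eigenvalue {z : ℂ} {R : E →L[ℂ] E} (hR : IsResolventAt A z R)
    (f : A.domain) (hf : A f = z • (f : E)) : (f : E) = 0 := by
  rw [← hR.2 f, hf, sub_self, map_zero]

/-- `A'` and `A` have the same domain and `A' - w = A - z + C` there. -/
def IsBoundedPerturbation (A A' : E →ₗ.[ℂ] E) (z w : ℂ) (C : E →L[ℂ] E) : Prop :=
  A'.domain = A.domain ∧ ∀ (u : E) (h : u ∈ A.domain) (h' : u ∈ A'.domain),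
    A' ⟨u, h'⟩ - w • u = A ⟨u, h⟩ - z • u + C u

theorem isBoundedPerturbation_shift (A : E →ₗ.[ℂ] E) (z w : ℂ) :
    IsBoundedPerturbation A A z w ((z - w) • 1) := by
  refine ⟨rfl, fun u h h' => ?_⟩
  simp only [smul_apply, one_apply_eq_self]
  module

/-- On the domain A' - w = (1 + C R)(A - z), so inverting the bounded factor is enough. Moving the
spectral parameter and perturbing the operator are both instances. -/
theorem IsResolventAt.perturb {z w : ℂ} {R C : E →L[ℂ] E} (hR : IsResolventAt A z R)
    (hC : IsBoundedPerturbation A A' z w C) (hu : IsUnit (1 + C * R)) :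
    IsResolventAt A' w (R * Ring.inverse (1 + C * R)) := by
  set U := Ring.inverse (1 + C * R) with hU
  have h1 : (1 + C * R) * U = 1 := Ring.mul_inverse_cancel _ hu
  have h2 : U * (1 + C * R) = 1 := Ring.inverse_mul_cancel _ hu
  constructor
  · intro g
    obtain ⟨h, e⟩ := hR.1 (U g)
    refine ⟨by rw [hC.1]; exact h, ?_⟩
    have h3 := hC.2 (R (U g)) h (by rw [hC.1]; exact h)
    have h4 : U g + C (R (U g)) = g := by
      have := congrArg (fun T : E →L[ℂ] E => T g) h1
      simpa [add_mul] using this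
    rw [e, h4] at h3
    exact h3
  · rintro ⟨f, hf⟩
    have hf' : f ∈ A.domain := by rw [← hC.1]; exact hf
    have h3 := hR.2 ⟨f, hf'⟩
    have h4 := hC.2 f hf' hf
    simp only at h3 ⊢
    rw [h4]
    set h := A ⟨f, hf'⟩ - z • f
    have h5 : h + C f = (1 + C * R) h := by simp [h3]
    have h6 : U ((1 + C * R) h) = h := by
      have := congrArg (fun T : E →L[ℂ] E => T h) h2
      simpa using this
    rw [h5, mul_apply_eq_comp, h6, h3]

variable [CompleteSpace E]

theorem IsResolventAt.perturb_of_norm_lt {z w : ℂ} {R C : E →L[ℂ] E} (hR : IsResolventAt A z R)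
    (hC : IsBoundedPerturbation A A' z w C) (hn : ‖C * R‖ < 1) :
    IsResolventAt A' w (R * Ring.inverse (1 + C * R)) := by
  refine hR.perturb hC ?_
  have := isUnit_one_sub_of_norm_lt_one (x := -(C * R)) (by rwa [norm_neg])
  rwa [sub_neg_eq_add] at this

theorem eventually_resolventOf_eq {z : ℂ} (hz : z ∈ resolventSetOf A) :
    ∀ᶠ w in 𝓝 z, IsResolventAt A w
      (resolventOf A z * Ring.inverse (1 + ((z - w) • 1 : E →L[ℂ] E) * resolventOf A z)) := by
  have hc : Continuous fun w : ℂ => ‖((z - w) • 1 : E →L[ℂ] E) * resolventOf A z‖ := by fun_prop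
  have h0 : ∀ᶠ w in 𝓝 z, ‖((z - w) • 1 : E →L[ℂ] E) * resolventOf A z‖ < 1 :=
    hc.continuousAt.eventually_lt continuousAt_const (by simp)
  filter_upwards [h0] with w hw
  exact (isResolventAt_resolventOf hz).perturb_of_norm_lt (isBoundedPerturbation_shift A z w) hw

theorem differentiableAt_resolventOf {z : ℂ} (hz : z ∈ resolventSetOf A) :
    DifferentiableAt ℂ (resolventOf A) z := by
  have h1 : resolventOf A =ᶠ[𝓝 z] fun w =>
      resolventOf A z * Ring.inverse (1 + ((z - w) • 1 : E →L[ℂ] E) * resolventOf A z) :=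
    (eventually_resolventOf_eq hz).mono fun w hw => hw.resolventOf_eq
  refine DifferentiableAt.congr_of_eventuallyEq ?_ h1
  refine (differentiableAt_const _).mul ?_
  have h2 : DifferentiableAt ℂ (fun w : ℂ =>
      1 + ((z - w) • 1 : E →L[ℂ] E) * resolventOf A z) z := by fun_prop
  refine DifferentiableAt.comp (g := Ring.inverse) z ?_ h2
  have h3 : (1 + ((z - z) • 1 : E →L[ℂ] E) * resolventOf A z) =
      ((1 : (E →L[ℂ] E)ˣ) : E →L[ℂ] E) := by
    simp
  rw [h3]
  exact differentiableAt_inverse isUnit_one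

theorem continuousOn_resolventOf : ContinuousOn (resolventOf A) (resolventSetOf A) :=
  fun _ hz => (differentiableAt_resolventOf hz).continuousAt.continuousWithinAt

/-! ### The Riesz projection -/

theorem circleIntegral_swap {F : Type*} [NormedAddCommGroup F] [NormedSpace ℂ F] {f : ℂ → ℂ → F}
    {c : ℂ} {r s : ℝ} (hf : Continuous fun p : ℝ × ℝ => f (circleMap c r p.1) (circleMap c s p.2)) :
    (∮ w in C(c, r), ∮ z in C(c, s), f w z) = ∮ z in C(c, s), ∮ w in C(c, r), f w z := by
  have h2 : (0 : ℝ) ≤ 2 * Real.pi := by positivity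
  simp only [circleIntegral, intervalIntegral.integral_of_le h2, ← integral_smul]
  have hc : Continuous (Function.uncurry fun a b : ℝ => deriv (circleMap c r) a •
      deriv (circleMap c s) b • f (circleMap c r a) (circleMap c s b)) := by
    simp only [deriv_circleMap, Function.uncurry_def]
    exact ((((continuous_circleMap 0 r).comp continuous_fst).mul continuous_const).smul
      ((((continuous_circleMap 0 s).comp continuous_snd).mul continuous_const).smul hf))
  rw [integral_integral_swap]
  · refine integral_congr_ae (Eventually.of_forall fun a => ?_)
    refine integral_congr_ae (Eventually.of_forall fun b => ?_)
    simp only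
    rw [smul_comm]
  · rw [Measure.prod_restrict, ← IntegrableOn]
    exact (hc.continuousOn.integrableOn_compact (isCompact_Icc.prod isCompact_Icc)).mono_set
      (Set.prod_mono Set.Ioc_subset_Icc_self Set.Ioc_subset_Icc_self)

theorem continuousOn_resolventOf_annulus {c : ℂ} {r ρ : ℝ}
    (h : Metric.closedBall c ρ \ Metric.ball c r ⊆ resolventSetOf A) :
    ContinuousOn (resolventOf A) (Metric.closedBall c ρ \ Metric.ball c r) :=
  continuousOn_resolventOf.mono h

theorem rieszProj_eq_of_annulus {c : ℂ} {r ρ : ℝ} (hr : 0 < r) (hρ : r ≤ ρ)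
    (h : Metric.closedBall c ρ \ Metric.ball c r ⊆ resolventSetOf A) :
    rieszProj A c ρ = rieszProj A c r := by
  rw [rieszProj, rieszProj, Complex.circleIntegral_eq_of_differentiable_on_annulus_off_countable hr
    hρ Set.countable_empty (continuousOn_resolventOf_annulus h)]
  intro z hz
  refine differentiableAt_resolventOf (h ⟨Metric.ball_subset_closedBall hz.1.1, fun h' => ?_⟩)
  exact hz.1.2 (Metric.ball_subset_closedBall h')

theorem circleIntegral_mul_left' {f : ℂ → E →L[ℂ] E} {c : ℂ} {r : ℝ} (a : E →L[ℂ] E)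
    (hf : CircleIntegrable f c r) : (∮ z in C(c, r), a * f z) = a * ∮ z in C(c, r), f z := by
  have := (ContinuousLinearMap.mul ℂ (E →L[ℂ] E) a).intervalIntegral_comp_comm (hf.out)
  simpa [circleIntegral] using this

theorem circleIntegral_mul_right' {f : ℂ → E →L[ℂ] E} {c : ℂ} {r : ℝ} (a : E →L[ℂ] E)
    (hf : CircleIntegrable f c r) : (∮ z in C(c, r), f z * a) = (∮ z in C(c, r), f z) * a := by
  have := ((ContinuousLinearMap.mul ℂ (E →L[ℂ] E)).flip a).intervalIntegral_comp_comm (hf.out)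
  simpa [circleIntegral] using this

theorem sphere_subset_annulus {c : ℂ} {r s ρ : ℝ} (h1 : r ≤ s) (h2 : s ≤ ρ) :
    Metric.sphere c s ⊆ Metric.closedBall c ρ \ Metric.ball c r := by
  intro z hz
  rw [mem_sphere_iff_norm, ← dist_eq_norm] at hz
  simp only [Set.mem_sdiff, Metric.mem_closedBall, Metric.mem_ball, not_lt, hz]
  exact ⟨h2, h1⟩

/-- The product is computed on two circles of radii r < ρ with the resolvent identity. The term (w -
z)⁻¹ R(w), integrated in z over the inner circle, vanishes because w lies outside it; the term (w -
z)⁻¹ R(z), integrated in w over the outer circle, gives 2πi R(z). -/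
theorem rieszProj_mul_self {c : ℂ} {r ρ : ℝ} (hr : 0 < r) (hρ : r < ρ)
    (h : Metric.closedBall c ρ \ Metric.ball c r ⊆ resolventSetOf A) :
    rieszProj A c ρ * rieszProj A c ρ = rieszProj A c ρ := by
  have hρ0 : 0 < ρ := hr.trans hρ
  have hsρ : Metric.sphere c ρ ⊆ resolventSetOf A := (sphere_subset_annulus hρ.le le_rfl).trans h
  have hsr : Metric.sphere c r ⊆ resolventSetOf A := (sphere_subset_annulus le_rfl hρ.le).trans h
  have hcρ : ContinuousOn (resolventOf A) (Metric.sphere c ρ) := continuousOn_resolventOf.mono hsρ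
  have hcr : ContinuousOn (resolventOf A) (Metric.sphere c r) := continuousOn_resolventOf.mono hsr
  have hiρ := hcρ.circleIntegrable hρ0.le
  have hir := hcr.circleIntegrable hr.le
  have hne : ∀ w ∈ Metric.sphere c ρ, ∀ z ∈ Metric.closedBall c r, w - z ≠ 0 := by
    intro w hw z hz e
    rw [sub_eq_zero] at e
    subst e
    rw [mem_sphere_iff_norm, ← dist_eq_norm] at hw
    rw [Metric.mem_closedBall] at hz
    linarith
  have key : (∮ w in C(c, ρ), resolventOf A w) * (∮ z in C(c, r), resolventOf A z) =
      -((2 * Real.pi * Complex.I : ℂ) • ∮ z in C(c, r), resolventOf A z) := by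
    rw [← circleIntegral_mul_right' _ hiρ]
    have e1 : ∀ w ∈ Metric.sphere c ρ, resolventOf A w * (∮ z in C(c, r), resolventOf A z) =
        -∮ z in C(c, r), (w - z)⁻¹ • resolventOf A z := by
      intro w hw
      have hcw : ContinuousOn (fun z => (w - z)⁻¹) (Metric.closedBall c r) :=
        (continuousOn_const.sub continuousOn_id).inv₀ fun z hz => hne w hw z hz
      have hcw' := hcw.mono Metric.sphere_subset_closedBall
      rw [← circleIntegral_mul_left' _ hir]
      have e2 : Set.EqOn (fun z => resolventOf A w * resolventOf A z)
          (fun z => (w - z)⁻¹ • resolventOf A w - (w - z)⁻¹ • resolventOf A z)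
          (Metric.sphere c r) := by
        intro z hz
        have h3 := (isResolventAt_resolventOf (hsρ hw)).sub_eq (isResolventAt_resolventOf (hsr hz))
        have h4 := hne w hw z (Metric.sphere_subset_closedBall hz)
        simp only
        rw [← smul_sub, h3, smul_smul, inv_mul_cancel₀ h4, one_smul]
      have i1 : CircleIntegrable (fun z => (w - z)⁻¹ • resolventOf A w) c r :=
        (hcw'.smul continuousOn_const).circleIntegrable hr.le
      have i2 : CircleIntegrable (fun z => (w - z)⁻¹ • resolventOf A z) c r :=
        (hcw'.smul hcr).circleIntegrable hr.le
      rw [circleIntegral.integral_congr hr.le e2, circleIntegral.integral_sub i1 i2,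
        circleIntegral.integral_smul_const,
        Complex.circleIntegral_eq_zero_of_differentiable_on_off_countable hr.le
          Set.countable_empty hcw, zero_smul, zero_sub]
      intro z hz
      refine DifferentiableAt.inv (by fun_prop) (hne w hw z (Metric.ball_subset_closedBall hz.1))
    rw [circleIntegral.integral_congr hρ0.le e1]
    have e3 : (∮ w in C(c, ρ), -∮ z in C(c, r), (w - z)⁻¹ • resolventOf A z) =
        -∮ w in C(c, ρ), ∮ z in C(c, r), (w - z)⁻¹ • resolventOf A z := by
      simp [circleIntegral]
    rw [e3, circleIntegral_swap]
    · congr 1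
      rw [← circleIntegral.integral_smul]
      refine circleIntegral.integral_congr hr.le fun z hz => ?_
      rw [circleIntegral.integral_smul_const, circleIntegral.integral_sub_inv_of_mem_ball]
      rw [mem_sphere_iff_norm, ← dist_eq_norm] at hz
      rw [Metric.mem_ball, hz]
      exact hρ
    · have hm1 : ∀ p : ℝ × ℝ, circleMap c ρ p.1 ∈ Metric.sphere c ρ :=
        fun p => circleMap_mem_sphere c hρ0.le _
      have hm2 : ∀ p : ℝ × ℝ, circleMap c r p.2 ∈ Metric.sphere c r :=
        fun p => circleMap_mem_sphere c hr.le _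
      have hk1 : Continuous fun p : ℝ × ℝ => circleMap c ρ p.1 :=
        (continuous_circleMap c ρ).comp continuous_fst
      have hk2 : Continuous fun p : ℝ × ℝ => circleMap c r p.2 :=
        (continuous_circleMap c r).comp continuous_snd
      exact ((hk1.sub hk2).inv₀ fun p => hne _ (hm1 p) _
        (Metric.sphere_subset_closedBall (hm2 p))).smul (hcr.comp_continuous hk2 hm2)
  have hpi : (2 * Real.pi * Complex.I : ℂ) ≠ 0 := Complex.two_pi_I_ne_zero
  have hP : rieszProj A c ρ =
      -((2 * Real.pi * Complex.I : ℂ)⁻¹ • ∮ z in C(c, r), resolventOf A z) :=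
    rieszProj_eq_of_annulus hr hρ.le h
  calc rieszProj A c ρ * rieszProj A c ρ
      = -((2 * Real.pi * Complex.I : ℂ)⁻¹ • ∮ z in C(c, ρ), resolventOf A z) *
        -((2 * Real.pi * Complex.I : ℂ)⁻¹ • ∮ z in C(c, r), resolventOf A z) := by
        rw [← hP]; rfl
    _ = rieszProj A c ρ := by
        rw [neg_mul_neg, smul_mul_smul_comm, key, smul_neg, smul_smul, hP, mul_assoc,
          inv_mul_cancel₀ hpi, mul_one]

end Resolvent

/-! ### Affine families of operators: analytic dependence of the Riesz projection. -/

section Family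

variable {E : Type*} [NormedAddCommGroup E] [NormedSpace ℂ E]

/-- `A ε = A 0 + ε B` on a common domain. -/
def IsAffineFamily (A : ℝ → E →ₗ.[ℂ] E) (B : E →L[ℂ] E) : Prop :=
  ∀ ε, (A ε).domain = (A 0).domain ∧ ∀ (u : E) (h : u ∈ (A 0).domain) (h' : u ∈ (A ε).domain),
    A ε ⟨u, h'⟩ = A 0 ⟨u, h⟩ + (ε : ℂ) • B u

theorem IsAffineFamily.isBoundedPerturbation {A : ℝ → E →ₗ.[ℂ] E} {B : E →L[ℂ] E}
    (hA : IsAffineFamily A B) (ε : ℝ) (z : ℂ) :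
    IsBoundedPerturbation (A 0) (A ε) z z ((ε : ℂ) • B) := by
  refine ⟨(hA ε).1, fun u h h' => ?_⟩
  rw [(hA ε).2 u h h', smul_apply]
  abel

theorem resolventOf_commute {A : E →ₗ.[ℂ] E} {z w : ℂ} (hz : z ∈ resolventSetOf A)
    (hw : w ∈ resolventSetOf A) : Commute (resolventOf A z) (resolventOf A w) := by
  rcases eq_or_ne z w with rfl | h
  · exact Commute.refl _
  · have h1 := (isResolventAt_resolventOf hz).sub_eq (isResolventAt_resolventOf hw)
    have h2 := (isResolventAt_resolventOf hw).sub_eq (isResolventAt_resolventOf hz)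
    have h3 : (z - w) • (resolventOf A z * resolventOf A w) =
        (z - w) • (resolventOf A w * resolventOf A z) := by
      rw [← h1, ← neg_sub w z, neg_smul, ← h2, neg_sub]
    exact smul_right_injective _ (sub_ne_zero.2 h) h3

/-- The strict bound makes `P` injective on the span of the `f i` and the functionals `l i` jointly
injective on the range of `P`, so the dimension is bounded by two from both sides. -/
theorem rank_two_of_near {P Q : E →L[ℂ] E} (hP : P * P = P) (hPQ : ‖P - Q‖ < 1)
    {f : Fin 2 → E} {l : Fin 2 → E →L[ℂ] ℂ} (hQ : ∀ g, Q g = ∑ i, l i g • f i)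
    (hl : ∀ i j, l i (f j) = if i = j then 1 else 0) :
    LinearIndependent ℂ (fun j => P (f j)) ∧
      Submodule.span ℂ (Set.range fun j => P (f j)) = LinearMap.range (P : E →ₗ[ℂ] E) ∧
      Module.finrank ℂ (LinearMap.range (P : E →ₗ[ℂ] E)) = 2 ∧
      (Matrix.of fun i j => l i (P (f j))).det ≠ 0 := by
  -- A vector fixed by one of the two maps and killed by the other would be sent by P - Q to a
  -- vector of the same norm.
  have small : ∀ x : E, P x - Q x = x ∨ Q x - P x = x → x = 0 := by
    intro x hx
    by_contra h0
    have h1 : ‖P x - Q x‖ ≤ ‖P - Q‖ * ‖x‖ := by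
      rw [← sub_apply]
      exact (P - Q).le_opNorm x
    have h2 : ‖P x - Q x‖ = ‖x‖ := by
      rcases hx with h | h
      · rw [h]
      · rw [norm_sub_rev, h]
    have h3 := norm_pos_iff.2 h0
    rw [h2] at h1
    nlinarith
  have hPP : ∀ x, P (P x) = P x := fun x => by
    have := congrArg (fun T : E →L[ℂ] E => T x) hP
    simpa using this
  have hPf : ∀ c : Fin 2 → ℂ, P (∑ i, c i • f i) = 0 → c = 0 := by
    intro c hc
    set y := ∑ i, c i • f i with hy
    have hly : ∀ i, l i y = c i := fun i => by fin_cases i <;> simp [hy, hl]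
    have hQy : Q y = y := by rw [hQ, hy]; simp only [← hy, hly]
    have : y = 0 := small y (Or.inr (by rw [hQy, hc, sub_zero]))
    ext i
    rw [← hly i, this, map_zero, Pi.zero_apply]
  have hli : LinearIndependent ℂ (fun j => P (f j)) := by
    rw [Fintype.linearIndependent_iff]
    intro c hc i
    have : c = 0 := hPf c (by rw [map_sum]; simpa using hc)
    rw [this, Pi.zero_apply]
  set V := LinearMap.range (P : E →ₗ[ℂ] E) with hV
  have hinj0 : ∀ x ∈ V, (∀ i, l i x = 0) → x = 0 := by
    rintro x ⟨y, rfl⟩ h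
    refine small _ (Or.inl ?_)
    rw [hQ]
    simp only [h, zero_smul, Finset.sum_const_zero, sub_zero]
    exact hPP y
  set T : V →ₗ[ℂ] (Fin 2 → ℂ) := LinearMap.pi fun i => (l i : E →ₗ[ℂ] ℂ) ∘ₗ V.subtype with hT
  have hTinj : Function.Injective T := by
    rw [← LinearMap.ker_eq_bot, LinearMap.ker_eq_bot']
    intro x hx
    exact Subtype.ext (hinj0 x x.2 fun i => congrFun hx i)
  have : FiniteDimensional ℂ V := FiniteDimensional.of_injective T hTinj
  have hle : Module.finrank ℂ V ≤ 2 := by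
    simpa using LinearMap.finrank_le_finrank_of_injective hTinj
  have hsp : Submodule.span ℂ (Set.range fun j => P (f j)) = V := by
    refine Submodule.eq_of_le_of_finrank_le ?_ ?_
    · rw [Submodule.span_le]
      rintro _ ⟨j, rfl⟩
      exact ⟨f j, rfl⟩
    · rw [finrank_span_eq_card hli]
      simpa using hle
  refine ⟨hli, hsp, ?_, fun hdet => ?_⟩
  · rw [← hsp, finrank_span_eq_card hli, Fintype.card_fin]
  · obtain ⟨c, hc0, hc⟩ := Matrix.exists_mulVec_eq_zero_iff.2 hdet
    refine hc0 (hPf c (hinj0 _ ⟨_, rfl⟩ fun i => ?_))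
    have := congrFun hc i
    simp only [Matrix.mulVec, dotProduct, Matrix.of_apply, Pi.zero_apply] at this
    simp only [map_sum, map_smul, smul_eq_mul]
    rw [← this]
    exact Finset.sum_congr rfl fun j _ => mul_comm _ _

variable [CompleteSpace E]

/-- Neumann series: A ε - z = (1 + ε B R)(A 0 - z) with R the unperturbed resolvent. The
coefficients R(-BR)ⁿ do not depend on ε, so this is a power series in ε. -/
theorem IsAffineFamily.hasSum_resolventOf {A : ℝ → E →ₗ.[ℂ] E} {B : E →L[ℂ] E}
    (hA : IsAffineFamily A B) {ε : ℝ} {z : ℂ} (hz : z ∈ resolventSetOf (A 0))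
    (hn : |ε| * ‖B * resolventOf (A 0) z‖ < 1) :
    z ∈ resolventSetOf (A ε) ∧
      HasSum (fun n : ℕ => (ε : ℂ) ^ n • (resolventOf (A 0) z * (-(B * resolventOf (A 0) z)) ^ n))
        (resolventOf (A ε) z) := by
  have hn' : ‖((ε : ℂ) • B) * resolventOf (A 0) z‖ < 1 := by
    rw [smul_mul_assoc, norm_smul, Complex.norm_real, Real.norm_eq_abs]
    exact hn
  have h := (isResolventAt_resolventOf hz).perturb_of_norm_lt (hA.isBoundedPerturbation ε z) hn'
  refine ⟨⟨_, h⟩, ?_⟩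
  rw [h.resolventOf_eq]
  have h1 := (hasSum_geom_series_inverse (-(((ε : ℂ) • B) * resolventOf (A 0) z))
    (by rwa [norm_neg])).mul_left (resolventOf (A 0) z)
  rw [sub_neg_eq_add] at h1
  have h2 : (fun n : ℕ => (ε : ℂ) ^ n • (resolventOf (A 0) z * (-(B * resolventOf (A 0) z)) ^ n)) =
      fun n => resolventOf (A 0) z * (-((ε : ℂ) • B * resolventOf (A 0) z)) ^ n := by
    ext1 n
    rw [smul_mul_assoc, ← smul_neg, smul_pow, mul_smul_comm]
  rw [h2]
  exact h1

theorem IsAffineFamily.exists_bound {A : ℝ → E →ₗ.[ℂ] E} (B : E →L[ℂ] E)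
    {K : Set ℂ} (hK : IsCompact K) (hKA : K ⊆ resolventSetOf (A 0)) :
    ∃ C > 0, ∀ z ∈ K, ‖resolventOf (A 0) z‖ ≤ C ∧ ‖B * resolventOf (A 0) z‖ ≤ C := by
  obtain ⟨C, hC⟩ := hK.exists_bound_of_continuousOn (continuousOn_resolventOf.mono hKA)
  refine ⟨(‖B‖ + 1) * max C 1, by positivity, fun z hz => ?_⟩
  have h1 : ‖resolventOf (A 0) z‖ ≤ max C 1 := (hC z hz).trans (le_max_left _ _)
  constructor
  · nlinarith [norm_nonneg B, norm_nonneg (resolventOf (A 0) z)]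
  · refine (norm_mul_le _ _).trans ?_
    nlinarith [norm_nonneg B, norm_nonneg (resolventOf (A 0) z), le_max_right C 1]

theorem IsAffineFamily.exists_subset_resolventSetOf {A : ℝ → E →ₗ.[ℂ] E} {B : E →L[ℂ] E}
    (hA : IsAffineFamily A B) {K : Set ℂ} (hK : IsCompact K) (hKA : K ⊆ resolventSetOf (A 0)) :
    ∀ᶠ ε in 𝓝 (0 : ℝ), K ⊆ resolventSetOf (A ε) := by
  obtain ⟨C, hC0, hC⟩ := IsAffineFamily.exists_bound B hK hKA
  have h : ∀ᶠ ε in 𝓝 (0 : ℝ), |ε| * C < 1 :=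
    (by fun_prop : Continuous fun ε : ℝ => |ε| * C).continuousAt.eventually_lt
      continuousAt_const (by simp)
  filter_upwards [h] with ε hε z hz
  exact (hA.hasSum_resolventOf (hKA hz)
    ((mul_le_mul_of_nonneg_left (hC z hz).2 (abs_nonneg _)).trans_lt hε)).1

/-- The resolvent is bounded on the compact circle, so the Neumann series is dominated there by a
geometric one and may be integrated term by term. -/
theorem IsAffineFamily.hasSum_rieszProj {A : ℝ → E →ₗ.[ℂ] E} {B : E →L[ℂ] E}
    (hA : IsAffineFamily A B) {c : ℂ} {ρ : ℝ} (hρ : 0 ≤ ρ)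
    (hs : Metric.sphere c ρ ⊆ resolventSetOf (A 0)) :
    ∃ p : ℕ → E →L[ℂ] E, ∀ᶠ ε in 𝓝 (0 : ℝ),
      HasSum (fun n : ℕ => ((ε : ℝ) : ℂ) ^ n • p n) (rieszProj (A ε) c ρ) := by
  obtain ⟨C, hC0, hC⟩ := IsAffineFamily.exists_bound B (isCompact_sphere c ρ) hs
  set R := resolventOf (A 0) with hR
  refine ⟨fun n => -((2 * Real.pi * Complex.I : ℂ)⁻¹ • ∮ z in C(c, ρ), R z * (-(B * R z)) ^ n), ?_⟩
  have h : ∀ᶠ ε in 𝓝 (0 : ℝ), |ε| * C < 1 :=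
    (by fun_prop : Continuous fun ε : ℝ => |ε| * C).continuousAt.eventually_lt
      continuousAt_const (by simp)
  filter_upwards [h] with ε hε
  have hm : ∀ θ, circleMap c ρ θ ∈ Metric.sphere c ρ := circleMap_mem_sphere c hρ
  have key : ∀ z ∈ Metric.sphere c ρ,
      HasSum (fun n : ℕ => (ε : ℂ) ^ n • (R z * (-(B * R z)) ^ n)) (resolventOf (A ε) z) :=
    fun z hz => (hA.hasSum_resolventOf (hs hz)
      ((mul_le_mul_of_nonneg_left (hC z hz).2 (abs_nonneg _)).trans_lt hε)).2
  have hcR : Continuous fun θ => R (circleMap c ρ θ) :=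
    (continuousOn_resolventOf.mono hs).comp_continuous (continuous_circleMap c ρ) hm
  have hd : Continuous (deriv (circleMap c ρ)) := by
    simp only [funext (deriv_circleMap c ρ)]
    exact (continuous_circleMap 0 ρ).mul continuous_const
  -- The factor `max 1 ‖1‖` takes care of n = 0, where the power is the identity.
  have hn : ∀ n θ, ‖(-(B * R (circleMap c ρ θ))) ^ n‖ ≤ C ^ n * max 1 ‖(1 : E →L[ℂ] E)‖ := by
    intro n θ
    rcases Nat.eq_zero_or_pos n with rfl | hn
    · simp
    · refine (norm_pow_le' _ hn).trans ?_
      rw [norm_neg]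
      exact (pow_le_pow_left₀ (norm_nonneg _) (hC _ (hm θ)).2 n).trans
        (le_mul_of_one_le_right (by positivity) (le_max_left _ _))
  have hsum : HasSum (fun n : ℕ => ∫ θ in (0 : ℝ)..2 * Real.pi, deriv (circleMap c ρ) θ •
      ((ε : ℂ) ^ n • (R (circleMap c ρ θ) * (-(B * R (circleMap c ρ θ))) ^ n)))
      (∫ θ in (0 : ℝ)..2 * Real.pi, deriv (circleMap c ρ) θ •
        resolventOf (A ε) (circleMap c ρ θ)) := by
    refine intervalIntegral.hasSum_integral_of_dominated_convergence
      (fun n _ => (ρ * C * max 1 ‖(1 : E →L[ℂ] E)‖) * (|ε| * C) ^ n) (fun n => ?_)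
      (fun n => Eventually.of_forall fun θ _ => ?_) (Eventually.of_forall fun θ _ => ?_) ?_
      (Eventually.of_forall fun θ _ => (key _ (hm θ)).const_smul _)
    · refine Continuous.aestronglyMeasurable ?_
      have h1 : Continuous fun θ => (-(B * R (circleMap c ρ θ))) ^ n :=
        (continuous_const.mul hcR).neg.pow n
      have h2 : Continuous fun θ => R (circleMap c ρ θ) * (-(B * R (circleMap c ρ θ))) ^ n :=
        hcR.mul h1
      have h3 := (continuous_const (y := (ε : ℂ) ^ n)).smul h2

      exact hd.smul h3
    · rw [norm_smul, norm_smul, deriv_circleMap, norm_mul, Complex.norm_I, mul_one,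
        norm_circleMap_zero, abs_of_nonneg hρ, norm_pow, Complex.norm_real, Real.norm_eq_abs]
      have h1 : ‖R (circleMap c ρ θ) * (-(B * R (circleMap c ρ θ))) ^ n‖ ≤
          C * (C ^ n * max 1 ‖(1 : E →L[ℂ] E)‖) :=
        (norm_mul_le _ _).trans (mul_le_mul (hC _ (hm θ)).1 (hn n θ) (norm_nonneg _) hC0.le)
      calc ρ * (|ε| ^ n * ‖R (circleMap c ρ θ) * (-(B * R (circleMap c ρ θ))) ^ n‖)
          ≤ ρ * (|ε| ^ n * (C * (C ^ n * max 1 ‖(1 : E →L[ℂ] E)‖))) := by gcongr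
        _ = _ := by rw [mul_pow]; ring
    · exact (summable_geometric_of_lt_one (by positivity) hε).mul_left _
    · exact intervalIntegrable_const
  have h2 := (hsum.const_smul ((2 * Real.pi * Complex.I : ℂ)⁻¹)).neg
  rw [rieszProj, circleIntegral]
  refine (congrArg (fun q => HasSum q _) (funext fun n => ?_)).mpr h2
  rw [smul_neg, smul_comm, circleIntegral, ← intervalIntegral.integral_smul]
  simp only [smul_comm ((ε : ℂ) ^ n)]

theorem analyticAt_of_hasSum {F : Type*} [NormedAddCommGroup F] [NormedSpace ℝ F]
    {f : ℝ → F} {p : ℕ → F} (h : ∀ᶠ ε in 𝓝 (0 : ℝ), HasSum (fun n => ε ^ n • p n) (f ε)) :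
    AnalyticAt ℝ f 0 := by
  let q : FormalMultilinearSeries ℝ ℝ F := fun n =>
    ContinuousMultilinearMap.mkPiRing ℝ (Fin n) (p n)
  refine ⟨q, hasFPowerSeriesAt_iff.2 ?_⟩
  filter_upwards [h] with ε hε
  simpa [q, FormalMultilinearSeries.coeff] using hε

theorem IsAffineFamily.analyticAt_rieszProj {A : ℝ → E →ₗ.[ℂ] E} {B : E →L[ℂ] E}
    (hA : IsAffineFamily A B) {c : ℂ} {ρ : ℝ} (hρ : 0 ≤ ρ)
    (hs : Metric.sphere c ρ ⊆ resolventSetOf (A 0)) (l : E →L[ℂ] ℂ) (f : E) :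
    AnalyticAt ℝ (fun ε => l (rieszProj (A ε) c ρ f)) 0 := by
  obtain ⟨p, hp⟩ := hA.hasSum_rieszProj hρ hs
  refine analyticAt_of_hasSum (p := fun n => l (p n f)) ?_
  filter_upwards [hp] with ε hε
  have := (hε.mapL ((ContinuousLinearMap.apply ℂ E f))).mapL l
  simpa using this

theorem IsAffineFamily.eventually_norm_lt {A : ℝ → E →ₗ.[ℂ] E} {B : E →L[ℂ] E}
    (hA : IsAffineFamily A B) {c : ℂ} {ρ : ℝ} (hρ : 0 ≤ ρ)
    (hs : Metric.sphere c ρ ⊆ resolventSetOf (A 0)) :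
    ∀ᶠ ε in 𝓝 (0 : ℝ), ‖rieszProj (A ε) c ρ - rieszProj (A 0) c ρ‖ < 1 := by
  obtain ⟨p, hp⟩ := hA.hasSum_rieszProj hρ hs
  have h : AnalyticAt ℝ (fun ε => rieszProj (A ε) c ρ) 0 := by
    refine analyticAt_of_hasSum (p := p) ?_
    filter_upwards [hp] with ε hε
    refine (congrArg (fun q => HasSum q _) (funext fun n => ?_)).mpr hε
    rw [← Complex.ofReal_pow, Complex.coe_smul]
  exact ((h.continuousAt.sub continuousAt_const).norm).eventually_lt continuousAt_const (by simp)

/-! ### Spectral subspaces -/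

theorem rieszProj_commute {A : E →ₗ.[ℂ] E} {c w : ℂ} {ρ : ℝ} (hρ : 0 ≤ ρ)
    (hs : Metric.sphere c ρ ⊆ resolventSetOf A) (hw : w ∈ resolventSetOf A) :
    Commute (resolventOf A w) (rieszProj A c ρ) := by
  have hi := (continuousOn_resolventOf.mono hs).circleIntegrable hρ
  refine (Commute.smul_right ?_ _).neg_right
  rw [Commute, SemiconjBy, ← circleIntegral_mul_left' _ hi, ← circleIntegral_mul_right' _ hi]
  exact circleIntegral.integral_congr hρ fun z hz => resolventOf_commute hw (hs hz)

/-- Since R(z) = R(w)(1 + (z - w)R(z)), one resolvent R(w) factors out of the contour integral, and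
its range lies in the domain. -/
theorem range_rieszProj_le_domain {A : E →ₗ.[ℂ] E} {c : ℂ} {ρ : ℝ} (hρ : 0 ≤ ρ)
    (hs : Metric.sphere c ρ ⊆ resolventSetOf A) (g : E) : rieszProj A c ρ g ∈ A.domain := by
  obtain ⟨w, hw⟩ : (Metric.sphere c ρ).Nonempty := ⟨_, circleMap_mem_sphere c hρ 0⟩
  have hc := continuousOn_resolventOf.mono hs
  have hR := isResolventAt_resolventOf (hs hw)
  have h1 : (∮ z in C(c, ρ), resolventOf A z) =
      resolventOf A w * ∮ z in C(c, ρ), (1 + (z - w) • resolventOf A z) := by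
    rw [← circleIntegral_mul_left']
    · refine circleIntegral.integral_congr hρ fun z hz => ?_
      have h2 := hR.sub_eq (isResolventAt_resolventOf (hs hz))
      rw [mul_add, mul_one, mul_smul_comm, ← neg_sub w z, neg_smul, ← h2]
      abel
    · exact (continuousOn_const.add ((continuousOn_id.sub continuousOn_const).smul
        hc)).circleIntegrable hρ
  rw [rieszProj, h1, ← mul_smul_comm, ← mul_neg, mul_apply_eq_comp]
  exact (hR.1 _).1

/-- With y = (A - w)u, commutation gives R(w)Py = PR(w)y = Pu = u = R(w)y, and R(w) is injective. -/
theorem apply_mem_range_rieszProj {A : E →ₗ.[ℂ] E} {c : ℂ} {ρ : ℝ} (hρ : 0 ≤ ρ)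
    (hs : Metric.sphere c ρ ⊆ resolventSetOf A) (u : A.domain)
    (hu : rieszProj A c ρ u = u) : rieszProj A c ρ (A u) = A u := by
  obtain ⟨w, hw⟩ : (Metric.sphere c ρ).Nonempty := ⟨_, circleMap_mem_sphere c hρ 0⟩
  have hR := isResolventAt_resolventOf (hs hw)
  have hcomm := rieszProj_commute hρ hs (hs hw)
  set P := rieszProj A c ρ
  set R := resolventOf A w
  have h1 := hR.2 u
  set y := A u - w • (u : E) with hy
  have h2 : R (P y) = R y := by
    have := congrArg (fun T : E →L[ℂ] E => T y) hcomm.eq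
    simp only [mul_apply_eq_comp] at this
    rw [this, h1, hu]
  have hinj : ∀ x, R x = 0 → x = 0 := by
    intro x hx
    obtain ⟨h, e⟩ := hR.1 x
    have h0 : (⟨R x, h⟩ : A.domain) = 0 := Subtype.ext hx
    rw [h0, LinearPMap.map_zero, hx, smul_zero, sub_zero] at e
    exact e.symm
  have h3 : P y = y := sub_eq_zero.1 (hinj _ (by rw [map_sub, h2, sub_self]))
  have h4 : A u = y + w • (u : E) := by rw [hy]; abel
  rw [h4, map_add, map_smul, h3, hu]

end Family

/-! ### Conjugation symmetry of the Riesz projection. -/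

section Conj

variable {E : Type*} [NormedAddCommGroup E] [NormedSpace ℂ E]

/-- `J` anticommutes with `A`. -/
def Anticommutes (J : E →L⋆[ℂ] E) (A : E →ₗ.[ℂ] E) : Prop :=
  ∀ u : A.domain, ∃ h : J u ∈ A.domain, A ⟨J u, h⟩ = -J (A u)

/-- Anticommutation gives J(A - z) = -(A + z̄)J: the spectral parameter is reflected in the
imaginary axis. -/
theorem resolventOf_conj {J : E →L⋆[ℂ] E} {A : E →ₗ.[ℂ] E} (hJA : Anticommutes J A)
    {z w : ℂ} (hz : z ∈ resolventSetOf A) (hw : w ∈ resolventSetOf A)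
    (hzw : w = -(starRingEnd ℂ) z) (g : E) : J (resolventOf A z g) = -resolventOf A w (J g) := by
  obtain ⟨h, e⟩ := (isResolventAt_resolventOf hz).1 g
  obtain ⟨h', e'⟩ := hJA ⟨_, h⟩
  have h3 := (isResolventAt_resolventOf hw).2 ⟨_, h'⟩
  rw [e'] at h3
  have h4 : -J (A ⟨resolventOf A z g, h⟩) - w • J (resolventOf A z g) = -J g := by
    have h5 := congrArg J e
    rw [map_sub, J.map_smulₛₗ] at h5
    rw [hzw, neg_smul, ← h5]
    abel
  simp only at h3
  rw [h4, map_neg] at h3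
  exact h3.symm

variable [CompleteSpace E]

/-- The reflection z ↦ -z̄ preserves a circle centred on the imaginary axis and sends the angle θ to
π - θ. The sign from reflecting z - c cancels the sign in the resolvent symmetry. -/
theorem rieszProj_conj {J : E →L⋆[ℂ] E} {A : E →ₗ.[ℂ] E} (hJA : Anticommutes J A)
    {c : ℂ} {ρ : ℝ} (hc : c = -(starRingEnd ℂ) c) (hρ : 0 ≤ ρ)
    (hs : Metric.sphere c ρ ⊆ resolventSetOf A) (g : E) :
    J (rieszProj A c ρ g) = rieszProj A c ρ (J g) := by
  have hm : ∀ θ, circleMap c ρ θ ∈ Metric.sphere c ρ := circleMap_mem_sphere c hρ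
  have hcR : Continuous fun θ => resolventOf A (circleMap c ρ θ) :=
    (continuousOn_resolventOf.mono hs).comp_continuous (continuous_circleMap c ρ) hm
  -- As dz = i (z - c) dθ, the i in the prefactor cancels. The remaining scalar 1/(2π) is real, so
  -- `J` passes through it.
  have form : ∀ x, rieszProj A c ρ x = -((2 * Real.pi : ℂ)⁻¹ • ∫ θ in (0 : ℝ)..2 * Real.pi,
      circleMap 0 ρ θ • resolventOf A (circleMap c ρ θ) x) := by
    intro x
    have hi : IntervalIntegrable (fun θ => deriv (circleMap c ρ) θ •
        resolventOf A (circleMap c ρ θ)) volume 0 (2 * Real.pi) := by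
      simp only [deriv_circleMap]
      exact (((continuous_circleMap 0 ρ).mul continuous_const).smul hcR).intervalIntegrable _ _
    have h1 := (ContinuousLinearMap.apply ℂ E x).intervalIntegral_comp_comm hi
    simp only [ContinuousLinearMap.apply_apply, smul_apply, deriv_circleMap] at h1
    rw [rieszProj, circleIntegral, neg_apply, smul_apply]
    simp only [deriv_circleMap]
    rw [← h1]
    simp only [mul_comm _ Complex.I, mul_smul]
    rw [intervalIntegral.integral_smul, smul_smul]
    congr 2
    have : Complex.I ≠ 0 := Complex.I_ne_zero
    have : (Real.pi : ℂ) ≠ 0 := Complex.ofReal_ne_zero.2 Real.pi_ne_zero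
    field_simp
  rw [form, form, map_neg, J.map_smulₛₗ]
  have h2 : (starRingEnd ℂ) (2 * Real.pi : ℂ)⁻¹ = (2 * Real.pi : ℂ)⁻¹ := by
    simp [Complex.conj_ofNat]
  rw [h2]
  have hcx : ∀ x, Continuous fun θ => resolventOf A (circleMap c ρ θ) x := fun x =>
    hcR.clm_apply continuous_const
  have hi : IntervalIntegrable (fun θ => circleMap 0 ρ θ •
      resolventOf A (circleMap c ρ θ) g) volume 0 (2 * Real.pi) :=
    ((continuous_circleMap 0 ρ).smul (hcx g)).intervalIntegrable _ _
  -- Regarded as real-linear, `J` can be exchanged with the integral over θ.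
  set J' : E →L[ℝ] E :=
    { toFun := J
      map_add' := map_add J
      map_smul' := fun a x => by
        rw [RingHom.id_apply, ← Complex.coe_smul, J.map_smulₛₗ, Complex.conj_ofReal,
          Complex.coe_smul]
      cont := J.continuous }
  change -((2 * Real.pi : ℂ)⁻¹ • J' _) = _
  rw [← J'.intervalIntegral_comp_comm hi]
  congr 2
  set G : ℝ → E := fun θ => circleMap 0 ρ θ • resolventOf A (circleMap c ρ θ) (J g) with hG
  have h3 : ∀ θ, J' (circleMap 0 ρ θ • resolventOf A (circleMap c ρ θ) g) = G (Real.pi - θ) := by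
    intro θ
    have h5 : circleMap 0 ρ (Real.pi - θ) = -(starRingEnd ℂ) (circleMap 0 ρ θ) := by
      simp only [circleMap, zero_add, map_mul, Complex.conj_ofReal, ← Complex.exp_conj,
        Complex.conj_I]
      rw [Complex.ofReal_sub, sub_mul, Complex.exp_sub, Complex.exp_pi_mul_I, mul_neg,
        Complex.exp_neg]
      ring
    have h4 : circleMap c ρ (Real.pi - θ) = -(starRingEnd ℂ) (circleMap c ρ θ) := by
      have e : ∀ t, circleMap c ρ t = c + circleMap 0 ρ t := fun t => by simp [circleMap]
      rw [e, e, h5, map_add, neg_add, ← hc]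
    change J _ = _
    rw [J.map_smulₛₗ, resolventOf_conj hJA (hs (hm θ)) (hs (hm (Real.pi - θ))) h4, hG]
    simp only [h5]
    rw [smul_neg, neg_smul]
  simp only [h3]
  rw [intervalIntegral.integral_comp_sub_left (f := G)]
  -- The substitution θ ↦ π - θ moves the interval to [-π, π]; periodicity brings it back to [0,
  -- 2π].
  have hper : Function.Periodic G (2 * Real.pi) := by
    intro θ
    simp only [hG, periodic_circleMap _ _ θ]
  have h6 := hper.intervalIntegral_add_eq (Real.pi - 2 * Real.pi) 0
  simpa using h6

end Conj

/-! ### The matrix of the perturbed operator on its spectral subspace. -/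

section Kato

variable {E : Type*} [NormedAddCommGroup E] [NormedSpace ℂ E] [CompleteSpace E]

/-- Testing A ε P f_j = ∑ M_kj P f_k against the left eigenfunctionals `l i` of A 0 gives G M = c G
+ ε N, hence M = c + ε G⁻¹N. The scalar part c is exact: every ε-dependence sits in the factor
multiplying ε. The hypotheses on `J` make G real and N imaginary. -/
theorem exists_representing_matrix {A : ℝ → E →ₗ.[ℂ] E} {B : E →L[ℂ] E} (hA : IsAffineFamily A B)
    {J : E →L⋆[ℂ] E} (hJA : Anticommutes J (A 0))
    (hJB : ∀ x, B (J x) = -J (B x))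
    {c : ℂ} {r ρ : ℝ} (hc : c = -(starRingEnd ℂ) c) (hr : 0 < r) (hρ : r < ρ)
    (hs : Metric.closedBall c ρ \ Metric.ball c r ⊆ resolventSetOf (A 0))
    {f : Fin 2 → E} {l : Fin 2 → E →L[ℂ] ℂ}
    (hP : ∀ g, rieszProj (A 0) c ρ g = ∑ i, l i g • f i)
    (hl : ∀ i j, l i (f j) = if i = j then 1 else 0)
    (hleft : ∀ i (u : (A 0).domain), l i (A 0 u) = c * l i u)
    (hJf : ∀ j, J (f j) = f j) (hJl : ∀ i x, l i (J x) = (starRingEnd ℂ) (l i x)) :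
    ∃ H : ℝ → Matrix (Fin 2) (Fin 2) ℂ, (∀ i j, AnalyticAt ℝ (fun ε => H ε i j) 0) ∧
      (∀ i j, H 0 i j = l i (B (f j))) ∧
      ∀ᶠ ε in 𝓝 (0 : ℝ), Metric.sphere c ρ ⊆ resolventSetOf (A ε) ∧
        Module.finrank ℂ (LinearMap.range (rieszProj (A ε) c ρ : E →ₗ[ℂ] E)) = 2 ∧
        IsRepresentedBy (A ε) (LinearMap.range (rieszProj (A ε) c ρ : E →ₗ[ℂ] E))
          (fun j => rieszProj (A ε) c ρ (f j)) (c • 1 + (ε : ℂ) • H ε) ∧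
        ∀ i j, (starRingEnd ℂ) (H ε i j) = -H ε i j := by
  have hρ0 : 0 < ρ := hr.trans hρ
  set P : ℝ → E →L[ℂ] E := fun ε => rieszProj (A ε) c ρ with hPdef
  set G : ℝ → Matrix (Fin 2) (Fin 2) ℂ := fun ε => Matrix.of fun i j => l i (P ε (f j)) with hG
  set N : ℝ → Matrix (Fin 2) (Fin 2) ℂ := fun ε => Matrix.of fun i j => l i (B (P ε (f j))) with hN
  have hss : Metric.sphere c ρ ⊆ resolventSetOf (A 0) :=
    (sphere_subset_annulus hρ.le le_rfl).trans hs
  have hK : IsCompact (Metric.closedBall c ρ \ Metric.ball c r) :=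
    (isCompact_closedBall c ρ).diff Metric.isOpen_ball
  have hGa : ∀ i j, AnalyticAt ℝ (fun ε => G ε i j) 0 := fun i j =>
    hA.analyticAt_rieszProj hρ0.le hss (l i) (f j)
  have hNa : ∀ i j, AnalyticAt ℝ (fun ε => N ε i j) 0 := fun i j =>
    hA.analyticAt_rieszProj hρ0.le hss ((l i).comp B) (f j)
  have hP0 : ∀ j, P 0 (f j) = f j := by
    intro j
    rw [hPdef]
    simp only
    rw [hP]
    simp [hl]
  have hG0 : G 0 = 1 := by
    ext i j
    simp only [hG, Matrix.of_apply, hP0, hl, Matrix.one_apply]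
  -- This is G⁻¹N in Cramer's form, so that analyticity can be read off entry by entry.
  refine ⟨fun ε => (G ε).det⁻¹ • ((G ε).adjugate * N ε), ?_, ?_, ?_⟩
  · have hd : AnalyticAt ℝ (fun ε => (G ε).det) 0 := by
      simp only [Matrix.det_fin_two]
      exact ((hGa 0 0).mul (hGa 1 1)).sub ((hGa 0 1).mul (hGa 1 0))
    have hd' := hd.inv (by rw [hG0]; simp)
    intro i j
    simp only [Matrix.smul_apply, Matrix.adjugate_fin_two, Matrix.mul_apply, Fin.sum_univ_two,
      smul_eq_mul]
    refine hd'.mul ?_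
    fin_cases i
    · exact ((hGa 1 1).mul (hNa 0 j)).add ((hGa 0 1).neg.mul (hNa 1 j))
    · exact ((hGa 1 0).neg.mul (hNa 0 j)).add ((hGa 0 0).mul (hNa 1 j))
  · intro i j
    simp only [hG0, Matrix.det_one, inv_one, one_smul, Matrix.adjugate_one, one_mul]
    simp only [hN, Matrix.of_apply, hP0]
  · filter_upwards [hA.exists_subset_resolventSetOf hK hs, hA.eventually_norm_lt hρ0.le hss]
      with ε h1 h2
    have hsε : Metric.sphere c ρ ⊆ resolventSetOf (A ε) :=
      (sphere_subset_annulus hρ.le le_rfl).trans h1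
    obtain ⟨hli, hspan, hrank, hdet⟩ :=
      rank_two_of_near (rieszProj_mul_self hr hρ h1) h2 hP hl
    have hPP : ∀ x, P ε (P ε x) = P ε x := fun x => by
      have := congrArg (fun T : E →L[ℂ] E => T x) (rieszProj_mul_self hr hρ h1)
      simpa using this
    have hdom : ∀ x, P ε x ∈ (A ε).domain := range_rieszProj_le_domain hρ0.le hsε
    refine ⟨hsε, hrank, ⟨hli, hspan, ?_, ?_⟩, ?_⟩
    · rintro _ ⟨x, rfl⟩
      exact hdom x
    · intro j
      refine ⟨hdom _, ?_⟩
      have hmem : A ε ⟨P ε (f j), hdom _⟩ ∈ Submodule.span ℂ (Set.range fun j => P ε (f j)) := by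
        rw [hspan]
        exact ⟨_, apply_mem_range_rieszProj hρ0.le hsε ⟨P ε (f j), hdom _⟩ (hPP _)⟩
      obtain ⟨m, hm⟩ := (Submodule.mem_span_range_iff_exists_fun ℂ).1 hmem
      have hdom0 : P ε (f j) ∈ (A 0).domain := by rw [← (hA ε).1]; exact hdom _
      -- The left-eigenvector property turns `l i (A 0 (P f_j))` into c G_ij; no expansion of A 0 on
      -- the perturbed vectors is needed.
      have h3 : ∀ i, ∑ k, G ε i k * m k = c * G ε i j + ε * N ε i j := by
        intro i
        have h4 := congrArg (l i) hm
        rw [(hA ε).2 _ hdom0 (hdom _), map_add, hleft, map_smul, map_sum] at h4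
        simp only [map_smul, smul_eq_mul] at h4
        simp only [hG, hN, Matrix.of_apply]
        rw [← h4]
        exact Finset.sum_congr rfl fun k _ => mul_comm _ _
      have h5 : m = fun i => (c • (1 : Matrix (Fin 2) (Fin 2) ℂ) +
          (ε : ℂ) • (G ε).det⁻¹ • ((G ε).adjugate * N ε)) i j := by
        have h6 : (G ε).mulVec m = c • (G ε).col j + (ε : ℂ) • (N ε).col j := by
          ext i
          simpa [Matrix.mulVec, dotProduct] using h3 i
        have h7 : (G ε)⁻¹ = (G ε).det⁻¹ • (G ε).adjugate := by
          rw [Matrix.inv_def, Ring.inverse_eq_inv']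
        have hu : IsUnit (G ε).det := isUnit_iff_ne_zero.2 hdet
        have h8 := congrArg ((G ε)⁻¹).mulVec h6
        rw [Matrix.mulVec_mulVec, Matrix.nonsing_inv_mul _ hu, Matrix.one_mulVec,
          Matrix.mulVec_add, Matrix.mulVec_smul, Matrix.mulVec_smul] at h8
        rw [h8]
        ext i
        have e1 : ∀ M : Matrix (Fin 2) (Fin 2) ℂ, ((G ε)⁻¹.mulVec (M.col j)) i =
            ((G ε)⁻¹ * M) i j := fun M => rfl
        simp only [Pi.add_apply, Pi.smul_apply, e1, Matrix.nonsing_inv_mul _ hu]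
        simp only [h7, Matrix.add_apply, Matrix.smul_apply, Matrix.smul_mul]
      rw [← hm]
      exact Finset.sum_congr rfl fun i _ => by rw [h5]
    · have hJAε : Anticommutes J (A ε) := by
        rintro ⟨u, hu⟩
        have hu0 : u ∈ (A 0).domain := by rw [← (hA ε).1]; exact hu
        obtain ⟨h3, h4⟩ := hJA ⟨u, hu0⟩
        refine ⟨(SetLike.ext_iff.1 (hA ε).1 _).2 h3, ?_⟩
        rw [(hA ε).2 _ h3, h4, (hA ε).2 _ hu0, map_add, J.map_smulₛₗ, hJB, Complex.conj_ofReal,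
          smul_neg, neg_add]
      have hJP : ∀ j, J (P ε (f j)) = P ε (f j) := fun j => by
        rw [hPdef]
        simp only
        rw [rieszProj_conj hJAε hc hρ0.le hsε, hJf]
      have hGr : ∀ i j, (starRingEnd ℂ) (G ε i j) = G ε i j := by
        intro i j
        simp only [hG, Matrix.of_apply]
        rw [← hJl, hJP]
      have hNr : ∀ i j, (starRingEnd ℂ) (N ε i j) = -N ε i j := by
        intro i j
        simp only [hN, Matrix.of_apply]
        rw [← hJl, ← neg_eq_iff_eq_neg, ← map_neg, ← hJB, hJP]
      intro i j
      simp only [Matrix.smul_apply, Matrix.adjugate_fin_two, Matrix.mul_apply, Fin.sum_univ_two,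
        smul_eq_mul, Matrix.det_fin_two]
      fin_cases i <;> simp [hGr, hNr] <;> ring

end Kato

/-! ### Operators on `H⁰_k` in Fourier coordinates -/

def coeffL (q : Freq) : L2 →L[ℂ] ℂ :=
  LinearMap.mkContinuous
    { toFun := fun f => coeff f q
      map_add' := fun f g => coeff_add f g q
      map_smul' := fun c f => coeff_smul c f q } 1 (fun f => by
    rw [one_mul, ← expBasis.repr.norm_map f]
    exact lp.norm_apply_le_norm (by norm_num) _ q)

@[simp] theorem coeffL_apply (q : Freq) (f : L2) : coeffL q f = coeff f q := rfl

theorem norm_sq_eq_tsum (f : L2) : ‖f‖ ^ 2 = ∑' q, ‖coeff f q‖ ^ 2 := by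
  have := lp.norm_rpow_eq_tsum (p := 2) (by norm_num) (expBasis.repr f)
  rw [expBasis.repr.norm_map f] at this
  simpa only [coeff, ENNReal.toReal_ofNat, Real.rpow_ofNat] using this

theorem summable_norm_sq_coeff (f : L2) : Summable fun q => ‖coeff f q‖ ^ 2 := by
  have := (memℓp_gen_iff (p := 2) (by norm_num)).1 (memlp_coeff f)
  simpa using this

theorem exists_boundedMul {a : Freq → ℂ} {C : ℝ} (h : ∀ q, ‖a q‖ ≤ C) :
    ∃ T : L2 →L[ℂ] L2, ∀ f q, coeff (T f) q = a q * coeff f q := by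
  have hC : 0 ≤ C := (norm_nonneg _).trans (h 0)
  have hm : ∀ f : L2, Memℓp (fun q => a q * coeff f q) 2 := fun f =>
    memlp_of_le (memlp_coeff f) C fun q => by
      rw [norm_mul]
      exact mul_le_mul_of_nonneg_right (h q) (norm_nonneg _)
  refine ⟨LinearMap.mkContinuous
    { toFun := fourierMul a
      map_add' := fun f g => fourierMul_add (hm f) (hm g)
      map_smul' := fun c f => fourierMul_smul c (hm f) } C fun f => ?_,
    fun f q => coeff_fourierMul (hm f) q⟩
  refine le_of_sq_le_sq ?_ (by positivity)
  simp only [LinearMap.coe_mk, AddHom.coe_mk]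
  rw [norm_sq_eq_tsum, mul_pow, norm_sq_eq_tsum f, ← tsum_mul_left]
  refine Summable.tsum_le_tsum (fun q => ?_) (summable_norm_sq_coeff _)
    ((summable_norm_sq_coeff f).mul_left _)
  rw [coeff_fourierMul (hm f), norm_mul, mul_pow]
  gcongr
  exact h q

section Hk

variable {k : Freq}

/-- The Fourier coefficient of the first component at `l k`. -/
def cb (k : Freq) (l : ℤ) : Hk k →L[ℂ] ℂ :=
  (coeffL (l • k)).comp ((ContinuousLinearMap.fst ℂ L2 L2).comp (Hk k).subtypeL)

/-- The Fourier coefficient of the second component at `l k`. -/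
def cw (k : Freq) (l : ℤ) : Hk k →L[ℂ] ℂ :=
  (coeffL (l • k)).comp ((ContinuousLinearMap.snd ℂ L2 L2).comp (Hk k).subtypeL)

theorem cb_apply (l : ℤ) (u : Hk k) : cb k l u = coeff u.1.1 (l • k) := rfl

theorem cw_apply (l : ℤ) (u : Hk k) : cw k l u = coeff u.1.2 (l • k) := rfl

theorem Hk_ext {u v : Hk k} (hb : ∀ l, cb k l u = cb k l v) (hw : ∀ l, cw k l u = cw k l v) :
    u = v := by
  refine Subtype.ext (Prod.ext (coeff_ext fun q => ?_) (coeff_ext fun q => ?_))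
  · by_cases hq : ∃ l : ℤ, q = l • k
    · obtain ⟨l, rfl⟩ := hq
      exact hb l
    · rw [(u.2 q (not_exists.1 hq)).1, (v.2 q (not_exists.1 hq)).1]
  · by_cases hq : ∃ l : ℤ, q = l • k
    · obtain ⟨l, rfl⟩ := hq
      exact hw l
    · rw [(u.2 q (not_exists.1 hq)).2, (v.2 q (not_exists.1 hq)).2]

instance : CompleteSpace (Hk k) := by
  have h : IsClosed ((Hk k : Submodule ℂ X) : Set X) := by
    have e : ((Hk k : Submodule ℂ X) : Set X) = ⋂ q : Freq, ⋂ _ : ∀ l : ℤ, q ≠ l • k,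
        {u : X | coeffL q u.1 = 0} ∩ {u : X | coeffL q u.2 = 0} := by
      ext u
      simp only [Set.mem_iInter, Set.mem_inter_iff, Set.mem_ofPred_eq, coeffL_apply]
      exact Iff.rfl
    rw [e]
    refine isClosed_iInter fun q => isClosed_iInter fun _ => IsClosed.inter ?_ ?_
    · exact isClosed_eq ((coeffL q).continuous.comp continuous_fst) continuous_const
    · exact isClosed_eq ((coeffL q).continuous.comp continuous_snd) continuous_const
  exact h.completeSpace_coe

theorem smul_injective (hk : k ≠ 0) : Function.Injective fun l : ℤ => l • k :=
  smul_left_injective ℤ hk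

theorem exists_restrict (T : X →L[ℂ] X) (hT : ∀ u ∈ Hk k, T u ∈ Hk k) :
    ∃ S : Hk k →L[ℂ] Hk k, ∀ u, (S u : X) = T u :=
  ⟨(T.comp (Hk k).subtypeL).codRestrict (Hk k) fun u => hT u u.2, fun _ => rfl⟩

/-- A block Fourier multiplier with bounded symbol. -/
theorem exists_blockOp (hk : k ≠ 0) {m : Fin 2 → Fin 2 → ℤ → ℂ} {C : ℝ}
    (h : ∀ i j l, ‖m i j l‖ ≤ C) :
    ∃ T : Hk k →L[ℂ] Hk k, ∀ u l, cb k l (T u) = m 0 0 l * cb k l u + m 0 1 l * cw k l u ∧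
      cw k l (T u) = m 1 0 l * cb k l u + m 1 1 l * cw k l u := by
  have hC : 0 ≤ C := (norm_nonneg _).trans (h 0 0 0)
  -- The symbol is prescribed on kℤ only; k ≠ 0 makes l ↦ lk injective, and off kℤ the symbol is
  -- extended by zero.
  have hext : ∀ i j, ∃ T : L2 →L[ℂ] L2, ∀ f q, coeff (T f) q =
      Function.extend (fun l : ℤ => l • k) (m i j) 0 q * coeff f q := by
    intro i j
    refine exists_boundedMul (C := C) fun q => ?_
    by_cases hq : ∃ l : ℤ, l • k = q
    · obtain ⟨l, rfl⟩ := hq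
      rw [(smul_injective hk).extend_apply]
      exact h i j l
    · rw [Function.extend_apply' _ _ _ hq]
      simpa using hC
  choose T hT using hext
  have hT' : ∀ i j f (l : ℤ), coeff (T i j f) (l • k) = m i j l * coeff f (l • k) := by
    intro i j f l
    rw [hT, (smul_injective hk).extend_apply]
  obtain ⟨S, hS⟩ := exists_restrict (k := k)
    (((T 0 0).comp (ContinuousLinearMap.fst ℂ L2 L2) +
      (T 0 1).comp (ContinuousLinearMap.snd ℂ L2 L2)).prod
    ((T 1 0).comp (ContinuousLinearMap.fst ℂ L2 L2) +
      (T 1 1).comp (ContinuousLinearMap.snd ℂ L2 L2))) (by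
    intro u hu q hq
    simp [coeff_add, hT, (hu q hq).1, (hu q hq).2])
  refine ⟨S, fun u l => ?_⟩
  constructor
  · rw [cb_apply, hS]
    simp [coeff_add, hT', cb_apply, cw_apply, -zsmul_eq_mul]
  · rw [cw_apply, hS]
    simp [coeff_add, hT', cb_apply, cw_apply, -zsmul_eq_mul]

theorem exists_cosOp (k : Freq) :
    ∃ T : Hk k →L[ℂ] Hk k, ∀ u l, cb k l (T u) = (cb k (l - 1) u + cb k (l + 1) u) / 2 ∧
      cw k l (T u) = (cw k (l - 1) u + cw k (l + 1) u) / 2 := by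
  set c : L2 →L[ℂ] L2 := LinearMap.mkContinuous
    { toFun := mulCos k
      map_add' := mulCos_add k
      map_smul' := mulCos_smul k } _ (fun f => Lp.norm_smul_le _ _) with hc
  have hcc : ∀ f q, coeff (c f) q = (coeff f (q - k) + coeff f (q + k)) / 2 :=
    fun f q => coeff_mulCos k f q
  obtain ⟨S, hS⟩ := exists_restrict (k := k) (c.prodMap c) (by
    intro u hu q hq
    have hm : ∀ l : ℤ, q - k ≠ l • k := fun l h =>
      hq (l + 1) (by rw [add_smul, one_smul, ← h]; abel)
    have hp : ∀ l : ℤ, q + k ≠ l • k := fun l h =>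
      hq (l - 1) (by rw [sub_smul, one_smul, ← h]; abel)
    simp [hcc, (hu _ hm).1, (hu _ hm).2, (hu _ hp).1, (hu _ hp).2])
  refine ⟨S, fun u l => ?_⟩
  constructor
  · rw [cb_apply, hS]
    simp [hcc, cb_apply, sub_smul, add_smul]
  · rw [cw_apply, hS]
    simp [hcc, cw_apply, sub_smul, add_smul]

theorem exists_conj_L2 :
    ∃ J : L2 →L⋆[ℂ] L2, ∀ f q, coeff (J f) q = (starRingEnd ℂ) (coeff f q) := by
  set j : L2 → L2 := fun f => expBasis.repr.symm (star (expBasis.repr f)) with hj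
  have hc : ∀ f q, coeff (j f) q = (starRingEnd ℂ) (coeff f q) := by
    intro f q
    rw [coeff, hj]
    simp only [LinearIsometryEquiv.apply_symm_apply]
    rfl
  refine ⟨LinearMap.mkContinuous
    { toFun := j
      map_add' := fun f g => coeff_ext fun q => by simp [hc, coeff_add]
      map_smul' := fun a f => coeff_ext fun q => by simp [hc, coeff_smul] } 1 (fun f => ?_), hc⟩
  simp only [LinearMap.coe_mk, AddHom.coe_mk, hj, LinearIsometryEquiv.norm_map, norm_star]
  rw [one_mul]

/-- Complex conjugation of the Fourier coefficients. -/
theorem exists_conj (k : Freq) : ∃ J : Hk k →L⋆[ℂ] Hk k,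
    (∀ u q, coeff (J u).1.1 q = (starRingEnd ℂ) (coeff u.1.1 q)) ∧
    (∀ u q, coeff (J u).1.2 q = (starRingEnd ℂ) (coeff u.1.2 q)) := by
  obtain ⟨j, hj⟩ := exists_conj_L2
  have hm : ∀ u : Hk k, (j u.1.1, j u.1.2) ∈ Hk k := by
    intro u q hq
    simp [hj, (u.2 q hq).1, (u.2 q hq).2]
  refine ⟨⟨⟨⟨fun u => ⟨(j u.1.1, j u.1.2), hm u⟩, fun u v => Subtype.ext ?_⟩,
    fun a u => Subtype.ext ?_⟩, ?_⟩, fun u q => hj _ _, fun u q => hj _ _⟩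
  · simp
  · simp
  · exact Continuous.subtype_mk
      ((j.continuous.comp (continuous_fst.comp continuous_subtype_val)).prodMk
      (j.continuous.comp (continuous_snd.comp continuous_subtype_val))) _

end Hk

/-! ### Fourier symbols of the differential expressions. -/

section Symbols

theorem inner_plane (v w : Plane) : inner ℝ v w = v 0 * w 0 + v 1 * w 1 := by
  simp [PiLp.inner_apply, Fin.sum_univ_two, mul_comm]

theorem norm_sq_plane (v : Plane) : ‖v‖ ^ 2 = v 0 ^ 2 + v 1 ^ 2 := by
  simp [EuclideanSpace.norm_sq_eq, Fin.sum_univ_two]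

theorem norm_plane (v : Plane) : ‖v‖ = √(v 0 ^ 2 + v 1 ^ 2) := by
  rw [← norm_sq_plane, Real.sqrt_sq (norm_nonneg _)]

@[simp] theorem vec_zero_apply (q : Freq) : vec q 0 = q 0 := rfl
@[simp] theorem vec_one_apply (q : Freq) : vec q 1 = q 1 := rfl
@[simp] theorem perp_zero_apply (v : Plane) : perp v 0 = v 1 := rfl
@[simp] theorem perp_one_apply (v : Plane) : perp v 1 = -v 0 := rfl

theorem vec_smul (l : ℤ) (k : Freq) : vec (l • k) = (l : ℝ) • vec k := by
  ext i
  fin_cases i <;> simp [vec]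

theorem coeff_shiftedGrad {f : L2} (hf : f ∈ H1) (μ v : Plane) (q : Freq) :
    coeff (shiftedGrad μ v f) q = Complex.I * (inner ℝ v (vec q + μ) : ℝ) * coeff f q := by
  rw [shiftedGrad, shiftedD, shiftedD, coeff_add, coeff_smul, coeff_smul,
    coeff_fourierMul (memlp_shiftedD hf μ 0), coeff_fourierMul (memlp_shiftedD hf μ 1), inner_plane]
  push_cast
  ring

theorem coeff_shiftedD {f : L2} (hf : f ∈ H1) (μ : Plane) (j : Fin 2) (q : Freq) :
    coeff (shiftedD μ j f) q = Complex.I * ((vec q + μ) j : ℝ) * coeff f q :=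
  coeff_fourierMul (memlp_shiftedD hf μ j) q

theorem coeff_shiftedD_invLap (f : L2) (μ : Plane) (j : Fin 2) (q : Freq) :
    coeff (shiftedD μ j (invLap μ f)) q =
      Complex.I * ((vec q + μ) j : ℝ) * ((‖vec q + μ‖ ^ 2)⁻¹ : ℝ) * coeff f q := by
  rw [shiftedD, coeff_fourierMul (memlp_shiftedD_invLap f μ j), invLap,
    coeff_fourierMul (memlp_invLap f μ)]
  ring

theorem coeff_shiftedPerpGrad_invLap (f : L2) (μ v : Plane) (q : Freq) :
    coeff (shiftedPerpGrad μ v (invLap μ f)) q =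
      -Complex.I * (inner ℝ (perp v) (vec q + μ) : ℝ) * ((‖vec q + μ‖ ^ 2)⁻¹ : ℝ) * coeff f q := by
  rw [shiftedPerpGrad, coeff_sub, coeff_smul, coeff_smul, coeff_shiftedD_invLap,
    coeff_shiftedD_invLap, inner_plane]
  simp only [perp_zero_apply, perp_one_apply]
  push_cast
  ring

/-- `l k + μ`. -/
def wv (k : Freq) (μ : Plane) (l : ℤ) : Plane := vec (l • k) + μ

/-- This is what makes the perturbation bounded: along kℤ the derivative in the direction k^⊥ has a
constant symbol, since k^⊥·k = 0. -/
theorem inner_perp_wv (k : Freq) (μ : Plane) (l : ℤ) :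
    inner ℝ (perp (vec k)) (wv k μ l) = inner ℝ (perp (vec k)) μ := by
  simp only [wv, vec_smul, inner_plane, PiLp.add_apply, PiLp.smul_apply, smul_eq_mul,
    perp_zero_apply, perp_one_apply]
  ring

/-- `c·(lk + μ)`. -/
def transport (N : ℝ) (k : Freq) (μ : Plane) (l : ℤ) : ℝ := inner ℝ (waveSpeed N k) (wv k μ l)

theorem freqW_eq (N : ℝ) (k : Freq) (μ : Plane) (σ : ℝ) (l : ℤ) :
    freqW N k μ σ l = transport N k μ l + σ * Omega N (wv k μ l) := rfl

end Symbols

/-! ### The operator mode by mode, and its eigenvector coordinates. -/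

section Coordinates

variable (N : ℝ) (k : Freq) (μ : Plane)

theorem restrictedOp_apply (ε : ℝ) (u : (restrictedOp N k μ ε).domain) :
    (restrictedOp N k μ ε u : X) = linOpFun N k μ ε u.1.1 := rfl

theorem cb_restrictedOp (u : (restrictedOp N k μ 0).domain) (l : ℤ) :
    cb k l (restrictedOp N k μ 0 u) = Complex.I * transport N k μ l * cb k l u -
      Complex.I * (N ^ 2 * (wv k μ l) 0 * (‖wv k μ l‖ ^ 2)⁻¹ : ℝ) * cw k l u := by
  have h1 : u.1.1.1 ∈ H1 := u.2.1
  rw [cb_apply, restrictedOp_apply]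
  simp only [linOpFun, coeff_sub, coeff_smul, coeff_shiftedGrad h1, coeff_shiftedD_invLap,
    zero_div, Complex.ofReal_zero, zero_mul, sub_zero, cb_apply, cw_apply, transport, wv]
  push_cast
  ring

theorem cw_restrictedOp (u : (restrictedOp N k μ 0).domain) (l : ℤ) :
    cw k l (restrictedOp N k μ 0 u) = Complex.I * transport N k μ l * cw k l u -
      Complex.I * ((wv k μ l) 0 : ℝ) * cb k l u := by
  have h1 : u.1.1.1 ∈ H1 := u.2.1
  have h2 : u.1.1.2 ∈ H1 := u.2.2
  rw [cw_apply, restrictedOp_apply]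
  simp only [linOpFun, coeff_sub, coeff_smul, coeff_shiftedGrad h2,
    coeff_shiftedD h1,
    zero_div, Complex.ofReal_zero, zero_mul, sub_zero, cb_apply, cw_apply, transport, wv]

/-- The perturbation `(𝓛_{μ,ε} - 𝓛_{μ,0}) / ε`, which is bounded on `H⁰_k`. -/
theorem exists_perturbation (hk : k ≠ 0) :
    ∃ B : Hk k →L[ℂ] Hk k, IsAffineFamily (restrictedOp N k μ) B ∧
      ∀ u l, cb k l (B u) =
          Complex.I * ((inner ℝ (perp (vec k)) μ / 2 : ℝ) : ℂ) *
            (-((1 / (N * ‖vec k‖) : ℝ) : ℂ) * (cb k (l - 1) u + cb k (l + 1) u) +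
              (((‖wv k μ (l - 1)‖ ^ 2)⁻¹ : ℝ) * cw k (l - 1) u +
                ((‖wv k μ (l + 1)‖ ^ 2)⁻¹ : ℝ) * cw k (l + 1) u)) ∧
        cw k l (B u) =
          Complex.I * ((inner ℝ (perp (vec k)) μ / 2 : ℝ) : ℂ) *
            (-((1 / (N * ‖vec k‖) : ℝ) : ℂ) * (cw k (l - 1) u + cw k (l + 1) u) +
              ((‖vec k‖ / N : ℝ) : ℂ) * (((‖wv k μ (l - 1)‖ ^ 2)⁻¹ : ℝ) * cw k (l - 1) u +
                ((‖wv k μ (l + 1)‖ ^ 2)⁻¹ : ℝ) * cw k (l + 1) u)) := by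
  obtain ⟨C, hC⟩ := exists_bound_invLap μ
  set S : ℝ := inner ℝ (perp (vec k)) μ with hS
  set α : ℂ := -(Complex.I * S * ((1 / (N * ‖vec k‖) : ℝ) : ℂ)) with hα
  set κ : ℂ := ((‖vec k‖ / N : ℝ) : ℂ) with hκ
  -- The perturbation is factored as multiplication by cos(k·x) after a block multiplier `T`. The
  -- diagonal of the symbol is bounded because the derivative reduces to the constant `S`; the other
  -- terms carry |lk + μ|⁻², which is bounded in l.
  obtain ⟨T, hT⟩ := exists_blockOp hk (m := fun i j l =>
      if i = j then α + (if i = 0 then 0 else Complex.I * S * κ * ((‖wv k μ l‖ ^ 2)⁻¹ : ℝ))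
      else if i = 0 then Complex.I * S * ((‖wv k μ l‖ ^ 2)⁻¹ : ℝ) else 0)
    (C := ‖α‖ + ‖Complex.I * S * κ‖ * C + ‖Complex.I * S‖ * C) (by
      intro i j l
      have hl : ‖(((‖wv k μ l‖ ^ 2)⁻¹ : ℝ) : ℂ)‖ ≤ C := by
        rw [Complex.norm_real, Real.norm_of_nonneg (by positivity)]
        exact hC _
      have hC0 : 0 ≤ C := (norm_nonneg _).trans hl
      have h1 : ‖Complex.I * S * κ * ((‖wv k μ l‖ ^ 2)⁻¹ : ℝ)‖ ≤ ‖Complex.I * S * κ‖ * C := by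
        rw [norm_mul]; gcongr
      have h2 : ‖Complex.I * S * ((‖wv k μ l‖ ^ 2)⁻¹ : ℝ)‖ ≤ ‖Complex.I * S‖ * C := by
        rw [norm_mul]; gcongr
      have p1 : 0 ≤ ‖Complex.I * S * κ‖ * C := by positivity
      have p2 : 0 ≤ ‖Complex.I * S‖ * C := by positivity
      have p3 := norm_nonneg α
      split_ifs
      · rw [add_zero]; linarith
      · exact (norm_add_le _ _).trans (by linarith)
      · linarith
      · rw [norm_zero]; linarith)
  obtain ⟨c, hc⟩ := exists_cosOp k
  have h01 : (0 : Fin 2) ≠ 1 := by decide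
  have h10 : (1 : Fin 2) ≠ 0 := by decide
  simp only [if_true, if_neg h01, if_neg h10, add_zero, zero_mul, zero_add] at hT
  have hb : ∀ u l, cb k l ((c.comp T) u) = Complex.I * ((S / 2 : ℝ) : ℂ) *
            (-((1 / (N * ‖vec k‖) : ℝ) : ℂ) * (cb k (l - 1) u + cb k (l + 1) u) +
              (((‖wv k μ (l - 1)‖ ^ 2)⁻¹ : ℝ) * cw k (l - 1) u +
                ((‖wv k μ (l + 1)‖ ^ 2)⁻¹ : ℝ) * cw k (l + 1) u)) := by
    intro u l
    rw [ContinuousLinearMap.comp_apply, (hc _ _).1, (hT _ _).1, (hT _ _).1, hα]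
    push_cast
    ring
  have hw : ∀ u l, cw k l ((c.comp T) u) = Complex.I * ((S / 2 : ℝ) : ℂ) *
            (-((1 / (N * ‖vec k‖) : ℝ) : ℂ) * (cw k (l - 1) u + cw k (l + 1) u) +
              κ * (((‖wv k μ (l - 1)‖ ^ 2)⁻¹ : ℝ) * cw k (l - 1) u +
                ((‖wv k μ (l + 1)‖ ^ 2)⁻¹ : ℝ) * cw k (l + 1) u)) := by
    intro u l
    rw [ContinuousLinearMap.comp_apply, (hc _ _).2, (hT _ _).2, (hT _ _).2, hα]
    push_cast
    ring
  refine ⟨c.comp T, fun ε => ⟨rfl, fun u h h' => ?_⟩, fun u l => ⟨hb u l, hw u l⟩⟩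
  have hh1 : u.1.1 ∈ H1 := h.1
  have hh2 : u.1.2 ∈ H1 := h.2
  have e1 : ∀ l : ℤ, l • k - k = (l - 1) • k := fun l => by rw [sub_smul, one_smul]
  have e2 : ∀ l : ℤ, l • k + k = (l + 1) • k := fun l => by rw [add_smul, one_smul]
  have hS' : ∀ l : ℤ, inner ℝ (perp (vec k)) (vec (l • k) + μ) = S := inner_perp_wv k μ
  have h1 : ∀ l, cb k l (restrictedOp N k μ ε ⟨u, h'⟩) = cb k l (restrictedOp N k μ 0 ⟨u, h⟩) +
      ε * cb k l ((c.comp T) u) := by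
    intro l
    rw [hb, cb_restrictedOp, cb_apply, restrictedOp_apply]
    simp only [linOpFun, coeff_sub, coeff_smul, coeff_mulCos, coeff_shiftedGrad hh1,
      coeff_shiftedD_invLap, coeff_shiftedPerpGrad_invLap, e1, e2, hS', cb_apply, cw_apply,
      transport, wv]
    push_cast
    ring
  have h2 : ∀ l, cw k l (restrictedOp N k μ ε ⟨u, h'⟩) = cw k l (restrictedOp N k μ 0 ⟨u, h⟩) +
      ε * cw k l ((c.comp T) u) := by
    intro l
    rw [hw, cw_restrictedOp, cw_apply, restrictedOp_apply]
    simp only [linOpFun, coeff_sub, coeff_smul, coeff_mulCos, coeff_shiftedGrad hh2,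
      coeff_shiftedD hh1,
      coeff_shiftedPerpGrad_invLap, e1, e2, hS', cb_apply, cw_apply, transport, wv, hκ]
    push_cast
    ring
  exact Hk_ext (fun l => by rw [h1, map_add, map_smul, smul_eq_mul])
    (fun l => by rw [h2, map_add, map_smul, smul_eq_mul])

/-- The coordinate `a^σ_l` along the eigenvector `f^σ_{lk}`. -/
def modeCoord (σ : ℝ) (l : ℤ) : Hk k →L[ℂ] ℂ :=
  ((1 / √2 / N : ℝ) : ℂ) • cb k l - ((1 / √2 * σ / ‖wv k μ l‖ : ℝ) : ℂ) • cw k l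

theorem modeCoord_apply (σ : ℝ) (l : ℤ) (u : Hk k) : modeCoord N k μ σ l u =
    ((1 / √2 / N : ℝ) : ℂ) * cb k l u - ((1 / √2 * σ / ‖wv k μ l‖ : ℝ) : ℂ) * cw k l u := rfl

variable {N k μ}

/-- The coordinate is a left eigenvector of the 2×2 block at l. Projections can therefore be
computed by testing against scalars, without expanding in eigenvectors. -/
theorem modeCoord_restrictedOp (hN : N ≠ 0) {l : ℤ} (hv : wv k μ l ≠ 0) {σ : ℝ} (hσ : σ ^ 2 = 1)
    (u : (restrictedOp N k μ 0).domain) : modeCoord N k μ σ l (restrictedOp N k μ 0 u) =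
      Complex.I * freqW N k μ σ l * modeCoord N k μ σ l u := by
  rw [modeCoord_apply, modeCoord_apply, cb_restrictedOp, cw_restrictedOp, freqW_eq, Omega]
  have hv' : (‖wv k μ l‖ : ℂ) ≠ 0 := Complex.ofReal_ne_zero.2 (norm_ne_zero_iff.2 hv)
  have hN' : (N : ℂ) ≠ 0 := Complex.ofReal_ne_zero.2 hN
  have hσ' : (σ : ℂ) ^ 2 = 1 := by exact_mod_cast hσ
  push_cast
  field_simp
  linear_combination ((N : ℂ) ^ 2 * (wv k μ l 0 : ℂ) * cw k l u) * hσ'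

theorem Hk_eq_zero_of_modeCoord (hN : N ≠ 0) (hv : ∀ l, wv k μ l ≠ 0) {u : Hk k}
    (h : ∀ l, modeCoord N k μ 1 l u = 0) (h' : ∀ l, modeCoord N k μ (-1) l u = 0) : u = 0 := by
  have h2 : ((√2 : ℝ) : ℂ) ≠ 0 := Complex.ofReal_ne_zero.2 (by positivity)
  have hN' : (N : ℂ) ≠ 0 := Complex.ofReal_ne_zero.2 hN
  refine Hk_ext (fun l => ?_) (fun l => ?_)
  · have e1 := h l
    have e2 := h' l
    rw [modeCoord_apply] at e1 e2
    push_cast at e1 e2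
    have e3 : (2 / (√2 : ℝ) / N : ℂ) * cb k l u = 0 := by linear_combination e1 + e2
    rw [map_zero]
    refine (mul_eq_zero.1 e3).resolve_left ?_
    exact div_ne_zero (div_ne_zero two_ne_zero h2) hN'
  · have e1 := h l
    have e2 := h' l
    rw [modeCoord_apply] at e1 e2
    push_cast at e1 e2
    have hv' : (‖wv k μ l‖ : ℂ) ≠ 0 := Complex.ofReal_ne_zero.2 (norm_ne_zero_iff.2 (hv l))
    have e3 : (2 / (√2 : ℝ) / ‖wv k μ l‖ : ℂ) * cw k l u = 0 := by linear_combination e2 - e1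
    rw [map_zero]
    refine (mul_eq_zero.1 e3).resolve_left ?_
    exact div_ne_zero (div_ne_zero two_ne_zero h2) hv'

theorem coeff_expBasis (p q : Freq) : coeff (expBasis p) q = if q = p then 1 else 0 := by
  rw [coeff, HilbertBasis.repr_self, lp.single_apply, Pi.single_apply]

theorem cb_eigvec (hk : k ≠ 0) (σ : ℝ) (l j : ℤ) :
    cb k j (eigvec N k μ σ l) = if j = l then ((1 / √2 * N : ℝ) : ℂ) else 0 := by
  rw [cb_apply, eigvec]
  simp only [coeff_smul, coeff_expBasis, (smul_injective hk).eq_iff]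
  simp

theorem cw_eigvec (hk : k ≠ 0) (σ : ℝ) (l j : ℤ) :
    cw k j (eigvec N k μ σ l) =
      if j = l then ((1 / √2 * (-σ * ‖wv k μ l‖) : ℝ) : ℂ) else 0 := by
  rw [cw_apply, eigvec]
  simp only [coeff_smul, coeff_expBasis, (smul_injective hk).eq_iff, wv]
  simp

theorem modeCoord_eigvec (hk : k ≠ 0) (hN : N ≠ 0) {l j : ℤ} (hv : wv k μ l ≠ 0) (σ τ : ℝ) :
    modeCoord N k μ τ j (eigvec N k μ σ l) = if j = l then ((1 + σ * τ) / 2 : ℂ) else 0 := by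
  rw [modeCoord_apply, cb_eigvec hk, cw_eigvec hk]
  split_ifs with h
  · subst h
    have hv' : (‖wv k μ j‖ : ℂ) ≠ 0 := Complex.ofReal_ne_zero.2 (norm_ne_zero_iff.2 hv)
    have h2 : ((√2 : ℝ) : ℂ) ≠ 0 := Complex.ofReal_ne_zero.2 (by positivity)
    have h2' : ((√2 : ℝ) : ℂ) ^ 2 = 2 := by
      rw [← Complex.ofReal_pow, Real.sq_sqrt (by norm_num)]; norm_num
    have hN' : (N : ℂ) ≠ 0 := Complex.ofReal_ne_zero.2 hN
    push_cast
    field_simp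
    rw [h2']
    ring
  · simp

theorem eigvec_mem_domain (σ : ℝ) (l : ℤ) (ε : ℝ) :
    eigvec N k μ σ l ∈ (restrictedOp N k μ ε).domain := by
  have h : expBasis (l • k) ∈ H1 := by
    change Memℓp (fun q => (1 + ‖vec q‖ : ℂ) * coeff (expBasis (l • k)) q) 2
    refine memlp_of_le (memlp_coeff (expBasis (l • k))) (1 + ‖vec (l • k)‖) fun q => ?_
    rw [coeff_expBasis]
    split_ifs with h
    · rw [h, mul_one, norm_one, mul_one]
      refine (norm_add_le _ _).trans ?_
      simp
    · simp
  exact ⟨H1.smul_mem _ h, H1.smul_mem _ h⟩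

theorem restrictedOp_eigvec (hk : k ≠ 0) {l : ℤ} (hv : wv k μ l ≠ 0) {σ : ℝ} (hσ : σ ^ 2 = 1) :
    restrictedOp N k μ 0 ⟨eigvec N k μ σ l, eigvec_mem_domain σ l 0⟩ =
      (Complex.I * freqW N k μ σ l) • eigvec N k μ σ l := by
  have hv' : (‖wv k μ l‖ : ℂ) ≠ 0 := Complex.ofReal_ne_zero.2 (norm_ne_zero_iff.2 hv)
  have hσ' : (σ : ℂ) ^ 2 = 1 := by exact_mod_cast hσ
  refine Hk_ext (fun j => ?_) (fun j => ?_)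
  · rw [cb_restrictedOp, map_smul, smul_eq_mul, cb_eigvec hk, cw_eigvec hk]
    split_ifs with h
    · subst h
      rw [freqW_eq, Omega]
      push_cast
      field_simp
      ring
    · ring
  · rw [cw_restrictedOp, map_smul, smul_eq_mul, cb_eigvec hk, cw_eigvec hk]
    split_ifs with h
    · subst h
      rw [freqW_eq, Omega]
      push_cast
      field_simp
      linear_combination (N * (wv k μ j 0 : ℂ)) * hσ'
    · ring

end Coordinates

/-! ### Growth of the frequencies and the resolvent of the unperturbed operator. -/

theorem exists_pos_forall_le {f : ℤ → ℝ} (hf : ∀ l, 0 < f l) {δ : ℝ} (hδ : 0 < δ)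
    (h : {l | f l < δ}.Finite) : ∃ c > 0, ∀ l, c ≤ f l := by
  rcases Set.eq_empty_or_nonempty {l | f l < δ} with he | hne
  · refine ⟨δ, hδ, fun l => not_lt.1 fun hl => ?_⟩
    have : l ∈ {l | f l < δ} := hl
    rw [he] at this
    exact this
  · obtain ⟨j, hj, hmin⟩ := Set.exists_min_image _ f h hne
    refine ⟨f j, hf j, fun l => ?_⟩
    by_cases hl : f l < δ
    · exact hmin l hl
    · exact (le_of_lt hj).trans (not_lt.1 hl)

theorem finite_abs_le (M : ℝ) : {l : ℤ | |(l : ℝ)| ≤ M}.Finite := by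
  refine (Set.finite_Icc (-⌈M⌉) ⌈M⌉).subset fun l hl => ?_
  have h1 : |(l : ℝ)| ≤ ⌈M⌉ := le_trans hl (Int.le_ceil _)
  have h2 : |l| ≤ ⌈M⌉ := by exact_mod_cast h1
  exact ⟨(abs_le.1 h2).1, (abs_le.1 h2).2⟩

theorem vec_ne_zero {k : Freq} (hk0 : 0 < k 0) : vec k ≠ 0 := by
  intro h
  have := congrArg (fun v : Plane => v 0) h
  simp only [vec_zero_apply, PiLp.zero_apply] at this
  rw [Int.cast_eq_zero] at this
  exact hk0.ne' this

theorem norm_vec_pos {k : Freq} (hk0 : 0 < k 0) : 0 < ‖vec k‖ := norm_pos_iff.2 (vec_ne_zero hk0)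

theorem Omega_vec_pos {N : ℝ} (hN : 0 < N) {k : Freq} (hk0 : 0 < k 0) : 0 < Omega N (vec k) := by
  have h : (0 : ℝ) < k 0 := by exact_mod_cast hk0
  exact div_pos (mul_pos hN h) (norm_vec_pos hk0)

theorem abs_apply_le_norm (v : Plane) (i : Fin 2) : |v i| ≤ ‖v‖ := by
  simpa using PiLp.norm_apply_le v i

theorem abs_Omega_le {N : ℝ} (hN : 0 < N) (v : Plane) : |Omega N v| ≤ N := by
  rw [Omega, abs_div, abs_mul, abs_of_pos hN, abs_norm]
  rcases eq_or_ne v 0 with rfl | hv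
  · simpa using hN.le
  · rw [div_le_iff₀ (norm_pos_iff.2 hv)]
    exact mul_le_mul_of_nonneg_left (abs_apply_le_norm v 0) hN.le

/-- The primary wave is stationary in the moving frame. Consequently the transport frequency is l
Ω(k) + c·μ, on which both the linear growth in l and the reading of resonance as a double eigenvalue
rest. -/
theorem waveSpeed_inner_vec (N : ℝ) {k : Freq} (hk0 : 0 < k 0) :
    inner ℝ (waveSpeed N k) (vec k) = Omega N (vec k) := by
  have := norm_vec_pos hk0
  rw [waveSpeed, real_inner_smul_left, real_inner_self_eq_norm_sq, Omega, vec_zero_apply]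
  field_simp

theorem transport_eq (N : ℝ) {k : Freq} (hk0 : 0 < k 0) (μ : Plane) (l : ℤ) :
    transport N k μ l = l * Omega N (vec k) + inner ℝ (waveSpeed N k) μ := by
  rw [transport, wv, vec_smul, inner_add_right, real_inner_smul_right, waveSpeed_inner_vec N hk0]

theorem le_abs_freqW {N : ℝ} (hN : 0 < N) {k : Freq} (hk0 : 0 < k 0) (μ : Plane) {σ : ℝ}
    (hσ : |σ| = 1) (l : ℤ) : |(l : ℝ)| * Omega N (vec k) -
      (|(inner ℝ (waveSpeed N k) μ : ℝ)| + N) ≤ |freqW N k μ σ l| := by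
  rw [freqW_eq, transport_eq N hk0]
  have h1 : |(l : ℝ) * Omega N (vec k)| = |(l : ℝ)| * Omega N (vec k) := by
    rw [abs_mul, abs_of_pos (Omega_vec_pos hN hk0)]
  have h2 : |σ * Omega N (wv k μ l)| ≤ N := by
    rw [abs_mul, hσ, one_mul]
    exact abs_Omega_le hN _
  rw [← h1]
  set a := (l : ℝ) * Omega N (vec k)
  set b : ℝ := inner ℝ (waveSpeed N k) μ
  set c := σ * Omega N (wv k μ l)
  have h3 : |a| ≤ |a + b + c| + |b| + |c| := by
    have : a = (a + b + c) - b - c := by ring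
    calc |a| = |(a + b + c) - b - c| := by rw [← this]
      _ ≤ |(a + b + c) - b| + |c| := abs_sub _ _
      _ ≤ _ := by linarith [abs_sub (a + b + c) b]
  linarith

/-- Linear growth settles all large |l|; for the finitely many others the ratio is positive since z
differs from each eigenvalue. -/
theorem exists_growth_lower_bound {N : ℝ} (hN : 0 < N) {k : Freq} (hk0 : 0 < k 0) {μ : Plane}
    {σ : ℝ} (hσ : |σ| = 1) {z : ℂ} (hz : ∀ l, z ≠ Complex.I * freqW N k μ σ l) :
    ∃ δ > 0, ∀ l : ℤ, δ * (1 + |(l : ℝ)|) ≤ ‖Complex.I * freqW N k μ σ l - z‖ := by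
  set κ := Omega N (vec k) with hκ
  have hκ0 : 0 < κ := Omega_vec_pos hN hk0
  set K : ℝ := |(inner ℝ (waveSpeed N k) μ : ℝ)| + N + ‖z‖ with hK
  obtain ⟨δ, hδ, h⟩ := exists_pos_forall_le
    (f := fun l : ℤ => ‖Complex.I * freqW N k μ σ l - z‖ / (1 + |(l : ℝ)|))
    (fun l => div_pos (norm_pos_iff.2 (sub_ne_zero.2 (hz l).symm)) (by positivity))
    -- A ratio below κ/2 forces |l|κ - K < (κ/2)(1 + |l|), hence |l| ≤ (2K + κ)/κ.
    (half_pos hκ0) ((finite_abs_le ((2 * K + κ) / κ)).subset fun l hl => by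
      have hl' : ‖Complex.I * freqW N k μ σ l - z‖ / (1 + |(l : ℝ)|) < κ / 2 := hl
      rw [div_lt_iff₀ (by positivity)] at hl'
      have h1 := le_abs_freqW hN hk0 μ hσ l
      have h2 : |freqW N k μ σ l| - ‖z‖ ≤ ‖Complex.I * freqW N k μ σ l - z‖ := by
        have := norm_sub_norm_le (Complex.I * freqW N k μ σ l : ℂ) z
        rwa [norm_mul, Complex.norm_I, one_mul, Complex.norm_real, Real.norm_eq_abs] at this
      change |(l : ℝ)| ≤ _
      rw [le_div_iff₀ hκ0]
      linarith)
  exact ⟨δ, hδ, fun l => (le_div_iff₀ (by positivity)).1 (h l)⟩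

/-- With p and m the two eigenvalues of the l-th block shifted by z, that block minus z has diagonal
(p + m)/2 and determinant pm. Both |p| and |m| are at least δ(1 + |l|) while the off-diagonal
entries are O(1 + |l|), so the inverse block is O(1/(1 + |l|)): it is bounded and gains one
derivative, which puts its range in H¹. -/
theorem mem_resolventSetOf {N : ℝ} (hN : 0 < N) {k : Freq} (hk0 : 0 < k 0) {μ : Plane}
    {z : ℂ} (hz : ∀ l, z ≠ Complex.I * freqW N k μ 1 l)
    (hz' : ∀ l, z ≠ Complex.I * freqW N k μ (-1) l) :
    z ∈ resolventSetOf (restrictedOp N k μ 0) := by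
  have hk : k ≠ 0 := by rintro rfl; exact lt_irrefl _ hk0
  obtain ⟨δ₁, hδ₁, h₁⟩ := exists_growth_lower_bound hN hk0 (by norm_num) hz
  obtain ⟨δ₂, hδ₂, h₂⟩ := exists_growth_lower_bound hN hk0 (by norm_num) hz'
  obtain ⟨C, hC⟩ := exists_bound_invLap μ
  set δ := min δ₁ δ₂
  have hδ : 0 < δ := lt_min hδ₁ hδ₂
  set p : ℤ → ℂ := fun l => Complex.I * freqW N k μ 1 l - z with hp
  set m : ℤ → ℂ := fun l => Complex.I * freqW N k μ (-1) l - z with hm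
  have hp0 : ∀ l, p l ≠ 0 := fun l => sub_ne_zero.2 (hz l).symm
  have hm0 : ∀ l, m l ≠ 0 := fun l => sub_ne_zero.2 (hz' l).symm
  set ℓ : ℤ → ℝ := fun l => 1 + |(l : ℝ)| with hℓ
  have hℓ0 : ∀ l, 0 < ℓ l := fun l => by positivity
  have hpl : ∀ l, δ * ℓ l ≤ ‖p l‖ := fun l =>
    (mul_le_mul_of_nonneg_right (min_le_left _ _) (hℓ0 l).le).trans (h₁ l)
  have hml : ∀ l, δ * ℓ l ≤ ‖m l‖ := fun l =>
    (mul_le_mul_of_nonneg_right (min_le_right _ _) (hℓ0 l).le).trans (h₂ l)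
  set t : ℤ → ℝ := fun l => N ^ 2 * (wv k μ l) 0 * (‖wv k μ l‖ ^ 2)⁻¹ with ht
  set v : ℤ → ℝ := fun l => (wv k μ l) 0 with hv
  have hs : ∀ l, Complex.I * transport N k μ l - z = (p l + m l) / 2 := fun l => by
    simp only [hp, hm, freqW_eq]
    push_cast
    ring
  -- This is the determinant identity: (p + m)²/4 + tv = pm.
  have htv : ∀ l, (t l : ℂ) * v l = -((p l - m l) / 2) ^ 2 := fun l => by
    have e1 : (p l - m l) / 2 = Complex.I * Omega N (wv k μ l) := by
      simp only [hp, hm, freqW_eq]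
      push_cast
      ring
    rw [e1, mul_pow, Complex.I_sq]
    simp only [ht, hv, Omega]
    push_cast
    rw [div_pow]
    ring
  set e : Fin 2 → Fin 2 → ℤ → ℂ := fun i j l =>
    if i = j then ((p l)⁻¹ + (m l)⁻¹) / 2
    else if i = 0 then Complex.I * t l / (p l * m l) else Complex.I * v l / (p l * m l) with he
  set W : ℤ → ℝ := fun l => 1 + ‖vec (l • k)‖ with hW
  set Kv := ‖vec k‖ + ‖μ‖ with hKv
  set Kw := 1 + ‖vec k‖ with hKw
  have hC0 : 0 ≤ C := (by positivity : 0 ≤ (‖vec 0 + μ‖ ^ 2)⁻¹).trans (hC 0)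
  have hnl : ∀ l : ℤ, ‖vec (l • k)‖ = |(l : ℝ)| * ‖vec k‖ := fun l => by
    rw [vec_smul, norm_smul, Real.norm_eq_abs]
  have hWl : ∀ l, W l ≤ Kw * ℓ l := fun l => by
    simp only [hW, hKw, hℓ, hnl]
    nlinarith [norm_nonneg (vec k), abs_nonneg (l : ℝ)]
  have hvl : ∀ l, |v l| ≤ Kv * ℓ l := fun l => by
    refine (abs_apply_le_norm _ 0).trans ((norm_add_le _ _).trans ?_)
    simp only [hKv, hℓ, hnl]
    nlinarith [norm_nonneg (vec k), abs_nonneg (l : ℝ), norm_nonneg μ,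
      mul_nonneg (abs_nonneg (l : ℝ)) (norm_nonneg μ)]
  have htl : ∀ l, |t l| ≤ N ^ 2 * C * (Kv * ℓ l) := fun l => by
    have h1 : |t l| = N ^ 2 * (‖wv k μ l‖ ^ 2)⁻¹ * |v l| := by
      simp only [ht, hv]
      rw [abs_mul, abs_mul, abs_of_nonneg (sq_nonneg N),
        abs_of_nonneg (by positivity : 0 ≤ (‖wv k μ l‖ ^ 2)⁻¹)]
      ring
    rw [h1]
    have h2 := hC (l • k)
    have h3 := hvl l
    change (‖wv k μ l‖ ^ 2)⁻¹ ≤ C at h2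
    gcongr
  have hinv : ∀ (l : ℤ) (x : ℂ), δ * ℓ l ≤ ‖x‖ → ‖x⁻¹‖ ≤ (δ * ℓ l)⁻¹ := fun l x hx => by
    rw [norm_inv]
    exact inv_anti₀ (mul_pos hδ (hℓ0 l)) hx
  have hdiag : ∀ l, ‖((p l)⁻¹ + (m l)⁻¹) / 2‖ ≤ (δ * ℓ l)⁻¹ := fun l => by
    rw [norm_div, Complex.norm_ofNat]
    linarith [norm_add_le (p l)⁻¹ (m l)⁻¹, hinv l _ (hpl l), hinv l _ (hml l)]
  have hoff : ∀ (l : ℤ) (x D : ℝ), |x| ≤ D * (Kv * ℓ l) →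
      ‖Complex.I * x / (p l * m l)‖ ≤ D * Kv * ℓ l * ((δ * ℓ l)⁻¹ * (δ * ℓ l)⁻¹) := by
    intro l x D hx
    rw [div_eq_mul_inv, mul_inv, norm_mul, norm_mul, norm_mul, Complex.norm_I, one_mul,
      Complex.norm_real, Real.norm_eq_abs]
    have h1 := hinv l _ (hpl l)
    have h2 := hinv l _ (hml l)
    rw [mul_assoc D]
    have := (abs_nonneg x).trans hx
    gcongr
  set M := Kw * (δ⁻¹ + (N ^ 2 * C + 1) * Kv * (δ⁻¹ * δ⁻¹)) with hM
  have hWe : ∀ i j l, W l * ‖e i j l‖ ≤ M := by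
    intro i j l
    have hl := hℓ0 l
    have hKv0 : 0 ≤ Kv := by positivity
    have hKw0 : 0 ≤ Kw := by positivity
    have b1 : Kw * ℓ l * (δ * ℓ l)⁻¹ = Kw * δ⁻¹ := by field_simp
    have b2 : ∀ D, Kw * ℓ l * (D * Kv * ℓ l * ((δ * ℓ l)⁻¹ * (δ * ℓ l)⁻¹)) =
        Kw * (D * Kv * (δ⁻¹ * δ⁻¹)) := fun D => by field_simp
    have q1 : 0 ≤ Kw * δ⁻¹ := by positivity
    have q2 : 0 ≤ Kw * (N ^ 2 * C * Kv * (δ⁻¹ * δ⁻¹)) := by positivity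
    have q3 : 0 ≤ Kw * (1 * Kv * (δ⁻¹ * δ⁻¹)) := by positivity
    have hMe : M = Kw * δ⁻¹ + Kw * (N ^ 2 * C * Kv * (δ⁻¹ * δ⁻¹)) +
        Kw * (1 * Kv * (δ⁻¹ * δ⁻¹)) := by rw [hM]; ring
    simp only [he]
    split_ifs
    · refine (mul_le_mul (hWl l) (hdiag l) (norm_nonneg _) (by positivity)).trans ?_
      rw [b1]; linarith
    · refine (mul_le_mul (hWl l) (hoff l _ _ (htl l)) (norm_nonneg _) (by positivity)).trans ?_
      rw [b2]; linarith
    · refine (mul_le_mul (hWl l) (hoff l _ 1 (by rw [one_mul]; exact hvl l)) (norm_nonneg _)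
        (by positivity)).trans ?_
      rw [b2]; linarith
  have hW1 : ∀ l, 1 ≤ W l := fun l => by simp [hW]
  obtain ⟨T, hT⟩ := exists_blockOp hk (m := e) (C := M) fun i j l =>
    (le_mul_of_one_le_left (norm_nonneg _) (hW1 l)).trans (hWe i j l)
  -- `T'` is `T` weighted by 1 + |lk|. Its boundedness on L² is exactly the statement that `T` takes
  -- values in H¹.
  obtain ⟨T', hT'⟩ := exists_blockOp hk (m := fun i j l => (W l : ℂ) * e i j l) (C := M)
    fun i j l => by
      rw [norm_mul, Complex.norm_real, Real.norm_of_nonneg (by linarith [hW1 l])]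
      exact hWe i j l
  have hdom : ∀ g, T g ∈ (restrictedOp N k μ 0).domain := by
    intro g
    have key1 : ∀ q, (1 + ‖vec q‖ : ℂ) * coeff (T g).1.1 q = coeff (T' g).1.1 q := by
      intro q
      by_cases hq : ∃ l : ℤ, q = l • k
      · obtain ⟨l, rfl⟩ := hq
        rw [← cb_apply, ← cb_apply, (hT g l).1, (hT' g l).1, hW]
        push_cast
        ring
      · rw [((T g).2 q (not_exists.1 hq)).1, ((T' g).2 q (not_exists.1 hq)).1, mul_zero]
    have key2 : ∀ q, (1 + ‖vec q‖ : ℂ) * coeff (T g).1.2 q = coeff (T' g).1.2 q := by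
      intro q
      by_cases hq : ∃ l : ℤ, q = l • k
      · obtain ⟨l, rfl⟩ := hq
        rw [← cw_apply, ← cw_apply, (hT g l).2, (hT' g l).2, hW]
        push_cast
        ring
      · rw [((T g).2 q (not_exists.1 hq)).2, ((T' g).2 q (not_exists.1 hq)).2, mul_zero]
    constructor
    · change Memℓp (fun q => (1 + ‖vec q‖ : ℂ) * coeff (T g).1.1 q) 2
      simp only [key1]
      exact memlp_coeff _
    · change Memℓp (fun q => (1 + ‖vec q‖ : ℂ) * coeff (T g).1.2 q) 2
      simp only [key2]
      exact memlp_coeff _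
  have h01 : (0 : Fin 2) ≠ 1 := by decide
  have h10 : (1 : Fin 2) ≠ 0 := by decide
  simp only [he, if_true, if_neg h01, if_neg h10] at hT
  refine ⟨T, fun g => ⟨hdom g, ?_⟩, fun f => ?_⟩
  · refine Hk_ext (fun l => ?_) (fun l => ?_)
    · rw [map_sub, map_smul, smul_eq_mul, cb_restrictedOp, (hT g l).1, (hT g l).2]
      have h1 := hs l
      have h2 := htv l
      have h3 := hp0 l
      have h4 := hm0 l
      have h5 : Complex.I * transport N k μ l = (p l + m l) / 2 + z := by rw [← h1]; ring
      rw [h5]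
      change _ - Complex.I * (t l : ℂ) * _ - _ = _
      field_simp
      linear_combination (cb k l g) * 4 * h2 - (cb k l g) * 4 * (t l : ℂ) * v l * Complex.I_sq
    · rw [map_sub, map_smul, smul_eq_mul, cw_restrictedOp, (hT g l).1, (hT g l).2]
      have h1 := hs l
      have h2 := htv l
      have h3 := hp0 l
      have h4 := hm0 l
      have h5 : Complex.I * transport N k μ l = (p l + m l) / 2 + z := by rw [← h1]; ring
      rw [h5]
      change _ - Complex.I * (v l : ℂ) * _ - _ = _
      field_simp
      linear_combination (cw k l g) * 4 * h2 - (cw k l g) * 4 * (t l : ℂ) * v l * Complex.I_sq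
  · refine Hk_ext (fun l => ?_) (fun l => ?_)
    · rw [(hT _ l).1, map_sub, map_sub, map_smul, map_smul, smul_eq_mul, smul_eq_mul,
        cb_restrictedOp, cw_restrictedOp]
      have h1 := hs l
      have h2 := htv l
      have h3 := hp0 l
      have h4 := hm0 l
      have h5 : Complex.I * transport N k μ l = (p l + m l) / 2 + z := by rw [← h1]; ring
      rw [h5]
      change _ * (_ - Complex.I * (t l : ℂ) * _ - _) + _ * (_ - Complex.I * (v l : ℂ) * _ - _) = _
      field_simp
      linear_combination (cb k l (f : Hk k)) * 4 * h2 -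
        (cb k l (f : Hk k)) * 4 * (t l : ℂ) * v l * Complex.I_sq
    · rw [(hT _ l).2, map_sub, map_sub, map_smul, map_smul, smul_eq_mul, smul_eq_mul,
        cb_restrictedOp, cw_restrictedOp]
      have h1 := hs l
      have h2 := htv l
      have h3 := hp0 l
      have h4 := hm0 l
      have h5 : Complex.I * transport N k μ l = (p l + m l) / 2 + z := by rw [← h1]; ring
      rw [h5]
      change _ * (_ - Complex.I * (t l : ℂ) * _ - _) + _ * (_ - Complex.I * (v l : ℂ) * _ - _) = _
      field_simp
      linear_combination (cw k l (f : Hk k)) * 4 * h2 -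
        (cw k l (f : Hk k)) * 4 * (t l : ℂ) * v l * Complex.I_sq

/-! ### Eigenvalues from a matrix, and left eigenfunctionals under the Riesz projection. -/

section Abstract

variable {E : Type*} [NormedAddCommGroup E] [NormedSpace ℂ E]

theorem eigenvaluesOn_eq_roots {A : E →ₗ.[ℂ] E} {V : Submodule ℂ E} {e : Fin 2 → E}
    {M : Matrix (Fin 2) (Fin 2) ℂ} (h : IsRepresentedBy A V e M) :
    eigenvaluesOn A V = {z | M.charpoly.IsRoot z} := by
  obtain ⟨hli, hspan, hdom, hA⟩ := h
  choose hd hAe using hA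
  have hcomb : ∀ (x : Fin 2 → ℂ) (hx : ∑ j, x j • e j ∈ A.domain),
      A ⟨∑ j, x j • e j, hx⟩ = ∑ i, M.mulVec x i • e i := by
    intro x hx
    have h1 : (⟨∑ j, x j • e j, hx⟩ : A.domain) = x 0 • ⟨e 0, hd 0⟩ + x 1 • ⟨e 1, hd 1⟩ :=
      Subtype.ext (by simp [Fin.sum_univ_two])
    rw [h1, A.map_add, A.map_smul, A.map_smul, hAe, hAe]
    simp only [Fin.sum_univ_two, Matrix.mulVec, dotProduct]
    module
  ext z
  have hroot : M.charpoly.IsRoot z ↔ ∃ x : Fin 2 → ℂ, x ≠ 0 ∧ M.mulVec x = z • x := by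
    rw [Polynomial.IsRoot, Matrix.eval_charpoly, ← Matrix.exists_mulVec_eq_zero_iff]
    refine exists_congr fun x => and_congr_right fun _ => ?_
    rw [Matrix.sub_mulVec, sub_eq_zero, eq_comm, Matrix.scalar_apply,
      ← Matrix.smul_one_eq_diagonal, Matrix.smul_mulVec, Matrix.one_mulVec]
  rw [Set.mem_ofPred_eq, hroot]
  constructor
  · rintro ⟨v, hv, hv0, hAv⟩
    rw [← hspan] at hv
    obtain ⟨x, hx⟩ := (Submodule.mem_span_range_iff_exists_fun ℂ).1 hv
    refine ⟨x, ?_, ?_⟩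
    · rintro rfl
      refine hv0 (Subtype.ext ?_)
      rw [← hx]
      simp
    · have h1 := hcomb x (by rw [hx]; exact v.2)
      have h2 : (⟨∑ j, x j • e j, by rw [hx]; exact v.2⟩ : A.domain) = v := Subtype.ext hx
      rw [h2, hAv, ← hx, Finset.smul_sum] at h1
      rw [Fintype.linearIndependent_iff] at hli
      have h3 := hli (M.mulVec x - z • x) (by
        simp only [Pi.sub_apply, sub_smul, Finset.sum_sub_distrib, ← h1, Pi.smul_apply,
          smul_eq_mul, mul_smul, sub_self])
      exact sub_eq_zero.1 (funext h3)
  · rintro ⟨x, hx0, hx⟩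
    have hmem : ∑ j, x j • e j ∈ V := by
      rw [← hspan]
      exact (Submodule.mem_span_range_iff_exists_fun ℂ).2 ⟨x, rfl⟩
    refine ⟨⟨∑ j, x j • e j, hdom hmem⟩, hmem, fun h0 => hx0 ?_, ?_⟩
    · rw [Fintype.linearIndependent_iff] at hli
      exact funext (hli x (congrArg Subtype.val h0))
    · rw [hcomb, hx, Finset.smul_sum]
      simp only [Pi.smul_apply, smul_eq_mul, mul_smul]

variable [CompleteSpace E]

/-- A left eigenfunctional satisfies a(R(z)g) = -(z - w)⁻¹ a(g), so the operator integral reduces to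
the winding number of the circle about w: one at the centre, zero outside the disc. -/
theorem leftEigen_rieszProj {A : E →ₗ.[ℂ] E} {a : E →L[ℂ] ℂ} {w c : ℂ} {ρ : ℝ} (hρ : 0 ≤ ρ)
    (ha : ∀ u : A.domain, a (A u) = w * a u) (hs : Metric.sphere c ρ ⊆ resolventSetOf A)
    (hw : w ∉ Metric.sphere c ρ) (g : E) : a (rieszProj A c ρ g) =
      ((2 * Real.pi * Complex.I : ℂ)⁻¹ * ∮ z in C(c, ρ), (z - w)⁻¹) * a g := by
  have hm : ∀ θ, circleMap c ρ θ ∈ Metric.sphere c ρ := circleMap_mem_sphere c hρ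
  have hi := ((continuousOn_resolventOf.mono hs).circleIntegrable hρ).out
  have h1 := (a.comp (ContinuousLinearMap.apply ℂ E g)).intervalIntegral_comp_comm hi
  have h2 : ∀ z ∈ Metric.sphere c ρ, a (resolventOf A z g) = -((z - w)⁻¹ * a g) := by
    intro z hz
    obtain ⟨h, e⟩ := (isResolventAt_resolventOf (hs hz)).apply_eq g
    have h3 := ha ⟨_, h⟩
    rw [e, map_add, map_smul, smul_eq_mul] at h3
    have h4 : z - w ≠ 0 := sub_ne_zero.2 fun e => hw (e ▸ hz)
    field_simp
    linear_combination h3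
  rw [rieszProj, neg_apply, smul_apply, map_neg, map_smul, circleIntegral]
  simp only [ContinuousLinearMap.comp_apply, ContinuousLinearMap.apply_apply,
    map_smul] at h1
  rw [← h1]
  simp only [h2 _ (hm _), smul_neg, intervalIntegral.integral_neg]
  rw [neg_neg, circleIntegral]
  simp only [smul_eq_mul, ← mul_assoc]
  rw [intervalIntegral.integral_mul_const]
  ring

theorem leftEigen_rieszProj_of_center {A : E →ₗ.[ℂ] E} {a : E →L[ℂ] ℂ} {c : ℂ} {ρ : ℝ}
    (hρ : 0 < ρ) (ha : ∀ u : A.domain, a (A u) = c * a u)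
    (hs : Metric.sphere c ρ ⊆ resolventSetOf A) (g : E) : a (rieszProj A c ρ g) = a g := by
  rw [leftEigen_rieszProj hρ.le ha hs (by simp [hρ.ne]), circleIntegral.integral_sub_center_inv _
    hρ.ne', inv_mul_cancel₀ Complex.two_pi_I_ne_zero, one_mul]

theorem leftEigen_rieszProj_of_outside {A : E →ₗ.[ℂ] E} {a : E →L[ℂ] ℂ} {c w : ℂ} {ρ : ℝ}
    (hρ : 0 < ρ) (ha : ∀ u : A.domain, a (A u) = w * a u)
    (hs : Metric.sphere c ρ ⊆ resolventSetOf A) (hw : w ∉ Metric.closedBall c ρ) (g : E) :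
    a (rieszProj A c ρ g) = 0 := by
  have hne : ∀ z ∈ Metric.closedBall c ρ, z - w ≠ 0 := fun z hz =>
    sub_ne_zero.2 fun e => hw (e ▸ hz)
  have hc : ContinuousOn (fun z => (z - w)⁻¹) (Metric.closedBall c ρ) :=
    (continuousOn_id.sub continuousOn_const).inv₀ hne
  rw [leftEigen_rieszProj hρ.le ha hs fun h => hw (Metric.sphere_subset_closedBall h),
    Complex.circleIntegral_eq_zero_of_differentiable_on_off_countable hρ.le Set.countable_empty hc,
    mul_zero, zero_mul]
  intro z hz
  exact DifferentiableAt.inv (by fun_prop) (hne z (Metric.ball_subset_closedBall hz.1))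

end Abstract

/-! ### Consequences of the resonance relation. -/

section Resonance

variable {N : ℝ} {k : Freq} {μ : Plane}

theorem wv_zero (k : Freq) (μ : Plane) : wv k μ 0 = μ := by
  rw [wv, vec_smul, Int.cast_zero, zero_smul, zero_add]

theorem wv_one (k : Freq) (μ : Plane) : wv k μ 1 = vec k + μ := by
  rw [wv, one_smul]

theorem Omega_smul_of_pos (N : ℝ) {a : ℝ} (ha : 0 < a) (v : Plane) :
    Omega N (a • v) = Omega N v := by
  rw [Omega, Omega, norm_smul, Real.norm_of_nonneg ha.le, PiLp.smul_apply, smul_eq_mul,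
    mul_left_comm, mul_div_mul_left _ _ ha.ne']

theorem Omega_neg (N : ℝ) (v : Plane) : Omega N (-v) = -Omega N v := by
  rw [Omega, Omega, norm_neg, PiLp.neg_apply]
  ring

theorem Omega_smul_of_neg (N : ℝ) {a : ℝ} (ha : a < 0) (v : Plane) :
    Omega N (a • v) = -Omega N v := by
  rw [← neg_neg a, neg_smul, Omega_neg, Omega_smul_of_pos N (neg_pos.2 ha)]

theorem Omega_zero (N : ℝ) : Omega N 0 = 0 := by simp [Omega]

theorem resonance_eq (hμ : μ ∈ resonantSet N k) :
    Omega N (vec k) - Omega N (vec k + μ) = Omega N μ := by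
  rcases hμ with rfl | h
  · rw [add_zero, sub_self, Omega_zero]
  · exact h.2

/-- Here w⁻_1 = Ω(k) + c·μ - Ω(k + μ) and w⁺_0 = c·μ + Ω(μ), so the resonance relation is precisely
their coincidence. -/
theorem freqW_zero_eq (hk0 : 0 < k 0) (hμ : μ ∈ resonantSet N k) :
    freqW N k μ (-1) 1 = freqW N k μ 1 0 := by
  have := resonance_eq hμ
  rw [freqW_eq, freqW_eq, transport_eq N hk0, transport_eq N hk0, wv_zero, wv_one]
  push_cast
  linarith

/-- At μ = 0 both w⁻_0 and w⁻_1 vanish, so the required gap fails at l = 0. -/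
theorem zero_mem_exceptionalSet (hk0 : 0 < k 0) : (0 : Plane) ∈ exceptionalSet N k := by
  refine ⟨Or.inl rfl, ?_⟩
  rintro ⟨α, hα, -, h⟩
  have := h 0 (by norm_num)
  rw [freqW_eq, freqW_eq, transport_eq N hk0, transport_eq N hk0, wv_zero, wv_one, add_zero,
    Omega_zero] at this
  norm_num at this
  linarith

/-- If μ = -lk, homogeneity of Ω turns resonance into sgn(-l) + sgn(1 - l) = 1, which holds only for
l = 0, that is for μ = 0. Thus the zero-symbol convention never intervenes at the points considered.
-/
theorem wv_ne_zero (hN : 0 < N) (hk0 : 0 < k 0) (hμ : μ ∈ resonantSet N k) (hμ0 : μ ≠ 0)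
    (l : ℤ) : wv k μ l ≠ 0 := by
  intro h
  have hκ := Omega_vec_pos hN hk0
  have e : μ = (-l : ℝ) • vec k := by
    rw [wv, vec_smul] at h
    rw [neg_smul]
    exact (neg_eq_of_add_eq_zero_right h).symm
  have e' : vec k + μ = (1 - l : ℝ) • vec k := by rw [e]; module
  have hr := resonance_eq hμ
  rw [e', e] at hr
  rcases lt_trichotomy l 0 with hl | hl | hl
  · have h1 : (l : ℝ) < 0 := by exact_mod_cast hl
    rw [Omega_smul_of_pos N (by linarith), Omega_smul_of_pos N (by linarith)] at hr
    linarith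
  · subst hl
    exact hμ0 (by simpa using e)
  · have h1 : (1 : ℝ) ≤ l := by exact_mod_cast hl
    rw [Omega_smul_of_neg N (by linarith : (-l : ℝ) < 0)] at hr
    rcases h1.eq_or_lt with h2 | h2
    · rw [← h2, sub_self, zero_smul, Omega_zero] at hr
      linarith
    · rw [Omega_smul_of_neg N (by linarith)] at hr
      linarith

end Resonance

/-! ### Isolation of λ⁺ and the unperturbed spectral projection. -/

section Separation

variable {N : ℝ} {k : Freq} {μ : Plane}

theorem freqW_mem_spectrumOf (hN : 0 < N) (hk0 : 0 < k 0) (hv : ∀ l, wv k μ l ≠ 0) {σ : ℝ}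
    (hσ : σ ^ 2 = 1) (l : ℤ) :
    (Complex.I * freqW N k μ σ l : ℂ) ∈ spectrumOf (restrictedOp N k μ 0) := by
  rintro ⟨R, hR⟩
  have hk : k ≠ 0 := by rintro rfl; exact lt_irrefl _ hk0
  have h := hR.not_eigenvalue _ (restrictedOp_eigvec hk (hv l) hσ)
  have h2 := cb_eigvec (N := N) (μ := μ) hk σ l l
  simp only at h
  rw [h, map_zero, if_pos rfl, eq_comm, Complex.ofReal_eq_zero] at h2
  have : 0 < 1 / √2 * N := by positivity
  exact this.ne' h2

theorem dist_freqW (σ τ : ℝ) (l j : ℤ) :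
    dist (Complex.I * freqW N k μ σ l) (Complex.I * freqW N k μ τ j) =
      |freqW N k μ σ l - freqW N k μ τ j| := by
  rw [dist_eq_norm, ← mul_sub, norm_mul, Complex.norm_I, one_mul, ← Complex.ofReal_sub,
    Complex.norm_real, Real.norm_eq_abs]

theorem exists_isSeparating (hN : 0 < N) (hk0 : 0 < k 0)
    (hμ : μ ∈ resonantSet N k \ exceptionalSet N k) : ∃ ρ, IsSeparating N k μ ρ := by
  have hμ0 : μ ≠ 0 := by
    rintro rfl
    exact hμ.2 (zero_mem_exceptionalSet hk0)
  have hv := wv_ne_zero hN hk0 hμ.1 hμ0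
  have hsep : ∃ α > 0, (∀ l : ℤ, l ≠ 0 → α ≤ |freqW N k μ 1 l - freqW N k μ 1 0|) ∧
      (∀ l : ℤ, l ≠ 1 → α ≤ |freqW N k μ (-1) l - freqW N k μ (-1) 1|) := by
    by_contra h
    exact hμ.2 ⟨hμ.1, h⟩
  obtain ⟨α, hα, h1, h2⟩ := hsep
  -- Every other eigenvalue is at distance at least α, so a closed disc of radius α/2 excludes it.
  refine ⟨α / 2, half_pos hα, Set.eq_singleton_iff_unique_mem.2
    ⟨⟨freqW_mem_spectrumOf hN hk0 hv (by norm_num) 0,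
      Metric.mem_closedBall_self (half_pos hα).le⟩, ?_⟩⟩
  rintro z ⟨hz, hzb⟩
  by_contra hne
  refine hz (mem_resolventSetOf hN hk0 (fun l e => ?_) (fun l e => ?_))
  · rw [e, lambdaPlus, Metric.mem_closedBall, dist_freqW] at hzb
    rcases eq_or_ne l 0 with rfl | hl
    · exact hne e
    · linarith [h1 l hl]
  · rw [e, lambdaPlus, ← freqW_zero_eq hk0 hμ.1, Metric.mem_closedBall, dist_freqW] at hzb
    rcases eq_or_ne l 1 with rfl | hl
    · rw [lambdaPlus, ← freqW_zero_eq hk0 hμ.1] at hne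
      exact hne e
    · linarith [h2 l hl]

theorem annulus_subset_resolventSetOf {ρ r : ℝ} (hρ : IsSeparating N k μ ρ) (hr : 0 < r) :
    Metric.closedBall (lambdaPlus N k μ) ρ \ Metric.ball (lambdaPlus N k μ) r ⊆
      resolventSetOf (restrictedOp N k μ 0) := by
  rintro z ⟨hz, hz'⟩
  by_contra h
  have : z ∈ ({lambdaPlus N k μ} : Set ℂ) := hρ.2 ▸ ⟨h, hz⟩
  rw [Set.mem_singleton_iff] at this
  subst this
  exact hz' (Metric.mem_ball_self hr)

/-- The coordinates dual to `f⁻_k`, `f⁺_0`. -/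
def dualCoord (N : ℝ) (k : Freq) (μ : Plane) : Fin 2 → Hk k →L[ℂ] ℂ :=
  ![modeCoord N k μ (-1) 1, modeCoord N k μ 1 0]

def unperturbedBasis (N : ℝ) (k : Freq) (μ : Plane) : Fin 2 → Hk k :=
  ![eigvec N k μ (-1) 1, eigvec N k μ 1 0]

theorem dualCoord_unperturbedBasis (hN : 0 < N) (hk : k ≠ 0) (hv : ∀ l, wv k μ l ≠ 0)
    (i j : Fin 2) : dualCoord N k μ i (unperturbedBasis N k μ j) = if i = j then 1 else 0 := by
  fin_cases i <;> fin_cases j <;>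
    simp [dualCoord, unperturbedBasis, modeCoord_eigvec hk hN.ne' (hv _)]

/-- The mode coordinates jointly separate points, so it suffices to compare them: the two belonging
to λ⁺ are kept by the projection and all the others are killed. -/
theorem rieszProj_zero (hN : 0 < N) (hk0 : 0 < k 0)
    (hμ : μ ∈ resonantSet N k \ exceptionalSet N k) {ρ : ℝ} (hρ : IsSeparating N k μ ρ)
    (g : Hk k) : rieszProj (restrictedOp N k μ 0) (lambdaPlus N k μ) ρ g =
      ∑ i, dualCoord N k μ i g • unperturbedBasis N k μ i := by
  have hμ0 : μ ≠ 0 := by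
    rintro rfl
    exact hμ.2 (zero_mem_exceptionalSet hk0)
  have hk : k ≠ 0 := by rintro rfl; exact lt_irrefl _ hk0
  have hv := wv_ne_zero hN hk0 hμ.1 hμ0
  have hsep : ∃ α > 0, (∀ l : ℤ, l ≠ 0 → α ≤ |freqW N k μ 1 l - freqW N k μ 1 0|) ∧
      (∀ l : ℤ, l ≠ 1 → α ≤ |freqW N k μ (-1) l - freqW N k μ (-1) 1|) := by
    by_contra h
    exact hμ.2 ⟨hμ.1, h⟩
  obtain ⟨α, hα, h1, h2⟩ := hsep
  have hss : Metric.sphere (lambdaPlus N k μ) ρ ⊆ resolventSetOf (restrictedOp N k μ 0) :=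
    (sphere_subset_annulus le_rfl le_rfl).trans (annulus_subset_resolventSetOf hρ hρ.1)
  have hin : ∀ (σ : ℝ) (l : ℤ), σ ^ 2 = 1 →
      (Complex.I * freqW N k μ σ l : ℂ) = lambdaPlus N k μ →
      modeCoord N k μ σ l (rieszProj (restrictedOp N k μ 0) (lambdaPlus N k μ) ρ g) =
        modeCoord N k μ σ l g := fun σ l hσ hl =>
    leftEigen_rieszProj_of_center hρ.1
      (fun u => by rw [modeCoord_restrictedOp hN.ne' (hv l) hσ, hl]) hss g
  have hout : ∀ (σ : ℝ) (l : ℤ), σ ^ 2 = 1 →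
      (Complex.I * freqW N k μ σ l : ℂ) ≠ lambdaPlus N k μ →
      modeCoord N k μ σ l (rieszProj (restrictedOp N k μ 0) (lambdaPlus N k μ) ρ g) = 0 := by
    intro σ l hσ hl
    refine leftEigen_rieszProj_of_outside hρ.1
      (fun u => modeCoord_restrictedOp hN.ne' (hv l) hσ u) hss (fun h => hl ?_) g
    have : (Complex.I * freqW N k μ σ l : ℂ) ∈ ({lambdaPlus N k μ} : Set ℂ) :=
      hρ.2 ▸ ⟨freqW_mem_spectrumOf hN hk0 hv hσ l, h⟩
    exact this
  have hne : ∀ (σ τ : ℝ) (l j : ℤ), α ≤ |freqW N k μ σ l - freqW N k μ τ j| →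
      (Complex.I * freqW N k μ σ l : ℂ) ≠ Complex.I * freqW N k μ τ j := by
    intro σ τ l j h e
    rw [← dist_freqW, e, dist_self] at h
    linarith
  have hlam : lambdaPlus N k μ = Complex.I * freqW N k μ (-1) 1 := by
    rw [lambdaPlus, freqW_zero_eq hk0 hμ.1]
  refine sub_eq_zero.1 (Hk_eq_zero_of_modeCoord hN.ne' hv (fun l => ?_) (fun l => ?_))
  · rw [map_sub, map_sum]
    simp only [map_smul, smul_eq_mul, Fin.sum_univ_two, unperturbedBasis, dualCoord,
      Matrix.cons_val_zero, Matrix.cons_val_one, modeCoord_eigvec hk hN.ne' (hv _)]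
    rcases eq_or_ne l 0 with rfl | hl
    · rw [hin 1 0 (by norm_num) rfl]
      norm_num
    · rw [hout 1 l (by norm_num) (hne _ _ _ _ (h1 l hl)), if_neg hl]
      norm_num
  · rw [map_sub, map_sum]
    simp only [map_smul, smul_eq_mul, Fin.sum_univ_two, unperturbedBasis, dualCoord,
      Matrix.cons_val_zero, Matrix.cons_val_one, modeCoord_eigvec hk hN.ne' (hv _)]
    rcases eq_or_ne l 1 with rfl | hl
    · rw [hin (-1) 1 (by norm_num) hlam.symm]
      norm_num
    · rw [hout (-1) l (by norm_num) (hlam ▸ hne _ _ _ _ (h2 l hl)), if_neg hl]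
      norm_num

end Separation

/-! ### First-order matrix elements. -/

section FirstOrder

variable {N : ℝ} {k : Freq} {μ : Plane}

/-- The first order coefficients of the perturbed matrix. -/
def firstOrder (N : ℝ) (k : Freq) (μ : Plane) : Matrix (Fin 2) (Fin 2) ℝ :=
  !![0, b0 N k μ; b1 N k μ, 0]

theorem dualCoord_perturbation (hN : 0 < N) (hk : k ≠ 0) (hk0 : 0 < k 0)
    (hv : ∀ l, wv k μ l ≠ 0) {B : Hk k →L[ℂ] Hk k}
    (hB : ∀ u l, cb k l (B u) =
          Complex.I * ((inner ℝ (perp (vec k)) μ / 2 : ℝ) : ℂ) *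
            (-((1 / (N * ‖vec k‖) : ℝ) : ℂ) * (cb k (l - 1) u + cb k (l + 1) u) +
              (((‖wv k μ (l - 1)‖ ^ 2)⁻¹ : ℝ) * cw k (l - 1) u +
                ((‖wv k μ (l + 1)‖ ^ 2)⁻¹ : ℝ) * cw k (l + 1) u)) ∧
        cw k l (B u) =
          Complex.I * ((inner ℝ (perp (vec k)) μ / 2 : ℝ) : ℂ) *
            (-((1 / (N * ‖vec k‖) : ℝ) : ℂ) * (cw k (l - 1) u + cw k (l + 1) u) +
              ((‖vec k‖ / N : ℝ) : ℂ) * (((‖wv k μ (l - 1)‖ ^ 2)⁻¹ : ℝ) * cw k (l - 1) u +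
                ((‖wv k μ (l + 1)‖ ^ 2)⁻¹ : ℝ) * cw k (l + 1) u)))
    (i j : Fin 2) : dualCoord N k μ i (B (unperturbedBasis N k μ j)) =
      Complex.I * firstOrder N k μ i j := by
  have hN' : (N : ℂ) ≠ 0 := Complex.ofReal_ne_zero.2 hN.ne'
  have hK : (‖vec k‖ : ℂ) ≠ 0 := Complex.ofReal_ne_zero.2 (norm_vec_pos hk0).ne'
  have hm : (‖μ‖ : ℂ) ≠ 0 := by
    have := hv 0
    rw [wv_zero] at this
    exact Complex.ofReal_ne_zero.2 (norm_ne_zero_iff.2 this)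
  have hp : (‖vec k + μ‖ : ℂ) ≠ 0 := by
    have := hv 1
    rw [wv_one] at this
    exact Complex.ofReal_ne_zero.2 (norm_ne_zero_iff.2 this)
  have h2 : ((√2 : ℝ) : ℂ) ≠ 0 := Complex.ofReal_ne_zero.2 (by positivity)
  have h2' : ((√2 : ℝ) : ℂ) ^ 2 = 2 := by
    rw [← Complex.ofReal_pow, Real.sq_sqrt (by norm_num)]; norm_num
  -- Multiplication by cos(k·x) couples l only with l ± 1, so the diagonal entries vanish; the two
  -- goals that remain are the couplings between l = 0 and l = 1.
  fin_cases i <;> fin_cases j <;>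
    simp only [dualCoord, unperturbedBasis, firstOrder, Matrix.of_apply, Fin.zero_eta, Fin.mk_one,
      Matrix.cons_val_zero, Matrix.cons_val_one, Fin.isValue, modeCoord_apply, (hB _ _).1,
      (hB _ _).2, cb_eigvec hk, cw_eigvec hk] <;> norm_num [wv_zero, wv_one, b0, b1]
  · field_simp
    rw [h2']
    ring
  · field_simp
    rw [h2']
    ring

end FirstOrder

/-! ### Expansion of the matrix and of its eigenvalues. -/

theorem eCoeff_eq (N : ℝ) (k : Freq) (μ : Plane) : eCoeff N k μ = -(b1 N k μ * b0 N k μ) := by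
  simp only [eCoeff, b1, b0, div_eq_mul_inv, mul_inv]
  ring

theorem isAnalyticO_one {g : ℝ → ℝ} (hg : AnalyticAt ℝ g 0) (h0 : g 0 = 0) : IsAnalyticO g 1 := by
  refine ⟨hg, ?_⟩
  have := hg.differentiableAt.isBigO_sub
  simpa [h0] using this

theorem isAnalyticO_two {g : ℝ → ℝ} (hg : AnalyticAt ℝ g 0) (h0 : g 0 = 0) :
    IsAnalyticO (fun ε => ε * g ε) 2 := by
  refine ⟨analyticAt_id.mul hg, ?_⟩
  have := (isBigO_refl (fun ε : ℝ => ε) (𝓝 0)).mul (isAnalyticO_one hg h0).2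
  simpa [pow_two] using this

theorem Complex_sqrt_mul_self (z : ℂ) : Complex.sqrt z * Complex.sqrt z = z := by
  rw [Complex.sqrt, ← pow_two]
  exact Complex.cpow_nat_inv_pow z two_ne_zero

theorem charpoly_fin_two_factor {M : Matrix (Fin 2) (Fin 2) ℂ} {a b : ℂ}
    (ht : M 0 0 + M 1 1 = a + b) (hd : M 0 0 * M 1 1 - M 0 1 * M 1 0 = a * b) :
    M.charpoly = (Polynomial.X - Polynomial.C a) * (Polynomial.X - Polynomial.C b) := by
  rw [Matrix.charpoly_fin_two, Matrix.trace_fin_two, Matrix.det_fin_two, ht, hd]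
  simp only [map_add, map_mul]
  ring

/-- With M = λ⁺ + iεh and h real, the eigenvalues are λ⁺ + iε(h₀₀ + h₁₁)/2 ± ε√(-((h₀₀ - h₁₁)/2)² -
h₀₁h₁₀). At ε = 0 the radicand is -b₀b₁ = e. -/
theorem spectral_expansion {N : ℝ} (hN : 0 < N) {k : Freq} (hk0 : 0 < k 0) {μ : Plane}
    (hμ : μ ∈ resonantSet N k \ exceptionalSet N k) {ρ : ℝ} (hρ : IsSeparating N k μ ρ) :
    ∃ ε₀ > 0, ∃ r₁ r₂ r₃ r₄ r s : ℝ → ℝ,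
      IsAnalyticO r₁ 2 ∧ IsAnalyticO r₂ 2 ∧ IsAnalyticO r₃ 2 ∧ IsAnalyticO r₄ 2 ∧
      IsAnalyticO r 2 ∧ IsAnalyticO s 1 ∧
      ∀ ε ∈ Set.Ioo 0 ε₀, ∃ M : Matrix (Fin 2) (Fin 2) ℂ, ∃ lp lm : ℂ,
        M = !![lambdaPlus N k μ + Complex.I * r₁ ε,
                Complex.I * b0 N k μ * ε + Complex.I * r₂ ε;
              Complex.I * b1 N k μ * ε + Complex.I * r₃ ε,
                lambdaPlus N k μ + Complex.I * r₄ ε] ∧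
        lp = lambdaPlus N k μ + Complex.I * r ε
          + ε * Complex.sqrt ((eCoeff N k μ + s ε : ℝ) : ℂ) ∧
        lm = lambdaPlus N k μ + Complex.I * r ε
          - ε * Complex.sqrt ((eCoeff N k μ + s ε : ℝ) : ℂ) ∧
        Metric.sphere (lambdaPlus N k μ) ρ ⊆ resolventSetOf (restrictedOp N k μ ε) ∧
        Module.finrank ℂ (specSubspace N k μ ρ ε) = 2 ∧
        IsRepresentedBy (restrictedOp N k μ ε) (specSubspace N k μ ρ ε)
          (specBasis N k μ ρ ε) M ∧
        eigenvaluesOn (restrictedOp N k μ ε) (specSubspace N k μ ρ ε) = {lp, lm} ∧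
        M.charpoly = (Polynomial.X - Polynomial.C lp) * (Polynomial.X - Polynomial.C lm) := by
  have hμ0 : μ ≠ 0 := by
    rintro rfl
    exact hμ.2 (zero_mem_exceptionalSet hk0)
  have hk : k ≠ 0 := by rintro rfl; exact lt_irrefl _ hk0
  have hv := wv_ne_zero hN hk0 hμ.1 hμ0
  have hlam : lambdaPlus N k μ = Complex.I * freqW N k μ (-1) 1 := by
    rw [lambdaPlus, freqW_zero_eq hk0 hμ.1]
  obtain ⟨B, hA, hB⟩ := exists_perturbation N k μ hk
  obtain ⟨J, hJ1, hJ2⟩ := exists_conj k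
  have hJb : ∀ l u, cb k l (J u) = (starRingEnd ℂ) (cb k l u) := fun l u => hJ1 u _
  have hJw : ∀ l u, cw k l (J u) = (starRingEnd ℂ) (cw k l u) := fun l u => hJ2 u _
  have hJm : ∀ σ l u, modeCoord N k μ σ l (J u) = (starRingEnd ℂ) (modeCoord N k μ σ l u) := by
    intro σ l u
    simp only [modeCoord_apply, hJb, hJw, map_sub, map_mul, Complex.conj_ofReal]
  have hJe : ∀ σ l, J (eigvec N k μ σ l) = eigvec N k μ σ l := by
    intro σ l
    refine Hk_ext (fun j => ?_) (fun j => ?_)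
    · rw [hJb, cb_eigvec hk]
      split_ifs <;> simp
    · rw [hJw, cw_eigvec hk]
      split_ifs <;> simp
  have hJA : Anticommutes J (restrictedOp N k μ 0) := by
    intro u
    have hd : J u ∈ (restrictedOp N k μ 0).domain := by
      have key : ∀ f g : L2, (∀ q, coeff g q = (starRingEnd ℂ) (coeff f q)) → f ∈ H1 → g ∈ H1 := by
        intro f g hfg hf
        refine memlp_of_le hf 1 fun q => ?_
        rw [norm_mul, norm_mul, hfg, RCLike.norm_conj, one_mul]
      exact ⟨key _ _ (hJ1 u) u.2.1, key _ _ (hJ2 u) u.2.2⟩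
    refine ⟨hd, Hk_ext (fun l => ?_) (fun l => ?_)⟩
    · rw [cb_restrictedOp, map_neg, hJb, hJb, hJw, cb_restrictedOp]
      simp only [map_sub, map_mul, Complex.conj_ofReal, Complex.conj_I]
      ring
    · rw [cw_restrictedOp, map_neg, hJb, hJw, hJw, cw_restrictedOp]
      simp only [map_sub, map_mul, Complex.conj_ofReal, Complex.conj_I]
      ring
  have hJB : ∀ x, B (J x) = -J (B x) := by
    intro x
    refine Hk_ext (fun l => ?_) (fun l => ?_)
    · rw [map_neg, hJb, (hB _ _).1, (hB _ _).1]
      simp only [map_add, map_mul, map_neg, Complex.conj_ofReal, Complex.conj_I, hJb, hJw]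
      ring
    · rw [map_neg, hJw, (hB _ _).2, (hB _ _).2]
      simp only [map_add, map_mul, map_neg, Complex.conj_ofReal, Complex.conj_I, hJw]
      ring
  -- Any inner radius would do, because the centre is the only spectral point in the disc.
  obtain ⟨H, hHa, hH0, hH⟩ := exists_representing_matrix hA hJA hJB (c := lambdaPlus N k μ)
    (r := ρ / 2) (ρ := ρ) (by simp [lambdaPlus]) (half_pos hρ.1) (half_lt_self hρ.1)
    (annulus_subset_resolventSetOf hρ (half_pos hρ.1)) (rieszProj_zero hN hk0 hμ hρ)
    (dualCoord_unperturbedBasis hN hk hv)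
    (by
      intro i u
      fin_cases i
      · rw [hlam]
        exact modeCoord_restrictedOp hN.ne' (hv 1) (by norm_num) u
      · exact modeCoord_restrictedOp hN.ne' (hv 0) (by norm_num) u)
    (by intro j; fin_cases j <;> exact hJe _ _)
    (by intro i x; fin_cases i <;> exact hJm _ _ _)
  simp only [dualCoord_perturbation hN hk hk0 hv hB] at hH0
  set h : Fin 2 → Fin 2 → ℝ → ℝ := fun i j ε => (H ε i j).im with hh
  have hha : ∀ i j, AnalyticAt ℝ (h i j) 0 := fun i j =>
    (Complex.imCLM.analyticAt _).comp (hHa i j)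
  have hh0 : ∀ i j, h i j 0 = firstOrder N k μ i j := fun i j => by
    simp only [hh, hH0, Complex.mul_im, Complex.I_im, Complex.I_re, Complex.ofReal_re,
      Complex.ofReal_im]
    ring
  have h00 : h 0 0 0 = 0 := hh0 0 0
  have h01 : h 0 1 0 = b0 N k μ := hh0 0 1
  have h10 : h 1 0 0 = b1 N k μ := hh0 1 0
  have h11 : h 1 1 0 = 0 := hh0 1 1
  obtain ⟨ε₀, hε₀, hball⟩ := Metric.eventually_nhds_iff.1 hH
  -- The remainders are read off from λ⁺ + iεh. Each of the order-two ones is ε times an analytic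
  -- function vanishing at 0, since h equals the off-diagonal first-order matrix there.
  refine ⟨ε₀, hε₀, fun ε => ε * h 0 0 ε, fun ε => ε * (h 0 1 ε - b0 N k μ),
    fun ε => ε * (h 1 0 ε - b1 N k μ), fun ε => ε * h 1 1 ε,
    fun ε => ε * ((h 0 0 ε + h 1 1 ε) / 2),
    fun ε => -((h 0 0 ε - h 1 1 ε) / 2) ^ 2 - h 0 1 ε * h 1 0 ε - eCoeff N k μ,
    isAnalyticO_two (hha 0 0) h00, isAnalyticO_two ((hha 0 1).sub analyticAt_const) (by
      simp [h01]), isAnalyticO_two ((hha 1 0).sub analyticAt_const) (by simp [h10]),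
    isAnalyticO_two (hha 1 1) h11, isAnalyticO_two
      (((hha 0 0).add (hha 1 1)).div analyticAt_const two_ne_zero) (by simp [h00, h11]),
    isAnalyticO_one ?_ ?_, ?_⟩
  · exact ((((((hha 0 0).sub (hha 1 1)).div analyticAt_const two_ne_zero).pow 2).neg).sub
      ((hha 0 1).mul (hha 1 0))).sub analyticAt_const
  · simp only [h00, h01, h10, h11, eCoeff_eq]
    ring
  · intro ε hε
    obtain ⟨hs, hrank, hrep, hconj⟩ := hball (y := ε) (by
      rw [Real.dist_eq, sub_zero, abs_of_pos hε.1]; exact hε.2)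
    have hHI : ∀ i j, H ε i j = Complex.I * h i j ε := by
      intro i j
      have h1 := hconj i j
      apply Complex.ext
      · have := congrArg Complex.re h1
        simp only [Complex.conj_re, Complex.neg_re] at this
        simp only [Complex.mul_re, Complex.I_re, Complex.I_im, Complex.ofReal_re,
          Complex.ofReal_im]
        linarith
      · simp [hh]
    set c := lambdaPlus N k μ with hc
    set M : Matrix (Fin 2) (Fin 2) ℂ := c • 1 + (ε : ℂ) • H ε with hM
    have hbasis : (fun j => rieszProj (restrictedOp N k μ ε) c ρ (unperturbedBasis N k μ j)) =
        specBasis N k μ ρ ε := by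
      funext j
      fin_cases j <;> rfl
    rw [hbasis] at hrep
    have hM00 : M 0 0 = c + Complex.I * (ε * h 0 0 ε : ℝ) := by
      simp only [hM, Matrix.add_apply, Matrix.smul_apply, Matrix.one_apply_eq, hHI, smul_eq_mul]
      push_cast; ring
    have hM11 : M 1 1 = c + Complex.I * (ε * h 1 1 ε : ℝ) := by
      simp only [hM, Matrix.add_apply, Matrix.smul_apply, Matrix.one_apply_eq, hHI, smul_eq_mul]
      push_cast; ring
    have hM01 : M 0 1 = Complex.I * (ε * h 0 1 ε : ℝ) := by
      have : (1 : Matrix (Fin 2) (Fin 2) ℂ) 0 1 = 0 := Matrix.one_apply_ne (by decide)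
      simp only [hM, Matrix.add_apply, Matrix.smul_apply, this, hHI, smul_eq_mul]
      push_cast; ring
    have hM10 : M 1 0 = Complex.I * (ε * h 1 0 ε : ℝ) := by
      have : (1 : Matrix (Fin 2) (Fin 2) ℂ) 1 0 = 0 := Matrix.one_apply_ne (by decide)
      simp only [hM, Matrix.add_apply, Matrix.smul_apply, this, hHI, smul_eq_mul]
      push_cast; ring
    set q : ℂ := Complex.sqrt ((eCoeff N k μ + (-((h 0 0 ε - h 1 1 ε) / 2) ^ 2 -
      h 0 1 ε * h 1 0 ε - eCoeff N k μ) : ℝ) : ℂ) with hq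
    have hqq : q * q = -((h 0 0 ε - h 1 1 ε) / 2) ^ 2 - h 0 1 ε * h 1 0 ε := by
      rw [hq, Complex_sqrt_mul_self]
      push_cast
      ring
    have hchar : M.charpoly = (Polynomial.X - Polynomial.C (c + Complex.I *
          (ε * ((h 0 0 ε + h 1 1 ε) / 2) : ℝ) + ε * q)) *
        (Polynomial.X - Polynomial.C (c + Complex.I *
          (ε * ((h 0 0 ε + h 1 1 ε) / 2) : ℝ) - ε * q)) := by
      refine charpoly_fin_two_factor ?_ ?_
      · rw [hM00, hM11]
        push_cast
        ring
      · rw [hM00, hM11, hM01, hM10]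
        push_cast
        linear_combination (ε : ℂ) ^ 2 * hqq + (ε : ℂ) ^ 2 * ((h 0 0 ε : ℂ) * h 1 1 ε -
          ((h 0 0 ε + h 1 1 ε) / 2) ^ 2 - h 0 1 ε * h 1 0 ε) * Complex.I_sq
    refine ⟨M, _, _, ?_, rfl, rfl, hs, hrank, hrep, ?_, hchar⟩
    · ext i j
      fin_cases i <;> fin_cases j
      · exact hM00
      · change M 0 1 = _
        rw [hM01]
        simp only [Matrix.of_apply, Matrix.cons_val', Matrix.cons_val_zero, Matrix.cons_val_one,
          Fin.zero_eta, Fin.mk_one]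
        push_cast
        ring
      · change M 1 0 = _
        rw [hM10]
        simp only [Matrix.of_apply, Matrix.cons_val', Matrix.cons_val_zero, Matrix.cons_val_one,
          Fin.zero_eta, Fin.mk_one]
        push_cast
        ring
      · exact hM11
    · refine (eigenvaluesOn_eq_roots hrep).trans ?_
      rw [hchar]
      ext z
      simp only [Set.mem_ofPred_eq, Polynomial.root_mul, Polynomial.root_X_sub_C,
        Set.mem_insert_iff, Set.mem_singleton_iff]
      exact or_congr eq_comm eq_comm

/-! ### The resonant set as a graph over the ordinate. -/

section ResonantCurve

variable {N : ℝ} {k : Freq} {μ : Plane} {y : ℝ}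

theorem mem_resonantSet_iff :
    μ ∈ resonantSet N k ↔ Omega N μ + Omega N (vec k + μ) = Omega N (vec k) := by
  constructor
  · intro h
    linarith [resonance_eq h]
  · intro h
    by_cases h0 : μ = 0
    · exact Or.inl h0
    · exact Or.inr ⟨h0, by linarith⟩

/-- From Ω(v)|v| = N v₁ follows (Ω(v) - Ω(w))|w| = N(v - w)₁ + Ω(v)(|w| - |v|), and |Ω| ≤ N. The
convention Ω(0) = 0 lets v be arbitrary. -/
theorem abs_Omega_sub_le (hN : 0 < N) (v : Plane) {w : Plane} (hw : w ≠ 0) :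
    |Omega N v - Omega N w| ≤ 2 * N * ‖v - w‖ / ‖w‖ := by
  have hw' := norm_pos_iff.2 hw
  rw [le_div_iff₀ hw']
  have e : (Omega N v - Omega N w) * ‖w‖ = N * (v - w) 0 + Omega N v * (‖w‖ - ‖v‖) := by
    rcases eq_or_ne v 0 with rfl | hv
    · rw [Omega_zero, Omega, zero_sub, zero_sub, PiLp.neg_apply]
      field_simp
      ring
    · have hv' := norm_pos_iff.2 hv
      rw [Omega, Omega, PiLp.sub_apply]
      field_simp
      ring
  have h1 : |N * (v - w) 0| ≤ N * ‖v - w‖ := by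
    rw [abs_mul, abs_of_pos hN]
    exact mul_le_mul_of_nonneg_left (abs_apply_le_norm _ 0) hN.le
  have h2 : |Omega N v * (‖w‖ - ‖v‖)| ≤ N * ‖v - w‖ := by
    rw [abs_mul]
    refine mul_le_mul (abs_Omega_le hN v) ?_ (abs_nonneg _) hN.le
    rw [norm_sub_rev]
    exact abs_norm_sub_norm_le w v
  rw [← abs_of_pos hw', ← abs_mul, e]
  exact (abs_add_le _ _).trans (by linarith)

theorem hasDerivAt_Omega_left (N : ℝ) {x : ℝ} (h : x ^ 2 + y ^ 2 ≠ 0) :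
    HasDerivAt (fun x => Omega N !₂[x, y]) (N * y ^ 2 / ‖(!₂[x, y] : Plane)‖ ^ 3) x := by
  have e : ∀ x : ℝ, ‖(!₂[x, y] : Plane)‖ = √(x ^ 2 + y ^ 2) := fun x => by simp [norm_plane]
  have hp : 0 < x ^ 2 + y ^ 2 := lt_of_le_of_ne (by positivity) h.symm
  have hs := Real.sqrt_pos.2 hp
  have h1 : HasDerivAt (fun x : ℝ => √(x ^ 2 + y ^ 2)) (2 * x / (2 * √(x ^ 2 + y ^ 2))) x := by
    have := ((hasDerivAt_pow 2 x).add_const (y ^ 2)).sqrt h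
    simpa using this
  have h2 := ((hasDerivAt_id x).const_mul N).fun_div h1 hs.ne'
  have h3 : (fun x => Omega N !₂[x, y]) = fun x => N * id x / √(x ^ 2 + y ^ 2) := by
    ext x
    simp [Omega, e]
  rw [h3]
  refine h2.congr_deriv ?_
  rw [e]
  have hq := Real.sq_sqrt hp.le
  simp only [id]
  field_simp
  linear_combination N * hq

theorem norm_pair_pos {x : ℝ} (hy : y ≠ 0) : 0 < ‖(!₂[x, y] : Plane)‖ :=
  norm_pos_iff.2 fun h => hy (congrArg (fun v : Plane => v 1) h)

theorem strictMono_Omega_left (hN : 0 < N) (hy : y ≠ 0) :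
    StrictMono fun x => Omega N !₂[x, y] := by
  have hne : ∀ x : ℝ, x ^ 2 + y ^ 2 ≠ 0 := fun x => by positivity
  refine strictMono_of_hasDerivAt_pos (fun x => hasDerivAt_Omega_left N (hne x)) fun x => ?_
  have : 0 < ‖(!₂[x, y] : Plane)‖ := norm_pair_pos hy
  positivity

theorem vec_add_pair (k : Freq) (x y : ℝ) :
    vec k + !₂[x, y] = !₂[(k 0 : ℝ) + x, (k 1 : ℝ) + y] := by
  ext i
  fin_cases i <;> simp [vec]

/-- `Ω(x, y) + Ω(k + (x, y))`. -/
def resonanceSum (N : ℝ) (k : Freq) (x y : ℝ) : ℝ :=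
  Omega N !₂[x, y] + Omega N !₂[(k 0 : ℝ) + x, (k 1 : ℝ) + y]

theorem pair_mem_resonantSet_iff {x : ℝ} :
    !₂[x, y] ∈ resonantSet N k ↔ resonanceSum N k x y = Omega N (vec k) := by
  rw [mem_resonantSet_iff, vec_add_pair, resonanceSum]

theorem strictMono_resonanceSum (hN : 0 < N) (hy : y ≠ 0) (hy' : y ≠ -(k 1 : ℝ)) :
    StrictMono fun x => resonanceSum N k x y := by
  intro a b hab
  have h2 : (k 1 : ℝ) + y ≠ 0 := fun h => hy' (by linarith)
  exact add_lt_add (strictMono_Omega_left hN hy hab)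
    (strictMono_Omega_left hN h2 (by linarith : (k 0 : ℝ) + a < k 0 + b))

/-- In the cone |y| ≤ x the cosine is at least 1/√2 > 2/3. Two such terms exceed N, hence Ω(k). -/
theorem le_Omega_of_abs_le (hN : 0 < N) {x : ℝ} (hy : y ≠ 0) (h : |y| ≤ x) :
    N * (2 / 3) ≤ Omega N !₂[x, y] := by
  have hx : 0 < x := (abs_pos.2 hy).trans_le h
  have h1 : ‖(!₂[x, y] : Plane)‖ ≤ 3 / 2 * x := by
    rw [norm_plane]
    refine Real.sqrt_le_iff.2 ⟨by positivity, ?_⟩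
    have := sq_le_sq' (by linarith [abs_nonneg y]) h
    rw [sq_abs] at this
    simp only [Matrix.cons_val_zero, Matrix.cons_val_one]
    nlinarith
  rw [Omega, le_div_iff₀ (norm_pair_pos hy)]
  simp only [Matrix.cons_val_zero]
  nlinarith

theorem Omega_vec_le (hN : 0 < N) : Omega N (vec k) ≤ N :=
  (le_abs_self _).trans (abs_Omega_le hN _)

theorem exists_resonant (hN : 0 < N) (hk0 : 0 < k 0) (hy : y ≠ 0) (hy' : y ≠ -(k 1 : ℝ)) :
    ∃ x, !₂[x, y] ∈ resonantSet N k := by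
  have h2 : (k 1 : ℝ) + y ≠ 0 := fun h => hy' (by linarith)
  have hk : (0 : ℝ) < k 0 := by exact_mod_cast hk0
  have hc : Continuous fun x => resonanceSum N k x y := by
    refine Continuous.add (continuous_iff_continuousAt.2 fun x =>
      (hasDerivAt_Omega_left N (by positivity)).continuousAt) ?_
    have h3 : Continuous fun x => Omega N !₂[x, (k 1 : ℝ) + y] :=
      continuous_iff_continuousAt.2 fun x =>
        (hasDerivAt_Omega_left N (by positivity)).continuousAt
    exact h3.comp (continuous_const.add continuous_id)
  simp only [pair_mem_resonantSet_iff]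
  -- Intermediate values: at x = -m the shifted term vanishes and the other is nonpositive, while at
  -- x = |y| + |n + y| both points lie in the cone where Ω ≥ 2N/3.
  refine mem_range_of_exists_le_of_exists_ge hc ⟨-k 0, ?_⟩ ⟨|y| + |(k 1 : ℝ) + y|, ?_⟩
  · rw [resonanceSum, add_neg_cancel]
    have e1 : Omega N !₂[0, (k 1 : ℝ) + y] = 0 := by simp [Omega]
    have e2 : Omega N !₂[-(k 0 : ℝ), y] ≤ 0 := by
      rw [Omega]
      refine div_nonpos_of_nonpos_of_nonneg ?_ (norm_nonneg _)
      simp only [Matrix.cons_val_zero]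
      nlinarith
    rw [e1]
    linarith [Omega_vec_pos hN hk0]
  · have e1 := le_Omega_of_abs_le hN hy (le_add_of_nonneg_right (abs_nonneg ((k 1 : ℝ) + y)))
    have e2 := le_Omega_of_abs_le (x := k 0 + (|y| + |(k 1 : ℝ) + y|)) hN h2
      (by linarith [abs_nonneg y])
    rw [resonanceSum]
    linarith [Omega_vec_le (k := k) hN]

theorem mem_resonantSet_iff_eq_abscissa (hN : 0 < N) (hk0 : 0 < k 0) (hy : y ≠ 0)
    (hy' : y ≠ -(k 1 : ℝ)) (x : ℝ) :
    !₂[x, y] ∈ resonantSet N k ↔ x = resonantAbscissa N k y := by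
  have hs : !₂[resonantAbscissa N k y, y] ∈ resonantSet N k :=
    Classical.epsilon_spec (exists_resonant hN hk0 hy hy')
  refine ⟨fun h => ?_, fun h => h ▸ hs⟩
  rw [pair_mem_resonantSet_iff] at h hs
  exact (strictMono_resonanceSum hN hy hy').injective (h.trans hs.symm)

theorem resonantPoint_mem (hN : 0 < N) (hk0 : 0 < k 0) (hy : y ≠ 0) (hy' : y ≠ -(k 1 : ℝ)) :
    resonantPoint N k y ∈ resonantSet N k :=
  (mem_resonantSet_iff_eq_abscissa hN hk0 hy hy' _).2 rfl

theorem abs_Omega_le_of_resonant (hN : 0 < N) (hk0 : 0 < k 0) (hμ : μ ∈ resonantSet N k) :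
    |Omega N μ| ≤ 2 * N * ‖μ‖ / ‖vec k‖ := by
  have h := abs_Omega_sub_le hN (vec k + μ) (vec_ne_zero hk0)
  rw [add_sub_cancel_left, abs_sub_comm, resonance_eq hμ] at h
  exact h

/-- Near the origin the resonant curve is tangent to the vertical axis. -/
theorem abs_abscissa_le (hN : 0 < N) (hk0 : 0 < k 0) (hy : y ≠ 0) (hy' : y ≠ -(k 1 : ℝ))
    (hsmall : 4 * (2 / ‖vec k‖) ^ 2 * y ^ 2 < 1) :
    |resonantAbscissa N k y| ≤ 2 * (2 / ‖vec k‖) * y ^ 2 := by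
  have hK := norm_vec_pos hk0
  set K := 2 / ‖vec k‖ with hKdef
  have hK0 : 0 < K := by positivity
  have hy2 : 0 < y ^ 2 := by positivity
  have hφ := (mem_resonantSet_iff_eq_abscissa hN hk0 hy hy' _).2 rfl
  rw [pair_mem_resonantSet_iff] at hφ
  have hmono := strictMono_resonanceSum (k := k) hN hy hy'
  -- Barrier points x = ±2Ky²: Ω(k + μ) differs from Ω(k) by at most NK|μ|, and |x|/|μ| exceeds K|μ|
  -- as soon as K(x² + y²) < 2Ky², which is the smallness assumption. Monotonicity then traps the
  -- resonant abscissa between them.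
  have hnorm : ∀ x : ℝ, x ^ 2 = (2 * K * y ^ 2) ^ 2 →
      0 < ‖(!₂[x, y] : Plane)‖ ∧ K * ‖(!₂[x, y] : Plane)‖ ^ 2 < 2 * K * y ^ 2 := by
    intro x hx
    have e : ‖(!₂[x, y] : Plane)‖ ^ 2 = x ^ 2 + y ^ 2 := by simp [norm_sq_plane]
    refine ⟨norm_pair_pos hy, ?_⟩
    rw [e, hx]
    nlinarith [mul_pos hK0 hy2]
  have hdiff : ∀ x : ℝ, |Omega N !₂[(k 0 : ℝ) + x, (k 1 : ℝ) + y] - Omega N (vec k)| ≤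
      N * (K * ‖(!₂[x, y] : Plane)‖) := by
    intro x
    have := abs_Omega_sub_le hN (vec k + !₂[x, y]) (vec_ne_zero hk0)
    rw [add_sub_cancel_left, vec_add_pair] at this
    refine this.trans_eq ?_
    rw [hKdef]
    ring
  have hΩ : ∀ x : ℝ, Omega N !₂[x, y] = N * (x / ‖(!₂[x, y] : Plane)‖) := fun x => by
    rw [Omega, mul_div_assoc]
    rfl
  refine abs_le.2 ⟨?_, ?_⟩
  · refine hmono.le_iff_le.1 ?_
    change resonanceSum N k (-(2 * K * y ^ 2)) y ≤ resonanceSum N k _ y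
    rw [hφ]
    obtain ⟨hp, hlt⟩ := hnorm (-(2 * K * y ^ 2)) (by ring)
    have h1 := (abs_le.1 (hdiff (-(2 * K * y ^ 2)))).2
    have h2 : K * ‖(!₂[-(2 * K * y ^ 2), y] : Plane)‖ +
        -(2 * K * y ^ 2) / ‖(!₂[-(2 * K * y ^ 2), y] : Plane)‖ ≤ 0 := by
      rw [← le_sub_iff_add_le, zero_sub, ← neg_div, neg_neg, le_div_iff₀ hp]
      linarith
    rw [resonanceSum, hΩ]
    nlinarith
  · refine hmono.le_iff_le.1 ?_
    change resonanceSum N k _ y ≤ resonanceSum N k (2 * K * y ^ 2) y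
    rw [hφ]
    obtain ⟨hp, hlt⟩ := hnorm (2 * K * y ^ 2) (by ring)
    have h1 := (abs_le.1 (hdiff (2 * K * y ^ 2))).1
    have h2 : K * ‖(!₂[2 * K * y ^ 2, y] : Plane)‖ ≤
        2 * K * y ^ 2 / ‖(!₂[2 * K * y ^ 2, y] : Plane)‖ := by
      rw [le_div_iff₀ hp]
      linarith
    rw [resonanceSum, hΩ]
    nlinarith

theorem eventually_abs_abscissa_le (hN : 0 < N) (hk0 : 0 < k 0) (hk1 : 0 < k 1) :
    ∀ᶠ y in 𝓝[≠] 0, |resonantAbscissa N k y| ≤ 2 * (2 / ‖vec k‖) * y ^ 2 := by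
  have hk : (0 : ℝ) < k 1 := by exact_mod_cast hk1
  have h1 : ∀ᶠ y : ℝ in 𝓝 0, 4 * (2 / ‖vec k‖) ^ 2 * y ^ 2 < 1 := by
    refine ContinuousAt.eventually_lt (by fun_prop) continuousAt_const ?_
    norm_num
  have h2 : ∀ᶠ y : ℝ in 𝓝 0, y ≠ -(k 1 : ℝ) := eventually_ne_nhds (by linarith)
  filter_upwards [nhdsWithin_le_nhds h1, nhdsWithin_le_nhds h2, self_mem_nhdsWithin]
    with y h1 h2 hy
  exact abs_abscissa_le hN hk0 hy h2 h1

end ResonantCurve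

/-! ### Asymptotics of e near the origin. -/

section SmallWavenumber

variable {N : ℝ} {k : Freq} {y ξ : ℝ}

/-- `e(μ) / y` at `μ = (ξ y, y)`, as a function of `(ξ, y, |y|)`. -/
def eCoeffSmall (N : ℝ) (k : Freq) (p : ℝ × ℝ × ℝ) : ℝ :=
  (k 1 * p.1 - k 0) ^ 2 *
    ((2 * k 0 * p.1 + 2 * k 1 + p.2.1 * (1 + p.1 ^ 2)) /
      (√((k 0 + p.2.1 * p.1) ^ 2 + (k 1 + p.2.1) ^ 2) + ‖vec k‖)) *
    (‖vec k‖ + p.2.2 * √(1 + p.1 ^ 2)) *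
    (√((k 0 + p.2.1 * p.1) ^ 2 + (k 1 + p.2.1) ^ 2) + ‖vec k‖ - p.2.2 * √(1 + p.1 ^ 2)) ^ 2 /
    (16 * N ^ 2 * (1 + p.1 ^ 2) * ((k 0 + p.2.1 * p.1) ^ 2 + (k 1 + p.2.1) ^ 2) * ‖vec k‖ ^ 2)

theorem norm_vec_sq (k : Freq) : ‖vec k‖ ^ 2 = (k 0 : ℝ) ^ 2 + (k 1 : ℝ) ^ 2 := by
  rw [norm_sq_plane, vec_zero_apply, vec_one_apply]

/-- Rationalising |k + μ| - |k| extracts the factor y. Since |μ| = |y|√(1 + ξ²) is not smooth in y,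
|y| is kept as a separate variable, and what remains is differentiable at the origin. -/
theorem eCoeff_eq_small (hk0 : 0 < k 0) (hy : y ≠ 0) :
    eCoeff N k !₂[ξ * y, y] = y * eCoeffSmall N k (ξ, y, |y|) := by
  have hK := norm_vec_pos hk0
  have e1 : inner ℝ (perp (vec k)) !₂[ξ * y, y] = y * (k 1 * ξ - k 0) := by
    rw [inner_plane]
    simp only [perp_zero_apply, perp_one_apply, vec_zero_apply, vec_one_apply,
      Matrix.cons_val_zero, Matrix.cons_val_one]
    ring
  have hB : 0 < 1 + ξ ^ 2 := by positivity
  have e2 : ‖(!₂[ξ * y, y] : Plane)‖ = |y| * √(1 + ξ ^ 2) := by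
    rw [← Real.sqrt_sq_eq_abs, ← Real.sqrt_mul (sq_nonneg y), norm_plane]
    simp only [Matrix.cons_val_zero, Matrix.cons_val_one]
    ring_nf
  have e3 : ‖vec k + !₂[ξ * y, y]‖ = √((k 0 + y * ξ) ^ 2 + (k 1 + y) ^ 2) := by
    rw [vec_add_pair, norm_plane]
    simp only [Matrix.cons_val_zero, Matrix.cons_val_one]
    ring_nf
  set A := √((k 0 + y * ξ) ^ 2 + (k 1 + y) ^ 2) with hA
  have hA0 : 0 ≤ A := Real.sqrt_nonneg _
  have hAsq : A ^ 2 = (k 0 + y * ξ) ^ 2 + (k 1 + y) ^ 2 := Real.sq_sqrt (by positivity)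
  have e4 : A - ‖vec k‖ = y * ((2 * k 0 * ξ + 2 * k 1 + y * (1 + ξ ^ 2)) / (A + ‖vec k‖)) := by
    have := norm_vec_sq k
    field_simp
    linear_combination hAsq - this
  have e5 : (|y| * √(1 + ξ ^ 2)) ^ 2 = y ^ 2 * (1 + ξ ^ 2) := by
    rw [mul_pow, sq_abs, Real.sq_sqrt hB.le]
  rw [eCoeff, e1, e2, e3, e4, e5, eCoeffSmall]
  simp only [← hAsq, Real.sqrt_sq hA0]
  generalize (2 * k 0 * ξ + 2 * k 1 + y * (1 + ξ ^ 2)) / (A + ‖vec k‖) = T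
  rw [mul_div_assoc', mul_div_assoc', show
    16 * N ^ 2 * (y ^ 2 * (1 + ξ ^ 2)) * A ^ 2 * ‖vec k‖ ^ 2 =
    y ^ 2 * (16 * N ^ 2 * (1 + ξ ^ 2) * A ^ 2 * ‖vec k‖ ^ 2) by ring,
    show (y * (k 1 * ξ - k 0)) ^ 2 * (y * T * (‖vec k‖ + |y| * √(1 + ξ ^ 2)) *
      (A + ‖vec k‖ - |y| * √(1 + ξ ^ 2)) ^ 2) = y ^ 2 * (y * ((k 1 * ξ - k 0) ^ 2 * T *
      (‖vec k‖ + |y| * √(1 + ξ ^ 2)) * (A + ‖vec k‖ - |y| * √(1 + ξ ^ 2)) ^ 2)) by ring,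
    mul_div_mul_left _ _ (pow_ne_zero 2 hy)]

theorem eCoeffSmall_zero (hN : 0 < N) (hk0 : 0 < k 0) :
    eCoeffSmall N k 0 = (k 0 : ℝ) ^ 2 * k 1 / (4 * N ^ 2 * ‖vec k‖ ^ 2) := by
  have hK := norm_vec_pos hk0
  simp only [eCoeffSmall, Prod.fst_zero, Prod.snd_zero, mul_zero, zero_mul, add_zero, zero_add,
    ne_eq, OfNat.ofNat_ne_zero, not_false_eq_true, zero_pow, sub_zero, zero_sub,
    ← norm_vec_sq, Real.sqrt_sq hK.le]
  field_simp
  ring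

theorem differentiableAt_eCoeffSmall (hN : 0 < N) (hk0 : 0 < k 0) :
    DifferentiableAt ℝ (eCoeffSmall N k) 0 := by
  have hK := norm_vec_pos hk0
  have hk : (0 : ℝ) < k 0 := by exact_mod_cast hk0
  have h1 : (k 0 : ℝ) ^ 2 + (k 1 : ℝ) ^ 2 ≠ 0 := by positivity
  have h2 : √((k 0 : ℝ) ^ 2 + (k 1 : ℝ) ^ 2) + ‖vec k‖ ≠ 0 := by positivity
  have h3 : 16 * N ^ 2 * ((k 0 : ℝ) ^ 2 + (k 1 : ℝ) ^ 2) * ‖vec k‖ ^ 2 ≠ 0 := by positivity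
  unfold eCoeffSmall
  fun_prop (disch := simp_all)

/-- The abscissa is O(y²), so all three arguments of the reduced function are O(y).
Differentiability at 0 gives an O(y) error, and the factor y makes it O(y²). -/
theorem eCoeff_resonantPoint_small (hN : 0 < N) (hk0 : 0 < k 0) (hk1 : 0 < k 1) :
    (fun y => eCoeff N k (resonantPoint N k y) -
      (k 0 : ℝ) ^ 2 * k 1 / (4 * N ^ 2 * ‖vec k‖ ^ 2) * y) =O[𝓝[≠] 0] fun y => y ^ 2 := by
  set C := 2 * (2 / ‖vec k‖) with hC
  have hC0 : 0 ≤ C := by positivity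
  have hid : (fun y : ℝ => y) =O[𝓝[≠] 0] fun y : ℝ => y := isBigO_refl _ _
  have hξ : (fun y => resonantAbscissa N k y / y) =O[𝓝[≠] 0] fun y : ℝ => y := by
    refine IsBigO.of_bound C ?_
    filter_upwards [eventually_abs_abscissa_le hN hk0 hk1, self_mem_nhdsWithin] with y h1 hy
    have hy' : 0 < |y| := abs_pos.2 hy
    rw [norm_div, Real.norm_eq_abs, Real.norm_eq_abs, div_le_iff₀ hy', mul_assoc, ← pow_two, sq_abs]
    exact h1
  have hp : (fun y => (resonantAbscissa N k y / y, y, |y|)) =O[𝓝[≠] 0] fun y : ℝ => y :=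
    hξ.prod_left (hid.prod_left hid.abs_left)
  have ht : Tendsto (fun y => (resonantAbscissa N k y / y, y, |y|)) (𝓝[≠] 0) (𝓝 0) :=
    hp.trans_tendsto (tendsto_id.mono_left nhdsWithin_le_nhds)
  have h := ((differentiableAt_eCoeffSmall hN hk0).isBigO_sub.comp_tendsto ht)
  simp only [Function.comp_def, sub_zero] at h
  refine (hid.mul (h.trans hp)).congr' ?_ (Eventually.of_forall fun y => (pow_two y).symm)
  filter_upwards [self_mem_nhdsWithin] with y hy
  have hy' : y ≠ 0 := hy
  rw [mul_sub, ← eCoeff_eq_small hk0 hy', div_mul_cancel₀ _ hy', eCoeffSmall_zero hN hk0,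
    resonantPoint]
  ring

end SmallWavenumber

/-! ### Asymptotics of e at infinity. -/

section LargeWavenumber

variable {N : ℝ} {k : Freq}

/-- `e(μ)` at `μ = t⁻¹ (u, √(1 - u²))`, as a function of `(u, t)`. -/
def eCoeffLarge (N : ℝ) (k : Freq) (p : ℝ × ℝ) : ℝ :=
  (k 1 * p.1 - k 0 * √(1 - p.1 ^ 2)) ^ 2 *
    (√(1 + 2 * p.2 * (k 0 * p.1 + k 1 * √(1 - p.1 ^ 2)) + p.2 ^ 2 * ‖vec k‖ ^ 2)
      - p.2 * ‖vec k‖) * (p.2 * ‖vec k‖ + 1) *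
    ((2 * (k 0 * p.1 + k 1 * √(1 - p.1 ^ 2)) + p.2 * ‖vec k‖ ^ 2) /
      (√(1 + 2 * p.2 * (k 0 * p.1 + k 1 * √(1 - p.1 ^ 2)) + p.2 ^ 2 * ‖vec k‖ ^ 2) + 1)
      + ‖vec k‖) ^ 2 /
    (16 * N ^ 2 * (1 + 2 * p.2 * (k 0 * p.1 + k 1 * √(1 - p.1 ^ 2)) + p.2 ^ 2 * ‖vec k‖ ^ 2) *
      ‖vec k‖ ^ 2)

/-- The difference |k + μ| - |μ| is rationalised so that it stays regular as t = 1/|μ| tends to 0.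
Positivity of the ordinate fixes the sign of μ₂/|μ| = √(1 - u²). -/
theorem eCoeff_eq_large {μ : Plane} (hk0 : 0 < k 0) (hμ : 0 < μ 1) :
    eCoeff N k μ = eCoeffLarge N k (μ 0 / ‖μ‖, ‖μ‖⁻¹) := by
  have hK := norm_vec_pos hk0
  have hM : 0 < ‖μ‖ := norm_pos_iff.2 fun h => hμ.ne' (by rw [h]; rfl)
  have hsq := norm_sq_plane μ
  have hw : √(1 - (μ 0 / ‖μ‖) ^ 2) = μ 1 / ‖μ‖ := by
    rw [Real.sqrt_eq_iff_mul_self_eq_of_pos (by positivity)]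
    field_simp
    linarith
  have hnum : 1 + 2 * ‖μ‖⁻¹ * (k 0 * (μ 0 / ‖μ‖) + k 1 * (μ 1 / ‖μ‖)) + ‖μ‖⁻¹ ^ 2 * ‖vec k‖ ^ 2 =
      (‖vec k + μ‖ / ‖μ‖) ^ 2 := by
    rw [div_pow, norm_sq_plane (vec k + μ), norm_vec_sq]
    simp only [PiLp.add_apply, vec_zero_apply, vec_one_apply]
    field_simp
    rw [hsq]
    ring
  have hA : √(1 + 2 * ‖μ‖⁻¹ * (k 0 * (μ 0 / ‖μ‖) + k 1 * (μ 1 / ‖μ‖)) +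
      ‖μ‖⁻¹ ^ 2 * ‖vec k‖ ^ 2) = ‖vec k + μ‖ / ‖μ‖ := by
    rw [hnum, Real.sqrt_sq (by positivity)]
  have hdiff : (2 * (k 0 * (μ 0 / ‖μ‖) + k 1 * (μ 1 / ‖μ‖)) + ‖μ‖⁻¹ * ‖vec k‖ ^ 2) /
      (‖vec k + μ‖ / ‖μ‖ + 1) = ‖vec k + μ‖ - ‖μ‖ := by
    have hV : 0 ≤ ‖vec k + μ‖ := norm_nonneg _
    have hVsq := norm_sq_plane (vec k + μ)
    simp only [PiLp.add_apply, vec_zero_apply, vec_one_apply] at hVsq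
    rw [div_eq_iff (by positivity), norm_vec_sq]
    field_simp
    linear_combination hsq - hVsq
  simp only [eCoeffLarge, hw, hA]
  rw [hdiff, hnum, eCoeff, inner_plane]
  simp only [perp_zero_apply, perp_one_apply, vec_zero_apply, vec_one_apply]
  -- If k + μ = 0, both sides are 0 by the convention for division by zero.
  rcases eq_or_ne ‖vec k + μ‖ 0 with hV | hV
  · simp [hV]
  · field_simp
    ring

/-- The two terms Ω(μ) and Ω(k + μ) add up to Ω(k) and differ by at most 2N|k|/|μ|, so each is close
to half of Ω(k). -/
theorem abs_Omega_sub_half_le (hN : 0 < N) {μ : Plane} (hμ0 : μ ≠ 0)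
    (hμ : μ ∈ resonantSet N k) :
    |μ 0 / ‖μ‖ - k 0 / (2 * ‖vec k‖)| ≤ ‖vec k‖ * ‖μ‖⁻¹ := by
  have h := abs_Omega_sub_le hN (vec k + μ) hμ0
  rw [add_sub_cancel_right] at h
  have e : Omega N (vec k + μ) - Omega N μ = 2 * N * (k 0 / (2 * ‖vec k‖) - μ 0 / ‖μ‖) := by
    have h1 := resonance_eq hμ
    have h2 : Omega N (vec k) = N * (k 0 / ‖vec k‖) := by
      rw [Omega, vec_zero_apply, mul_div_assoc]
    have h3 : Omega N μ = N * (μ 0 / ‖μ‖) := by rw [Omega, mul_div_assoc]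
    have h4 : (k 0 : ℝ) / (2 * ‖vec k‖) = k 0 / ‖vec k‖ / 2 := by rw [div_div, mul_comm]
    rw [h4]
    linear_combination (-1 : ℝ) * h1 - 2 * h3 + h2
  rw [e, abs_mul, abs_of_pos (by positivity : 0 < 2 * N), mul_assoc, mul_div_assoc, mul_assoc,
    abs_sub_comm] at h
  have h5 := le_of_mul_le_mul_left h (by norm_num : (0 : ℝ) < 2)
  rw [← div_eq_mul_inv]
  exact le_of_mul_le_mul_left h5 hN

theorem eCoeffLarge_limit (hN : 0 < N) (hk0 : 0 < k 0) :
    eCoeffLarge N k ((k 0 : ℝ) / (2 * ‖vec k‖), 0) =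
      (k 0 : ℝ) ^ 2 / (256 * N ^ 2 * ‖vec k‖ ^ 6)
        * ((k 1 : ℝ) - √(3 * (k 0 : ℝ) ^ 2 + 4 * (k 1 : ℝ) ^ 2)) ^ 2
        * (3 * (k 0 : ℝ) ^ 2 + 2 * (k 1 : ℝ) ^ 2
          + (k 1 : ℝ) * √(3 * (k 0 : ℝ) ^ 2 + 4 * (k 1 : ℝ) ^ 2)) ^ 2 := by
  have hK := norm_vec_pos hk0
  have hKsq := norm_vec_sq k
  set S := √(3 * (k 0 : ℝ) ^ 2 + 4 * (k 1 : ℝ) ^ 2) with hS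
  have hS2 : S ^ 2 = 3 * (k 0 : ℝ) ^ 2 + 4 * (k 1 : ℝ) ^ 2 := Real.sq_sqrt (by positivity)
  have hS0 : 0 < S := Real.sqrt_pos.2 (by have : (0 : ℝ) < k 0 := by exact_mod_cast hk0
                                          positivity)
  have hw : √(1 - ((k 0 : ℝ) / (2 * ‖vec k‖)) ^ 2) = S / (2 * ‖vec k‖) := by
    rw [Real.sqrt_eq_iff_mul_self_eq_of_pos (by positivity)]
    field_simp
    linear_combination hS2 - 4 * hKsq
  have e1 : 2 * (k 0 * ((k 0 : ℝ) / (2 * ‖vec k‖)) + k 1 * (S / (2 * ‖vec k‖))) / (1 + 1) +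
      ‖vec k‖ = (3 * (k 0 : ℝ) ^ 2 + 2 * (k 1 : ℝ) ^ 2 + k 1 * S) / (2 * ‖vec k‖) := by
    field_simp
    linear_combination 4 * hKsq
  have e2 : k 1 * ((k 0 : ℝ) / (2 * ‖vec k‖)) - k 0 * (S / (2 * ‖vec k‖)) =
      k 0 * (k 1 - S) / (2 * ‖vec k‖) := by
    field_simp
  simp only [eCoeffLarge, hw, mul_zero, zero_mul, add_zero, sub_zero, zero_add, ne_eq,
    OfNat.ofNat_ne_zero, not_false_eq_true, zero_pow, Real.sqrt_one, mul_one]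
  rw [e1, e2]
  field_simp
  ring

theorem one_sub_half_sq_pos (hk0 : 0 < k 0) : 0 < 1 - ((k 0 : ℝ) / (2 * ‖vec k‖)) ^ 2 := by
  have hK := norm_vec_pos hk0
  have hKsq := norm_vec_sq k
  rw [div_pow, sub_pos, div_lt_one (by positivity)]
  nlinarith [sq_nonneg (k 1 : ℝ), pow_pos hK 2]

theorem differentiableAt_eCoeffLarge (hN : 0 < N) (hk0 : 0 < k 0) :
    DifferentiableAt ℝ (eCoeffLarge N k) ((k 0 : ℝ) / (2 * ‖vec k‖), 0) := by
  have hK := norm_vec_pos hk0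
  have h1 := (one_sub_half_sq_pos hk0).ne'
  have h2 := hN.ne'
  have h3 := hK.ne'
  unfold eCoeffLarge
  generalize (k 0 : ℝ) / (2 * ‖vec k‖) = c at h1
  generalize ‖vec k‖ = K at h3
  fun_prop (disch := first | assumption | (norm_num; done) | (norm_num; simp_all))

theorem eCoeff_resonantPoint_large (hN : 0 < N) (hk0 : 0 < k 0) (hk1 : 0 < k 1) :
    (fun τ => eCoeff N k (resonantPoint N k τ) -
      eCoeffLarge N k ((k 0 : ℝ) / (2 * ‖vec k‖), 0)) =O[atTop] fun τ => τ⁻¹ := by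
  have hk : (0 : ℝ) < k 1 := by exact_mod_cast hk1
  have hK := norm_vec_pos hk0
  have hle : ∀ τ : ℝ, τ ≤ ‖resonantPoint N k τ‖ := fun τ =>
    (le_abs_self τ).trans (abs_apply_le_norm (resonantPoint N k τ) 1)
  have hinv : (fun τ => ‖resonantPoint N k τ‖⁻¹) =O[atTop] fun τ : ℝ => τ⁻¹ := by
    refine IsBigO.of_bound 1 ?_
    filter_upwards [eventually_gt_atTop 0] with τ hτ
    rw [one_mul, Real.norm_of_nonneg (by positivity), Real.norm_of_nonneg (by positivity)]
    exact inv_anti₀ hτ (hle τ)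
  have hu : (fun τ => resonantPoint N k τ 0 / ‖resonantPoint N k τ‖ - k 0 / (2 * ‖vec k‖))
      =O[atTop] fun τ : ℝ => τ⁻¹ := by
    refine IsBigO.trans (IsBigO.of_bound ‖vec k‖ ?_) hinv
    filter_upwards [eventually_gt_atTop 0] with τ hτ
    rw [Real.norm_eq_abs, norm_inv, norm_norm]
    refine abs_Omega_sub_half_le hN (norm_pos_iff.1 (hτ.trans_le (hle τ)))
      (resonantPoint_mem hN hk0 hτ.ne' (by linarith))
  set p₀ : ℝ × ℝ := ((k 0 : ℝ) / (2 * ‖vec k‖), 0) with hp₀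
  set p : ℝ → ℝ × ℝ := fun τ =>
    (resonantPoint N k τ 0 / ‖resonantPoint N k τ‖, ‖resonantPoint N k τ‖⁻¹) with hpdef
  have hp : (fun τ => p τ - p₀) =O[atTop] fun τ : ℝ => τ⁻¹ := by
    refine (hu.prod_left hinv).congr_left fun τ => ?_
    simp [hpdef, hp₀]
  have ht : Tendsto p atTop (𝓝 p₀) :=
    tendsto_sub_nhds_zero_iff.1 (hp.trans_tendsto tendsto_inv_atTop_zero)
  have h := (differentiableAt_eCoeffLarge hN hk0).isBigO_sub.comp_tendsto ht
  refine (h.trans hp).congr' ?_ EventuallyEq.rfl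
  filter_upwards [eventually_gt_atTop 0] with τ hτ
  simp only [Function.comp_def]
  rw [eCoeff_eq_large hk0 (μ := resonantPoint N k τ) hτ]

theorem eCoeff_limit_pos (hN : 0 < N) (hk0 : 0 < k 0) (hk1 : 0 < k 1) :
    0 < (k 0 : ℝ) ^ 2 / (256 * N ^ 2 * ‖vec k‖ ^ 6)
      * ((k 1 : ℝ) - √(3 * (k 0 : ℝ) ^ 2 + 4 * (k 1 : ℝ) ^ 2)) ^ 2
      * (3 * (k 0 : ℝ) ^ 2 + 2 * (k 1 : ℝ) ^ 2
        + (k 1 : ℝ) * √(3 * (k 0 : ℝ) ^ 2 + 4 * (k 1 : ℝ) ^ 2)) ^ 2 := by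
  have hK := norm_vec_pos hk0
  have hk : (0 : ℝ) < k 0 := by exact_mod_cast hk0
  have hk' : (0 : ℝ) < k 1 := by exact_mod_cast hk1
  have hlt : (k 1 : ℝ) < √(3 * (k 0 : ℝ) ^ 2 + 4 * (k 1 : ℝ) ^ 2) :=
    Real.lt_sqrt_of_sq_lt (by nlinarith)
  have hne := (sub_neg.2 hlt).ne
  positivity

theorem eventually_pos_of_isBigO_small {f : ℝ → ℝ} {a : ℝ} (ha : 0 < a)
    (h : (fun τ => f τ - a * τ) =O[𝓝[≠] 0] fun τ => τ ^ 2) : ∀ᶠ τ in 𝓝[>] 0, 0 < f τ := by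
  obtain ⟨C, hC⟩ := h.bound
  have hC' := hC.filter_mono (nhdsWithin_mono 0 fun x (hx : x ∈ Set.Ioi 0) => hx.ne')
  have hsm : ∀ᶠ τ : ℝ in 𝓝[>] 0, C * τ < a := by
    refine nhdsWithin_le_nhds (ContinuousAt.eventually_lt (by fun_prop) continuousAt_const ?_)
    simpa using ha
  filter_upwards [hC', hsm, self_mem_nhdsWithin] with τ h1 h2 h3
  have h3' : 0 < τ := h3
  rw [Real.norm_eq_abs, Real.norm_of_nonneg (by positivity)] at h1
  nlinarith [(abs_le.1 h1).1]

theorem eventually_pos_of_isBigO_large {f : ℝ → ℝ} {a : ℝ} (ha : 0 < a)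
    (h : (fun τ => f τ - a) =O[atTop] fun τ => τ⁻¹) : ∀ᶠ τ in atTop, 0 < f τ :=
  (tendsto_sub_nhds_zero_iff.1 (h.trans_tendsto tendsto_inv_atTop_zero)).eventually_const_lt ha

end LargeWavenumber

/-! ### Gaps between frequencies on one branch. -/

section ModeGap

variable {N : ℝ} {k : Freq} {μ : Plane} {σ : ℝ} {j l : ℤ}

/-- `w^σ_l(μ) - w^σ_j(μ)`. -/
def modeGap (N : ℝ) (k : Freq) (σ : ℝ) (j l : ℤ) (μ : Plane) : ℝ :=
  (l - j) * Omega N (vec k) + σ * (Omega N (wv k μ l) - Omega N (wv k μ j))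

theorem freqW_sub (hk0 : 0 < k 0) :
    freqW N k μ σ l - freqW N k μ σ j = modeGap N k σ j l μ := by
  rw [freqW_eq, freqW_eq, transport_eq N hk0, transport_eq N hk0, modeGap]
  ring

theorem le_abs_modeGap (hN : 0 < N) (hk0 : 0 < k 0) (hσ : |σ| = 1) :
    |(l : ℝ) - j| * Omega N (vec k) - 2 * N ≤ |modeGap N k σ j l μ| := by
  have h1 : |((l : ℝ) - j) * Omega N (vec k)| = |(l : ℝ) - j| * Omega N (vec k) := by
    rw [abs_mul, abs_of_pos (Omega_vec_pos hN hk0)]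
  have h2 : |σ * (Omega N (wv k μ l) - Omega N (wv k μ j))| ≤ 2 * N := by
    rw [abs_mul, hσ, one_mul]
    refine (abs_sub _ _).trans ?_
    linarith [abs_Omega_le hN (wv k μ l), abs_Omega_le hN (wv k μ j)]
  have h3 := abs_sub_abs_le_abs_add (((l : ℝ) - j) * Omega N (vec k))
    (σ * (Omega N (wv k μ l) - Omega N (wv k μ j)))
  rw [modeGap]
  linarith

theorem finite_mode_set (hN : 0 < N) (hk0 : 0 < k 0) (j : ℤ) (M : ℝ) :
    {l : ℤ | |(l : ℝ) - j| * Omega N (vec k) ≤ M}.Finite := by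
  have hΩ := Omega_vec_pos hN hk0
  refine (finite_abs_le (M / Omega N (vec k) + |(j : ℝ)|)).subset fun l hl => ?_
  have hl' : |(l : ℝ) - j| * Omega N (vec k) ≤ M := hl
  rw [← le_div_iff₀ hΩ] at hl'
  have := abs_sub_abs_le_abs_sub (l : ℝ) j
  change |(l : ℝ)| ≤ _
  linarith

/-- A gap can vanish only if |l - j|Ω(k) ≤ 2N. This is a finite set of l independent of μ, so the
quantifier over l can be moved inside the filter. -/
theorem eventually_forall_modeGap_ne {α : Type*} {F : Filter α} {f : α → Plane} (hN : 0 < N)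
    (hk0 : 0 < k 0) (hσ : |σ| = 1)
    (h : ∀ l ≠ j, ∀ᶠ a in F, modeGap N k σ j l (f a) ≠ 0) :
    ∀ᶠ a in F, ∀ l ≠ j, modeGap N k σ j l (f a) ≠ 0 := by
  have hfin := finite_mode_set hN hk0 j (2 * N)
  have h1 := (eventually_all_finite hfin).2 fun l _ =>
    (if hl : l = j then Eventually.of_forall fun _ h => absurd hl h
      else (h l hl).mono fun _ h _ => h :
        ∀ᶠ a in F, l ≠ j → modeGap N k σ j l (f a) ≠ 0)
  filter_upwards [h1] with a ha l hl h0
  refine ha l ?_ hl h0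
  have := le_abs_modeGap (l := l) (j := j) (μ := f a) hN hk0 hσ
  rw [h0, abs_zero] at this
  change _ ≤ _
  linarith

theorem exists_pos_le_abs_modeGap (hN : 0 < N) (hk0 : 0 < k 0) (hσ : |σ| = 1)
    (h : ∀ l ≠ j, modeGap N k σ j l μ ≠ 0) :
    ∃ α > 0, ∀ l ≠ j, α ≤ |modeGap N k σ j l μ| := by
  obtain ⟨α, hα, h'⟩ := exists_pos_forall_le
    (f := fun l => if l = j then 1 else |modeGap N k σ j l μ|) (fun l => by
      by_cases hl : l = j
      · simp [hl]
      · simpa [hl] using h l hl) one_pos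
    ((finite_mode_set hN hk0 j (2 * N + 1)).subset fun l hl => by
      by_cases hlj : l = j
      · simp [hlj] at hl
      · have hl' : |modeGap N k σ j l μ| < 1 := by simpa [hlj] using hl
        have := le_abs_modeGap (l := l) (j := j) (μ := μ) hN hk0 hσ
        change |(l : ℝ) - j| * Omega N (vec k) ≤ 2 * N + 1
        linarith)
  refine ⟨α, hα, fun l hl => ?_⟩
  simpa [hl] using h' l

theorem exists_modeGap_eq_zero (hN : 0 < N) (hk0 : 0 < k 0) (hμ : μ ∈ exceptionalSet N k) :
    (∃ l ≠ 0, modeGap N k 1 0 l μ = 0) ∨ ∃ l ≠ 1, modeGap N k (-1) 1 l μ = 0 := by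
  by_contra! h
  obtain ⟨α, hα, h1⟩ := exists_pos_le_abs_modeGap hN hk0 abs_one h.1
  obtain ⟨β, hβ, h2⟩ := exists_pos_le_abs_modeGap hN hk0 (by simp) h.2
  refine hμ.2 ⟨min α β, lt_min hα hβ, fun l hl => ?_, fun l hl => ?_⟩
  · rw [freqW_sub hk0]
    exact (min_le_left _ _).trans (h1 l hl)
  · rw [freqW_sub hk0]
    exact (min_le_right _ _).trans (h2 l hl)

end ModeGap

/-! ### Nonvanishing of the gaps near the origin. -/

section NearOrigin

variable {N : ℝ} {k : Freq} {μ : Plane} {l : ℤ}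

theorem continuousAt_Omega (N : ℝ) {v : Plane} (hv : v ≠ 0) : ContinuousAt (Omega N) v := by
  unfold Omega
  have : ‖v‖ ≠ 0 := norm_ne_zero_iff.2 hv
  fun_prop (disch := assumption)

theorem Omega_vec_zsmul (N : ℝ) (k : Freq) (hl : l ≠ 0) :
    Omega N (vec (l • k)) = (l.sign : ℝ) * Omega N (vec k) := by
  rw [vec_smul]
  rcases lt_or_gt_of_ne hl with h | h
  · rw [Omega_smul_of_neg N (by exact_mod_cast h), Int.sign_eq_neg_one_of_neg h]
    simp
  · rw [Omega_smul_of_pos N (by exact_mod_cast h), Int.sign_eq_one_of_pos h]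
    simp

theorem tendsto_Omega_wv (N : ℝ) (hk0 : 0 < k 0) (hl : l ≠ 0) :
    Tendsto (fun μ => Omega N (wv k μ l)) (𝓝 0) (𝓝 ((l.sign : ℝ) * Omega N (vec k))) := by
  have hv : vec (l • k) ≠ 0 := by
    rw [vec_smul]
    exact smul_ne_zero (by exact_mod_cast hl) (vec_ne_zero hk0)
  have h : Tendsto (fun μ => wv k μ l) (𝓝 0) (𝓝 (vec (l • k))) := by
    have h := (continuous_const_add (vec (l • k))).tendsto 0
    rwa [add_zero] at h
  have := (continuousAt_Omega N hv).tendsto.comp h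
  rwa [Omega_vec_zsmul N k hl] at this

/-- Ω is discontinuous at 0, but on the resonant set it equals Ω(k) - Ω(k + μ), which is small. -/
theorem tendsto_Omega_resonant (hN : 0 < N) (hk0 : 0 < k 0) :
    Tendsto (Omega N) (𝓝[resonantSet N k] 0) (𝓝 0) := by
  have h : Tendsto (fun μ : Plane => 2 * N * ‖μ‖ / ‖vec k‖) (𝓝 0) (𝓝 0) := by
    have : Continuous fun μ : Plane => 2 * N * ‖μ‖ / ‖vec k‖ := by fun_prop
    simpa using this.tendsto 0
  refine squeeze_zero_norm' ?_ (h.mono_left nhdsWithin_le_nhds)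
  filter_upwards [self_mem_nhdsWithin] with μ hμ
  exact abs_Omega_le_of_resonant hN hk0 hμ

/-- The gap tends to (l + sgn l)Ω(k), which is nonzero for every l ≠ 0. -/
theorem eventually_modeGap_plus_ne (hN : 0 < N) (hk0 : 0 < k 0) (hl : l ≠ 0) :
    ∀ᶠ μ in 𝓝[resonantSet N k] 0, modeGap N k 1 0 l μ ≠ 0 := by
  have h := (((tendsto_Omega_wv N hk0 hl).mono_left
    (nhdsWithin_le_nhds (s := resonantSet N k))).sub (tendsto_Omega_resonant hN hk0)).const_add
      ((l : ℝ) * Omega N (vec k))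
  have hne : (l : ℝ) * Omega N (vec k) + ((l.sign : ℝ) * Omega N (vec k) - 0) ≠ 0 := by
    rw [sub_zero, ← add_mul]
    refine mul_ne_zero ?_ (Omega_vec_pos hN hk0).ne'
    rcases lt_or_gt_of_ne hl with h | h
    · rw [Int.sign_eq_neg_one_of_neg h]
      exact_mod_cast (by lia : l + -1 ≠ 0)
    · rw [Int.sign_eq_one_of_pos h]
      exact_mod_cast (by lia : l + 1 ≠ 0)
  filter_upwards [h.eventually_ne hne] with μ hμ
  simpa [modeGap, wv_zero] using hμ

theorem modeGap_minus_zero (hμ : μ ∈ resonantSet N k) :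
    modeGap N k (-1) 1 0 μ = -2 * Omega N μ := by
  rw [modeGap, wv_zero, wv_one]
  push_cast
  linarith [resonance_eq hμ]

/-- A zero of this gap forces μ₁ = 0; resonance then gives |k + μ| = |k|, that is μ₂(2n + μ₂) = 0,
impossible for 0 < |μ| < 2n. -/
theorem eventually_modeGap_minus_zero_ne (hN : 0 < N) (hk0 : 0 < k 0) (hk1 : 0 < k 1) :
    ∀ᶠ μ in 𝓝[resonantSet N k \ {0}] 0, modeGap N k (-1) 1 0 μ ≠ 0 := by
  have hk : (0 : ℝ) < k 0 := by exact_mod_cast hk0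
  have hk' : (0 : ℝ) < k 1 := by exact_mod_cast hk1
  have hsmall : ∀ᶠ μ : Plane in 𝓝 0, ‖μ‖ < 2 * k 1 :=
    continuous_norm.continuousAt.eventually_lt continuousAt_const (by simpa using hk')
  filter_upwards [nhdsWithin_le_nhds hsmall, self_mem_nhdsWithin] with μ hs ⟨hμ, hμ0⟩ h
  rw [modeGap_minus_zero hμ] at h
  have hΩ : Omega N μ = 0 := by linarith
  have hn : ‖μ‖ ≠ 0 := norm_ne_zero_iff.2 hμ0
  have h0 : μ 0 = 0 := by
    rw [Omega, div_eq_zero_iff, mul_eq_zero] at hΩ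
    rcases hΩ with (h | h) | h
    · exact absurd h hN.ne'
    · exact h
    · exact absurd h hn
  have hr := mem_resonantSet_iff.1 hμ
  have hK := norm_vec_pos hk0
  have hv : ‖vec k + μ‖ ≠ 0 := by
    intro hv
    rw [hΩ, Omega, hv, div_zero] at hr
    linarith [Omega_vec_pos hN hk0]
  have he : ‖vec k + μ‖ = ‖vec k‖ := by
    rw [hΩ, Omega, Omega, PiLp.add_apply, vec_zero_apply, h0] at hr
    field_simp at hr
    exact (mul_left_cancel₀ (mul_pos hN hk).ne' (by linarith)).symm
  have hsq : ‖vec k + μ‖ ^ 2 = ‖vec k‖ ^ 2 := by rw [he]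
  rw [norm_sq_plane, norm_vec_sq] at hsq
  simp only [PiLp.add_apply, vec_zero_apply, vec_one_apply, h0] at hsq
  have hy : μ 1 * (2 * k 1 + μ 1) = 0 := by linarith
  have hle := abs_apply_le_norm μ 1
  rcases mul_eq_zero.1 hy with h1 | h1
  · refine hn ?_
    rw [norm_plane, h0, h1]
    simp
  · have := (abs_le.1 hle).1
    linarith

theorem sq_ne_two_mul_sq {a b : ℤ} (hb : 0 < b) (ha : 0 < a) : (a : ℝ) ^ 2 ≠ 2 * (b : ℝ) ^ 2 := by
  intro h
  have hb' : (0 : ℝ) < b := by exact_mod_cast hb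
  have ha' : (0 : ℝ) < a := by exact_mod_cast ha
  refine irrational_sqrt_two.ne_rat (a / b) ?_
  rw [Real.sqrt_eq_iff_mul_self_eq_of_pos (by push_cast; positivity)]
  push_cast
  field_simp
  linarith

/-- The algebraic consequence of the two equations
`Ω(k + μ) = Ω(k) - Ω(μ)` and `Ω(k - μ) = Ω(k) + Ω(μ)`. -/
theorem double_resonance_identity {c s K r κ m x : ℝ} (hr : r ≠ 0) (hm : m = c * K)
    (hx : x = s * r) (h1 : (c - s) ^ 2 * (K ^ 2 + 2 * κ + r ^ 2) = (m + x) ^ 2)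
    (h2 : (c + s) ^ 2 * (K ^ 2 - 2 * κ + r ^ 2) = (m - x) ^ 2) :
    c ^ 4 * (K ^ 2 + r ^ 2 + K * r) ^ 2 + K ^ 2 * (c ^ 2 + s ^ 2) ^ 2 * (κ / r) ^ 2 -
      4 * c ^ 2 * (c ^ 2 + s ^ 2) * (κ / r) ^ 2 * (K ^ 2 + r ^ 2 + K * r) = 0 := by
  subst hm hx
  set Q := K ^ 2 + r ^ 2 + K * r with hQ
  -- Sum and difference of the two squared equations. Substituting csQ = (c² + s²)κ in the first
  -- leaves terms carrying r² or κ² only, so division by r² has a nondegenerate limit at the origin.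
  have e1 : c ^ 2 * r ^ 2 + s ^ 2 * K ^ 2 = 4 * c * s * κ := by linear_combination (h1 + h2) / 2
  have e2 : c * s * Q = (c ^ 2 + s ^ 2) * κ := by
    rw [hQ]
    linear_combination (h2 - h1) / 4
  have e3 : c ^ 4 * Q ^ 2 * r ^ 2 + K ^ 2 * (c ^ 2 + s ^ 2) ^ 2 * κ ^ 2 -
      4 * c ^ 2 * (c ^ 2 + s ^ 2) * κ ^ 2 * Q = 0 := by
    linear_combination c ^ 2 * Q ^ 2 * e1 - (K ^ 2 * (c * s * Q + (c ^ 2 + s ^ 2) * κ) -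
      4 * c ^ 2 * Q * κ) * e2
  field_simp
  linear_combination e3

/-- Here the limit of the gap is zero, so a finer argument is needed. A zero together with resonance
yields Ω(k ± μ) = Ω(k) ∓ Ω(μ), and squaring and eliminating gives an identity whose left side tends
to c⁴K²(m² - 2n²), where c is m/|k|. Integrality of m and n makes this nonzero. -/
theorem eventually_modeGap_minus_neg_one_ne (hN : 0 < N) (hk0 : 0 < k 0) (hk1 : 0 < k 1) :
    ∀ᶠ μ in 𝓝[resonantSet N k \ {0}] 0, modeGap N k (-1) 1 (-1) μ ≠ 0 := by
  have hk : (0 : ℝ) < k 0 := by exact_mod_cast hk0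
  have hK := norm_vec_pos hk0
  have hKsq := norm_vec_sq k
  set K := ‖vec k‖ with hKdef
  set c : ℝ := k 0 / K with hc
  have hc0 : 0 < c := by positivity
  -- The variables are |μ|, s = μ₁/|μ| and sμ₂/|μ|. The ratio μ₂/|μ| itself may approach either ±1,
  -- so it enters only through its square 1 - s² and through the product, which tends to 0.
  set P : ℝ × ℝ × ℝ → ℝ := fun p =>
    c ^ 4 * (K ^ 2 + p.1 ^ 2 + K * p.1) ^ 2 + K ^ 2 * (c ^ 2 + p.2.1 ^ 2) ^ 2 *
      ((k 0 * p.2.1) ^ 2 + 2 * k 0 * k 1 * p.2.2 + k 1 ^ 2 * (1 - p.2.1 ^ 2)) -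
    4 * c ^ 2 * (c ^ 2 + p.2.1 ^ 2) *
      ((k 0 * p.2.1) ^ 2 + 2 * k 0 * k 1 * p.2.2 + k 1 ^ 2 * (1 - p.2.1 ^ 2)) *
      (K ^ 2 + p.1 ^ 2 + K * p.1) with hP
  have hP0 : P 0 ≠ 0 := by
    have : P 0 = c ^ 4 * K ^ 2 * ((k 0 : ℝ) ^ 2 - 2 * (k 1 : ℝ) ^ 2) := by
      simp only [hP, Prod.fst_zero, Prod.snd_zero]
      linear_combination c ^ 4 * K ^ 2 * hKsq
    rw [this]
    exact mul_ne_zero (by positivity) (sub_ne_zero.2 (sq_ne_two_mul_sq hk1 hk0))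
  have hPc : Continuous P := by fun_prop
  have hs : Tendsto (fun μ : Plane => μ 0 / ‖μ‖) (𝓝[resonantSet N k \ {0}] 0) (𝓝 0) := by
    have h := ((tendsto_Omega_resonant hN hk0).mono_left
      (nhdsWithin_mono 0 (Set.sdiff_subset (t := {0})))).div_const N
    rw [zero_div] at h
    refine h.congr fun μ => ?_
    rw [Omega]
    field_simp
  have hsy : Tendsto (fun μ : Plane => μ 0 / ‖μ‖ * (μ 1 / ‖μ‖))
      (𝓝[resonantSet N k \ {0}] 0) (𝓝 0) := by
    refine squeeze_zero_norm (fun μ => ?_) (tendsto_norm_zero.comp hs)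
    rw [norm_mul]
    refine mul_le_of_le_one_right (norm_nonneg _) ?_
    rw [norm_div, norm_norm]
    exact div_le_one_of_le₀ (abs_apply_le_norm μ 1) (norm_nonneg _)
  have hn : Tendsto (fun μ : Plane => ‖μ‖) (𝓝[resonantSet N k \ {0}] 0) (𝓝 0) :=
    tendsto_norm_zero.mono_left nhdsWithin_le_nhds
  have ht := hPc.continuousAt.tendsto.comp (hn.prodMk_nhds (hs.prodMk_nhds hsy))
  filter_upwards [ht.eventually_ne hP0, self_mem_nhdsWithin] with μ hPμ ⟨hμ, hμ0⟩ h
  refine hPμ ?_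
  have hr : ‖μ‖ ≠ 0 := norm_ne_zero_iff.2 hμ0
  have hres := mem_resonantSet_iff.1 hμ
  have hΩk : Omega N (vec k) = N * c := by rw [Omega, vec_zero_apply, mul_div_assoc]
  have hΩμ : Omega N μ = N * (μ 0 / ‖μ‖) := by rw [Omega, mul_div_assoc]
  have e1 : Omega N (vec k + μ) = N * (c - μ 0 / ‖μ‖) := by rw [mul_sub, ← hΩk, ← hΩμ]; linarith
  have e2 : Omega N (vec k - μ) = N * (c + μ 0 / ‖μ‖) := by
    have hneg : wv k μ (-1) = -(vec k - μ) := by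
      rw [wv, vec_smul, Int.cast_neg, Int.cast_one, neg_one_smul]
      abel
    rw [modeGap, hneg, Omega_neg, wv_one] at h
    push_cast at h
    rw [mul_add, ← hΩk, ← hΩμ]
    linarith
  have hκ : inner ℝ (vec k) μ = k 0 * μ 0 + k 1 * μ 1 := inner_plane _ _
  have hsqeq : ∀ v : Plane, ∀ a : ℝ, Omega N v = N * a → a ^ 2 * ‖v‖ ^ 2 = (v 0) ^ 2 := by
    intro v a h
    rcases eq_or_ne v 0 with rfl | hv
    · simp
    · have hv' := norm_ne_zero_iff.2 hv
      rw [Omega, mul_div_assoc] at h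
      rw [← mul_left_cancel₀ hN.ne' h]
      field_simp
  have q1 := hsqeq _ _ e1
  have q2 := hsqeq _ _ e2
  rw [norm_add_sq_real, ← hKdef, hκ] at q1
  rw [norm_sub_sq_real, ← hKdef, hκ] at q2
  have key := double_resonance_identity hr (m := k 0) (x := μ 0) (by rw [hc]; field_simp)
    (by field_simp) q1 q2
  have hsq1 : (μ 0 / ‖μ‖) ^ 2 + (μ 1 / ‖μ‖) ^ 2 = 1 := by
    have := norm_sq_plane μ
    field_simp
    linarith
  have hH : ((k 0 * μ 0 + k 1 * μ 1) / ‖μ‖) ^ 2 = (k 0 * (μ 0 / ‖μ‖)) ^ 2 +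
      2 * k 0 * k 1 * (μ 0 / ‖μ‖ * (μ 1 / ‖μ‖)) + k 1 ^ 2 * (1 - (μ 0 / ‖μ‖) ^ 2) := by
    rw [add_div, mul_div_assoc, mul_div_assoc]
    linear_combination (k 1 : ℝ) ^ 2 * hsq1
  rw [hH] at key
  exact key

/-- For l ≠ 0 the limit is (l - sgn l)Ω(k), nonzero unless l = ±1; with l = 1 excluded, only l = 0
and l = -1 need separate treatment. -/
theorem eventually_modeGap_minus_ne (hN : 0 < N) (hk0 : 0 < k 0) (hk1 : 0 < k 1) (hl : l ≠ 1) :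
    ∀ᶠ μ in 𝓝[resonantSet N k \ {0}] 0, modeGap N k (-1) 1 l μ ≠ 0 := by
  rcases eq_or_ne l 0 with rfl | hl0
  · exact eventually_modeGap_minus_zero_ne hN hk0 hk1
  rcases eq_or_ne l (-1) with rfl | hl1
  · exact eventually_modeGap_minus_neg_one_ne hN hk0 hk1
  have h := ((tendsto_Omega_wv N hk0 hl0).sub (tendsto_Omega_wv N hk0 one_ne_zero)).const_sub
    (((l : ℝ) - 1) * Omega N (vec k))
  have hne : ((l : ℝ) - 1) * Omega N (vec k) - ((l.sign : ℝ) * Omega N (vec k) -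
      ((1 : ℤ).sign : ℝ) * Omega N (vec k)) ≠ 0 := by
    rw [← sub_mul, ← sub_mul]
    refine mul_ne_zero ?_ (Omega_vec_pos hN hk0).ne'
    rcases lt_or_gt_of_ne hl0 with h | h
    · rw [Int.sign_eq_neg_one_of_neg h, Int.sign_one]
      exact_mod_cast (by lia : l - 1 - (-1 - 1) ≠ 0)
    · rw [Int.sign_eq_one_of_pos h, Int.sign_one]
      exact_mod_cast (by lia : l - 1 - (1 - 1) ≠ 0)
  filter_upwards [nhdsWithin_le_nhds (h.eventually_ne hne)] with μ hμ
  intro h0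
  refine hμ ?_
  rw [modeGap] at h0
  push_cast at h0
  linarith

/-- The two pairs `(σ, j)` for which `w^σ_j` is the double eigenvalue. -/
def IsCriticalMode (σ : ℝ) (j : ℤ) : Prop := (σ = 1 ∧ j = 0) ∨ (σ = -1 ∧ j = 1)

theorem IsCriticalMode.abs_eq {σ : ℝ} {j : ℤ} (h : IsCriticalMode σ j) : |σ| = 1 := by
  rcases h with ⟨rfl, -⟩ | ⟨rfl, -⟩ <;> simp

theorem eventually_modeGap_ne {σ : ℝ} {j : ℤ} (hN : 0 < N) (hk0 : 0 < k 0) (hk1 : 0 < k 1)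
    (h : IsCriticalMode σ j) (hl : l ≠ j) :
    ∀ᶠ μ in 𝓝[resonantSet N k \ {0}] 0, modeGap N k σ j l μ ≠ 0 := by
  rcases h with ⟨rfl, rfl⟩ | ⟨rfl, rfl⟩
  · exact nhdsWithin_mono 0 Set.sdiff_subset (eventually_modeGap_plus_ne hN hk0 hl)
  · exact eventually_modeGap_minus_ne hN hk0 hk1 hl

end NearOrigin

/-! ### Analyticity of the resonant curve and discreteness of the exceptional set. -/

section AnalyticCurve

open scoped ContDiff

variable {N : ℝ} {k : Freq} {μ : Plane} {σ y : ℝ} {j l : ℤ}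

theorem contDiffAt_Omega (N : ℝ) {v : Plane} (hv : v ≠ 0) : ContDiffAt ℝ ω (Omega N) v := by
  have h0 : ContDiffAt ℝ ω (fun v : Plane => v 0) v := contDiffAt_euclidean.1 contDiffAt_id 0
  exact (contDiffAt_const.mul h0).div (contDiffAt_norm ℝ hv) (norm_ne_zero_iff.2 hv)

theorem contDiffAt_modeGap (hl : wv k μ l ≠ 0) (hj : wv k μ j ≠ 0) :
    ContDiffAt ℝ ω (modeGap N k σ j l) μ := by
  have h : ∀ i, wv k μ i ≠ 0 → ContDiffAt ℝ ω (fun μ => Omega N (wv k μ i)) μ := fun i hi =>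
    (contDiffAt_Omega N hi).comp μ (contDiffAt_const.add contDiffAt_id)
  exact contDiffAt_const.add (contDiffAt_const.mul ((h l hl).sub (h j hj)))

theorem contDiffAt_pair {f : ℝ → ℝ} (hf : ContDiffAt ℝ ω f y) :
    ContDiffAt ℝ ω (fun y => (!₂[f y, y] : Plane)) y := by
  refine contDiffAt_euclidean.2 fun i => ?_
  fin_cases i
  · exact hf
  · exact contDiffAt_id

theorem eta_pair (μ : Plane) : !₂[μ 0, μ 1] = μ := by
  ext i
  fin_cases i <;> rfl

theorem isInvertible_of_apply_one_ne {f : ℝ →L[ℝ] ℝ} (h : f 1 ≠ 0) : f.IsInvertible :=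
  ⟨ContinuousLinearEquiv.unitsEquivAut ℝ (Units.mk0 _ h), by ext; simp⟩

theorem add_ne_zero_of_resonant (hN : 0 < N) (hk0 : 0 < k 0) (hμ : μ ∈ resonantSet N k)
    (hμ0 : μ ≠ 0) : vec k + μ ≠ 0 := by
  have := wv_ne_zero hN hk0 hμ hμ0 1
  rwa [wv_one] at this

/-- The two contributions to the derivative are proportional to y² and (n + y)², which cannot both
vanish since n > 0. This covers the heights 0 and -n as well, provided neither point is the origin.
-/
theorem hasDerivAt_resonanceSum_left (hN : 0 < N) (hk1 : 0 < k 1) {x : ℝ}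
    (h1 : (!₂[x, y] : Plane) ≠ 0) (h2 : vec k + !₂[x, y] ≠ 0) :
    ∃ d > 0, HasDerivAt (fun x => resonanceSum N k x y) d x := by
  have hk : (0 : ℝ) < k 1 := by exact_mod_cast hk1
  rw [vec_add_pair] at h2
  have hsq : ∀ a b : ℝ, (!₂[a, b] : Plane) ≠ 0 → a ^ 2 + b ^ 2 ≠ 0 := fun a b h h0 => h (by
    have : ‖(!₂[a, b] : Plane)‖ ^ 2 = a ^ 2 + b ^ 2 := by simp [norm_sq_plane]
    rw [h0] at this
    exact norm_eq_zero.1 (pow_eq_zero_iff two_ne_zero |>.1 this))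
  have d1 := hasDerivAt_Omega_left N (hsq _ _ h1)
  have d2 := (hasDerivAt_Omega_left N (hsq _ _ h2)).comp_const_add (k 0 : ℝ) x
  refine ⟨_, ?_, d1.add d2⟩
  have p1 := norm_pos_iff.2 h1
  have p2 := norm_pos_iff.2 h2
  rcases eq_or_ne y 0 with rfl | hy
  · rw [add_zero] at p2 ⊢
    positivity
  · positivity

/-- Away from the origin the resonant set is locally the graph of an analytic function of the
ordinate. -/
theorem exists_analytic_graph (hN : 0 < N) (hk0 : 0 < k 0) (hk1 : 0 < k 1)
    (hμ : μ ∈ resonantSet N k) (hμ0 : μ ≠ 0) :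
    ∃ ψ : ℝ → ℝ, ContDiffAt ℝ ω ψ (μ 1) ∧ ψ (μ 1) = μ 0 ∧
      (∀ᶠ y in 𝓝 (μ 1), !₂[ψ y, y] ∈ resonantSet N k) ∧
      ∀ᶠ ν in 𝓝 μ, ν ∈ resonantSet N k → ψ (ν 1) = ν 0 := by
  have hμk := add_ne_zero_of_resonant hN hk0 hμ hμ0
  -- The coordinates are swapped because the implicit function expresses the second one, here the
  -- abscissa.
  set u : ℝ × ℝ := (μ 1, μ 0) with hu
  set f : ℝ × ℝ → ℝ := fun p => resonanceSum N k p.2 p.1 with hf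
  have hpair : ∀ a b : ℝ, ContDiff ℝ ω fun p : ℝ × ℝ => (!₂[a + p.2, b + p.1] : Plane) := by
    refine fun a b => contDiff_euclidean.2 fun i => ?_
    fin_cases i
    · exact contDiff_const.add contDiff_snd
    · exact contDiff_const.add contDiff_fst
  have cdf : ContDiffAt ℝ ω f u := by
    have h1 := (contDiffAt_Omega N (v := !₂[0 + u.2, 0 + u.1])
      (by simpa [hu, eta_pair] using hμ0)).comp u (hpair 0 0).contDiffAt
    have h2 := (contDiffAt_Omega N (v := !₂[(k 0 : ℝ) + u.2, (k 1 : ℝ) + u.1])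
      (by rwa [← vec_add_pair, hu, eta_pair])).comp u (hpair (k 0) (k 1)).contDiffAt
    have h3 := h1.add h2
    simp only [Function.comp_def, zero_add] at h3
    exact h3
  have pn : (ω : WithTop ℕ∞) ≠ 0 := by simp
  have if₂ : (fderiv ℝ f u ∘L .inr ℝ ℝ ℝ).IsInvertible := by
    obtain ⟨d, hd, hderiv⟩ := hasDerivAt_resonanceSum_left (N := N) (k := k) (x := μ 0) (y := μ 1)
      hN hk1 (by rwa [eta_pair]) (by rwa [eta_pair])
    have h1 := (cdf.differentiableAt pn).hasFDerivAt.comp_hasDerivAt (μ 0)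
      ((hasDerivAt_const (μ 0) (μ 1)).prodMk (hasDerivAt_id (μ 0)))
    have h2 := h1.unique hderiv
    refine isInvertible_of_apply_one_ne ?_
    change fderiv ℝ f u (0, 1) ≠ 0
    rw [h2]
    exact hd.ne'
  have hfu : f u = Omega N (vec k) := pair_mem_resonantSet_iff.1 (by rwa [eta_pair])
  refine ⟨cdf.implicitFunction pn if₂, cdf.contDiffAt_implicitFunction pn if₂,
    cdf.implicitFunction_apply_self pn if₂, ?_, ?_⟩
  · filter_upwards [cdf.eventually_apply_implicitFunction pn if₂] with y hy
    exact pair_mem_resonantSet_iff.2 (hy.trans hfu)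
  · have hc : Tendsto (fun ν : Plane => (ν 1, ν 0)) (𝓝 μ) (𝓝 u) := by
      have : Continuous fun ν : Plane => (ν 1, ν 0) := by fun_prop
      exact this.tendsto μ
    filter_upwards [hc.eventually (cdf.eventually_apply_eq_iff_implicitFunction pn if₂)]
      with ν hν hR
    refine hν.1 ?_
    rw [hfu]
    exact pair_mem_resonantSet_iff.1 (by rwa [eta_pair])

theorem resonantPoint_ne_zero (hy : y ≠ 0) : resonantPoint N k y ≠ 0 := fun h =>
  hy (congrArg (fun v : Plane => v 1) h)

theorem contDiffAt_resonantPoint (hN : 0 < N) (hk0 : 0 < k 0) (hk1 : 0 < k 1) (hy : y ≠ 0)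
    (hy' : y ≠ -(k 1 : ℝ)) : ContDiffAt ℝ ω (resonantPoint N k) y := by
  obtain ⟨ψ, hψ, -, hψR, -⟩ := exists_analytic_graph hN hk0 hk1
    (resonantPoint_mem (k := k) hN hk0 hy hy') (resonantPoint_ne_zero hy)
  change ContDiffAt ℝ ω ψ y at hψ
  change ∀ᶠ y in 𝓝 y, _ at hψR
  refine (contDiffAt_pair hψ).congr_of_eventuallyEq ?_
  filter_upwards [hψR, eventually_ne_nhds hy, eventually_ne_nhds hy'] with z hz h1 h2
  rw [resonantPoint, (mem_resonantSet_iff_eq_abscissa hN hk0 h1 h2 _).1 hz]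

theorem analyticAt_modeGap_comp {f : ℝ → Plane} (hN : 0 < N) (hk0 : 0 < k 0)
    (hμ : f y ∈ resonantSet N k) (hμ0 : f y ≠ 0) (hf : ContDiffAt ℝ ω f y) :
    AnalyticAt ℝ (fun y => modeGap N k σ j l (f y)) y :=
  (ContDiffAt.comp y (contDiffAt_modeGap (wv_ne_zero hN hk0 hμ hμ0 l)
    (wv_ne_zero hN hk0 hμ hμ0 j)) hf).analyticAt

theorem analyticOnNhd_modeGap_resonantPoint (hN : 0 < N) (hk0 : 0 < k 0) (hk1 : 0 < k 1)
    {U : Set ℝ} (hU : ∀ y ∈ U, y ≠ 0 ∧ y ≠ -(k 1 : ℝ)) :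
    AnalyticOnNhd ℝ (fun y => modeGap N k σ j l (resonantPoint N k y)) U := fun y hy =>
  analyticAt_modeGap_comp hN hk0 (resonantPoint_mem hN hk0 (hU y hy).1 (hU y hy).2)
    (resonantPoint_ne_zero (hU y hy).1)
    (contDiffAt_resonantPoint hN hk0 hk1 (hU y hy).1 (hU y hy).2)

theorem tendsto_resonantPoint_zero (hN : 0 < N) (hk0 : 0 < k 0) (hk1 : 0 < k 1) :
    Tendsto (resonantPoint N k) (𝓝[≠] 0) (𝓝[resonantSet N k \ {0}] 0) := by
  have hk : (0 : ℝ) < k 1 := by exact_mod_cast hk1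
  refine tendsto_nhdsWithin_iff.2 ⟨?_, ?_⟩
  · have hy : Tendsto (fun y : ℝ => y) (𝓝[≠] 0) (𝓝 0) := tendsto_id.mono_left nhdsWithin_le_nhds
    have hx : Tendsto (resonantAbscissa N k) (𝓝[≠] 0) (𝓝 0) := by
      refine squeeze_zero_norm' (eventually_abs_abscissa_le hN hk0 hk1) ?_
      have := (hy.pow 2).const_mul (2 * (2 / ‖vec k‖))
      simpa using this
    have hc : Continuous fun p : ℝ × ℝ => (!₂[p.1, p.2] : Plane) := by fun_prop
    have := (hc.tendsto (0, 0)).comp (hx.prodMk_nhds hy)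
    rwa [show (!₂[((0 : ℝ), (0 : ℝ)).1, ((0 : ℝ), (0 : ℝ)).2] : Plane) = 0 by
      ext i; fin_cases i <;> rfl] at this
  · filter_upwards [self_mem_nhdsWithin, nhdsWithin_le_nhds
      (eventually_ne_nhds (by linarith : (0 : ℝ) ≠ -(k 1 : ℝ)))] with y hy hy'
    exact ⟨resonantPoint_mem hN hk0 hy hy', resonantPoint_ne_zero hy⟩

/-- A zero would require |l - j|Ω(k) = |Ω(lk + μ) - Ω(jk + μ)|, while the right side is at most 2N|l
- j||k|/|jk + μ|. The factor |l - j| cancels, so one threshold serves every l. -/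
theorem modeGap_ne_zero_of_large (hN : 0 < N) (hk0 : 0 < k 0) (hσ : |σ| = 1) (hl : l ≠ j)
    (hμ : 2 * N * ‖vec k‖ < Omega N (vec k) * ‖wv k μ j‖) : modeGap N k σ j l μ ≠ 0 := by
  have hΩ := Omega_vec_pos hN hk0
  have hK := norm_vec_pos hk0
  have hj : 0 < ‖wv k μ j‖ := by
    by_contra! h
    have := mul_nonpos_of_nonneg_of_nonpos hΩ.le h
    nlinarith
  intro h0
  have h1 := abs_Omega_sub_le hN (wv k μ l) (norm_pos_iff.1 hj)
  have h2 : wv k μ l - wv k μ j = ((l : ℝ) - j) • vec k := by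
    rw [wv, wv, vec_smul, vec_smul, sub_smul]
    abel
  have hlj : 0 < |(l : ℝ) - j| := abs_pos.2 (sub_ne_zero.2 (by exact_mod_cast hl))
  have h3 : |(l : ℝ) - j| * Omega N (vec k) = |Omega N (wv k μ l) - Omega N (wv k μ j)| := by
    rw [modeGap, add_eq_zero_iff_eq_neg] at h0
    have := congrArg abs h0
    rwa [abs_mul, abs_neg, abs_mul, hσ, one_mul, abs_of_pos hΩ] at this
  rw [← h3, h2, norm_smul, Real.norm_eq_abs, le_div_iff₀ hj] at h1
  have h4 := mul_lt_mul_of_pos_left hμ hlj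
  linarith

/-- The identity theorem spreads a local zero over the whole interval of ordinates containing y. The
intervals y > 0 and -n < y < 0 have 0 as an endpoint and contradict the behaviour at the origin; y <
-n contradicts the behaviour at infinity. -/
theorem not_eventually_modeGap_eq_zero (hN : 0 < N) (hk0 : 0 < k 0) (hk1 : 0 < k 1)
    (hσ : IsCriticalMode σ j) (hl : l ≠ j) (hy : y ≠ 0) (hy' : y ≠ -(k 1 : ℝ)) :
    ¬ ∀ᶠ z in 𝓝 y, modeGap N k σ j l (resonantPoint N k z) = 0 := by
  intro h
  have hk : (0 : ℝ) < k 1 := by exact_mod_cast hk1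
  have hEq : ∀ U : Set ℝ, IsPreconnected U → (∀ y ∈ U, y ≠ 0 ∧ y ≠ -(k 1 : ℝ)) → y ∈ U →
      ∀ z ∈ U, modeGap N k σ j l (resonantPoint N k z) = 0 := fun U hU hU' hyU =>
    (analyticOnNhd_modeGap_resonantPoint hN hk0 hk1 hU')
      |>.eqOn_zero_of_preconnected_of_eventuallyEq_zero
      hU hyU h
  have hzero := (tendsto_resonantPoint_zero hN hk0 hk1).eventually
    (eventually_modeGap_ne hN hk0 hk1 hσ hl)
  rcases lt_or_gt_of_ne hy with hneg | hpos
  · rcases lt_or_gt_of_ne hy' with hlt | hgt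
    · have hz := hEq (Set.Iio (-(k 1 : ℝ))) isPreconnected_Iio
        (fun z (hz : z < -(k 1 : ℝ)) => ⟨by linarith, hz.ne⟩) hlt
      have hΩ := Omega_vec_pos hN hk0
      have hlarge : Tendsto (fun z : ℝ => |(j : ℝ) * k 1 + z|) atBot atTop :=
        tendsto_abs_atBot_atTop.comp (tendsto_atBot_add_const_left _ _ tendsto_id)
      obtain ⟨z, hz1, hz2⟩ := ((hlarge.eventually_gt_atTop
        (2 * N * ‖vec k‖ / Omega N (vec k))).and (eventually_lt_atBot (-(k 1 : ℝ)))).exists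
      refine modeGap_ne_zero_of_large hN hk0 hσ.abs_eq hl ?_ (hz z hz2)
      rw [← div_lt_iff₀' hΩ]
      refine hz1.trans_le ?_
      have := abs_apply_le_norm (wv k (resonantPoint N k z) j) 1
      refine le_of_eq_of_le ?_ this
      rw [wv, vec_smul]
      rfl
    · have hz := hEq (Set.Ioo (-(k 1 : ℝ)) 0) isPreconnected_Ioo
        (fun z hz => ⟨hz.2.ne, hz.1.ne'⟩) ⟨hgt, hneg⟩
      have h1 : ∀ᶠ z : ℝ in 𝓝[<] 0, z ∈ Set.Ioo (-(k 1 : ℝ)) 0 :=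
        Ioo_mem_nhdsLT (by linarith)
      obtain ⟨z, hz1, hz2⟩ := ((hzero.filter_mono
        (nhdsWithin_mono 0 fun z (hz : z ∈ Set.Iio 0) => ne_of_lt hz)).and h1).exists
      exact hz1 (hz z hz2)
  · have hz := hEq (Set.Ioi 0) isPreconnected_Ioi
      (fun z (hz : 0 < z) => ⟨hz.ne', by linarith⟩) hpos
    obtain ⟨z, hz1, hz2⟩ := ((hzero.filter_mono
      (nhdsWithin_mono 0 fun z (hz : z ∈ Set.Ioi 0) => ne_of_gt hz)).and self_mem_nhdsWithin).exists
    exact hz1 (hz z hz2)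

/-- The point may sit at height 0 or -n, where the global parametrisation is unavailable. An
identically vanishing gap on the local graph would also vanish near a neighbouring ordinate
different from both, where the graph agrees with the resonant curve. -/
theorem eventually_modeGap_graph_ne {ψ : ℝ → ℝ} (hN : 0 < N) (hk0 : 0 < k 0) (hk1 : 0 < k 1)
    (hσ : IsCriticalMode σ j) (hl : l ≠ j) (hμ : μ ∈ resonantSet N k) (hμ0 : μ ≠ 0)
    (hψ : ContDiffAt ℝ ω ψ (μ 1)) (hψμ : ψ (μ 1) = μ 0)
    (hψR : ∀ᶠ y in 𝓝 (μ 1), !₂[ψ y, y] ∈ resonantSet N k) :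
    ∀ᶠ y in 𝓝[≠] (μ 1), modeGap N k σ j l !₂[ψ y, y] ≠ 0 := by
  have hμe : (!₂[ψ (μ 1), μ 1] : Plane) = μ := by rw [hψμ, eta_pair]
  have han : AnalyticAt ℝ (fun y => modeGap N k σ j l !₂[ψ y, y]) (μ 1) :=
    analyticAt_modeGap_comp hN hk0 (by rwa [hμe]) (by rwa [hμe]) (contDiffAt_pair hψ)
  refine han.eventually_eq_zero_or_eventually_ne_zero.resolve_left fun h => ?_
  have hfin : ∀ᶠ y in 𝓝[≠] (μ 1), y ∈ ({0, -(k 1 : ℝ)} : Set ℝ)ᶜ :=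
    nhdsNE_le_cofinite _ (Set.toFinite _).compl_mem_cofinite
  obtain ⟨y, ⟨hyz, hyR⟩, hy⟩ := ((((eventually_eventually_nhds.2 h).and
    (eventually_eventually_nhds.2 hψR)).filter_mono nhdsWithin_le_nhds).and hfin).exists
  simp only [Set.mem_compl_iff, Set.mem_insert_iff, Set.mem_singleton_iff, not_or] at hy
  refine not_eventually_modeGap_eq_zero hN hk0 hk1 hσ hl hy.1 hy.2 ?_
  filter_upwards [hyz, hyR, eventually_ne_nhds hy.1, eventually_ne_nhds hy.2] with z h1 h2 h3 h4
  rw [resonantPoint, ← (mem_resonantSet_iff_eq_abscissa hN hk0 h3 h4 _).1 h2]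
  exact h1

theorem isDiscrete_exceptionalSet (hN : 0 < N) (hk0 : 0 < k 0) (hk1 : 0 < k 1) :
    IsDiscrete (exceptionalSet N k) := by
  suffices h : ∀ μ ∈ exceptionalSet N k, ∀ᶠ ν in 𝓝 μ, ν ∈ exceptionalSet N k → ν = μ by
    refine isDiscrete_iff_nhdsWithin.2 fun μ hμ => le_antisymm ?_ (pure_le_nhdsWithin hμ)
    refine le_pure_iff.2 (mem_nhdsWithin_iff_eventually.2 (h μ hμ))
  have hplus : IsCriticalMode 1 0 := Or.inl ⟨rfl, rfl⟩
  have hminus : IsCriticalMode (-1) 1 := Or.inr ⟨rfl, rfl⟩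
  intro μ hμ
  rcases eq_or_ne μ 0 with rfl | hμ0
  · have h : ∀ σ j, IsCriticalMode σ j →
        ∀ᶠ ν in 𝓝[resonantSet N k \ {0}] 0, ∀ l ≠ j, modeGap N k σ j l ν ≠ 0 := fun σ j hσ =>
      eventually_forall_modeGap_ne hN hk0 hσ.abs_eq fun l hl =>
        eventually_modeGap_ne hN hk0 hk1 hσ hl
    filter_upwards [eventually_nhdsWithin_iff.1 (h _ _ hplus),
      eventually_nhdsWithin_iff.1 (h _ _ hminus)] with ν h1 h2 hν
    by_contra hν0
    rcases exists_modeGap_eq_zero hN hk0 hν with ⟨l, hl, hz⟩ | ⟨l, hl, hz⟩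
    · exact h1 ⟨hν.1, hν0⟩ l hl hz
    · exact h2 ⟨hν.1, hν0⟩ l hl hz
  · obtain ⟨ψ, hψ, hψμ, hψR, hgraph⟩ := exists_analytic_graph hN hk0 hk1 hμ.1 hμ0
    have h : ∀ σ j, IsCriticalMode σ j →
        ∀ᶠ y in 𝓝[≠] (μ 1), ∀ l ≠ j, modeGap N k σ j l !₂[ψ y, y] ≠ 0 := fun σ j hσ =>
      eventually_forall_modeGap_ne hN hk0 hσ.abs_eq fun l hl =>
        eventually_modeGap_graph_ne hN hk0 hk1 hσ hl hμ.1 hμ0 hψ hψμ hψR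
    have hc : Tendsto (fun ν : Plane => ν 1) (𝓝 μ) (𝓝 (μ 1)) := by
      have : Continuous fun ν : Plane => ν 1 := by fun_prop
      exact this.tendsto μ
    filter_upwards [hgraph, hc.eventually (eventually_nhdsWithin_iff.1 (h _ _ hplus)),
      hc.eventually (eventually_nhdsWithin_iff.1 (h _ _ hminus))] with ν h0 h1 h2 hν
    have hνe := h0 hν.1
    -- On the local graph, equal ordinates mean equal points; a different ordinate lies in the
    -- punctured neighbourhood where no gap vanishes.
    by_cases hy : ν 1 = μ 1
    · rw [← eta_pair ν, ← eta_pair μ, ← hνe, hy, hψμ]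
    · exfalso
      rw [hνe, eta_pair] at h1 h2
      rcases exists_modeGap_eq_zero hN hk0 hν with ⟨l, hl, hz⟩ | ⟨l, hl, hz⟩
      · exact h1 hy l hl hz
      · exact h2 hy l hl hz

end AnalyticCurve

end Boussinesq

end

/-! ### Assembly of the theorem. -/

theorem mainTheorem2 (N : ℝ) (hN : 0 < N) (k : Freq) (hk0 : 0 < k 0) (hk1 : 0 < k 1) :
    IsDiscrete (exceptionalSet N k) ∧
    (∀ μ ∈ resonantSet N k \ exceptionalSet N k,
      (∃ ρ, IsSeparating N k μ ρ) ∧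
      eCoeff N k μ = -(b1 N k μ * b0 N k μ) ∧
      ∀ ρ, IsSeparating N k μ ρ →
        ∃ ε₀ > 0, ∃ r₁ r₂ r₃ r₄ r s : ℝ → ℝ,
          IsAnalyticO r₁ 2 ∧ IsAnalyticO r₂ 2 ∧ IsAnalyticO r₃ 2 ∧ IsAnalyticO r₄ 2 ∧
          IsAnalyticO r 2 ∧ IsAnalyticO s 1 ∧
          ∀ ε ∈ Set.Ioo 0 ε₀, ∃ M : Matrix (Fin 2) (Fin 2) ℂ, ∃ lp lm : ℂ,
            M = !![lambdaPlus N k μ + Complex.I * r₁ ε,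
                    Complex.I * b0 N k μ * ε + Complex.I * r₂ ε;
                  Complex.I * b1 N k μ * ε + Complex.I * r₃ ε,
                    lambdaPlus N k μ + Complex.I * r₄ ε] ∧
            lp = lambdaPlus N k μ + Complex.I * r ε
              + ε * Complex.sqrt ((eCoeff N k μ + s ε : ℝ) : ℂ) ∧
            lm = lambdaPlus N k μ + Complex.I * r ε
              - ε * Complex.sqrt ((eCoeff N k μ + s ε : ℝ) : ℂ) ∧
            Metric.sphere (lambdaPlus N k μ) ρ ⊆ resolventSetOf (restrictedOp N k μ ε) ∧
            Module.finrank ℂ (specSubspace N k μ ρ ε) = 2 ∧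
            IsRepresentedBy (restrictedOp N k μ ε) (specSubspace N k μ ρ ε)
              (specBasis N k μ ρ ε) M ∧
            eigenvaluesOn (restrictedOp N k μ ε) (specSubspace N k μ ρ ε) = {lp, lm} ∧
            M.charpoly = (Polynomial.X - Polynomial.C lp) * (Polynomial.X - Polynomial.C lm)) ∧
    (∀ y : ℝ, y ≠ 0 → y ≠ -(k 1 : ℝ) →
      ∀ x : ℝ, !₂[x, y] ∈ resonantSet N k ↔ x = resonantAbscissa N k y) ∧
    ((fun τ : ℝ => eCoeff N k (resonantPoint N k (k 1 * τ))
        - (k 0 : ℝ) ^ 2 * (k 1 : ℝ) ^ 2 / (4 * N ^ 2 * ‖vec k‖ ^ 2) * τ)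
      =O[𝓝[≠] 0] fun τ => τ ^ 2) ∧
    (∀ᶠ τ : ℝ in 𝓝[>] 0, 0 < eCoeff N k (resonantPoint N k (k 1 * τ))) ∧
    ((fun τ : ℝ => eCoeff N k (resonantPoint N k τ)
        - (k 0 : ℝ) ^ 2 / (256 * N ^ 2 * ‖vec k‖ ^ 6)
          * ((k 1 : ℝ) - √(3 * (k 0 : ℝ) ^ 2 + 4 * (k 1 : ℝ) ^ 2)) ^ 2
          * (3 * (k 0 : ℝ) ^ 2 + 2 * (k 1 : ℝ) ^ 2
            + (k 1 : ℝ) * √(3 * (k 0 : ℝ) ^ 2 + 4 * (k 1 : ℝ) ^ 2)) ^ 2)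
      =O[atTop] fun τ => τ⁻¹) ∧
    (0 < (k 0 : ℝ) ^ 2 / (256 * N ^ 2 * ‖vec k‖ ^ 6)
          * ((k 1 : ℝ) - √(3 * (k 0 : ℝ) ^ 2 + 4 * (k 1 : ℝ) ^ 2)) ^ 2
          * (3 * (k 0 : ℝ) ^ 2 + 2 * (k 1 : ℝ) ^ 2
            + (k 1 : ℝ) * √(3 * (k 0 : ℝ) ^ 2 + 4 * (k 1 : ℝ) ^ 2)) ^ 2) ∧
    (∀ᶠ τ : ℝ in atTop, 0 < eCoeff N k (resonantPoint N k τ)) := by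
  have hk : (0 : ℝ) < k 1 := by exact_mod_cast hk1
  have hK := norm_vec_pos hk0
  have hsmall : (fun τ : ℝ => eCoeff N k (resonantPoint N k (k 1 * τ))
      - (k 0 : ℝ) ^ 2 * (k 1 : ℝ) ^ 2 / (4 * N ^ 2 * ‖vec k‖ ^ 2) * τ)
      =O[𝓝[≠] 0] fun τ => τ ^ 2 := by
    -- The expansion in y is composed with y = nτ, which supplies the second factor n in the leading
    -- coefficient.
    have ht : Tendsto (fun τ : ℝ => (k 1 : ℝ) * τ) (𝓝[≠] 0) (𝓝[≠] 0) := by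
      refine tendsto_nhdsWithin_iff.2 ⟨?_, ?_⟩
      · have : Continuous fun τ : ℝ => (k 1 : ℝ) * τ := by fun_prop
        simpa using (this.tendsto 0).mono_left (nhdsWithin_le_nhds (s := {0}ᶜ))
      · filter_upwards [self_mem_nhdsWithin] with τ hτ
        exact mul_ne_zero hk.ne' hτ
    have h := (eCoeff_resonantPoint_small hN hk0 hk1).comp_tendsto ht
    refine (h.congr_left fun τ => ?_).trans
      ((isBigO_const_mul_self ((k 1 : ℝ) ^ 2) _ _).congr_left fun τ => (mul_pow _ _ 2).symm)
    simp only [Function.comp_apply]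
    ring
  have hlarge := eCoeff_resonantPoint_large hN hk0 hk1
  rw [eCoeffLarge_limit hN hk0] at hlarge
  have hk0' : (0 : ℝ) < k 0 := by exact_mod_cast hk0
  exact ⟨isDiscrete_exceptionalSet hN hk0 hk1,
    fun μ hμ => ⟨exists_isSeparating hN hk0 hμ, eCoeff_eq N k μ,
      fun ρ hρ => spectral_expansion hN hk0 hμ hρ⟩,
    fun y hy hy' x => mem_resonantSet_iff_eq_abscissa hN hk0 hy hy' x, hsmall,
    eventually_pos_of_isBigO_small (by positivity) hsmall, hlarge, eCoeff_limit_pos hN hk0 hk1,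
    eventually_pos_of_isBigO_large (eCoeff_limit_pos hN hk0 hk1) hlarge⟩
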